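/- **Setting.** A Turing machine here is a deterministic machine with finitely many two-way infinite tapes (one of them the input tape, one the output tape) over the alphabet {blank, 0, 1, separator}. Machines are described by binary words (a fixed effective encoding of transition tables, for which every word describes a machine), and $M_1, M_2, \dots$ is the enumeration of all Turing machines in which $M_i$ is described by the $i$-th binary word in the length-lexicographic order. A *classification domain* $\mathcal X\times\mathcal Y$ consists of two sets with injective encodings of their elements by binary words (all singletons being measurable). Samples $Z=(z_1,\dots,z_n)\in(\mathcal X\times\mathcal Y)^n$ are given to a machine as the word, of length denoted $|Z|$, that lists the encodings of $x_1,y_1,\dots,x_n,y_n$, each followed by a separator. A *predictor* is (the description of) a Turing machine. The output of a learner is a predictor, and a predictor may be run for at most as many steps as the learner that produced it: for a learner run for at most $s$ steps with output $f$, the error $\mathcal L_{\mathcal D}(f)$ is the probability, for $(x,y)\sim\mathcal D$, that $f$ on input $x$ does not within $s$ steps halt with output $y$; it is $1$ if the learner has no output. For $s\ge 0$, "$M_i$ run for at most $s$ steps" has an output only if $M_i$ halts within $s$ steps. $\log$ is the natural logarithm. **Lemma (Continuous Universal Learner).** For every classification domain $\mathcal X\times\mathcal Y$ there is a Turing machine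 $\mathcal A^+$, which does not depend on any time bound, with the following properties. Given samples $Z$, it never halts, and it signals (by entering one of certain distinguished states) infinitely often that a further step of its parallel simulation is completed. Time $T=0,1,2,\dots$ is measured in these simulation steps; "at time $T$" means at the moment of the signal number $T$, the first signal having number $0$. Let $\mathcal A^+_T(Z)$ be the word on the output tape at time $T$. 1. There is a constant $c$ such that for all samples $Z$ and all $T$, time $T$ is reached after at most $c\,(|Z|+T+1)^c$ actual steps of $\mathcal A^+$. 2. Let $k=\lfloor\log n\rfloor\ge 1$, let $Z\in(\mathcal X\times\mathcal Y)^n$, let $Z_{tr}$ be the first $\lfloor 0.99n\rfloor$ samples of $Z$ and $Z_{te}$ the remaining ones. For every $T$, $\mathcal A^+_T(Z)$ is the current best predictor: it is the output of some $M_j$, $1\le j\le k$, run on $Z_{tr}$ for at most $\lfloor T/k\rfloor$ steps, and no other of these $k$ outputs makes fewer errors on $Z_{te}$ (predictors being run for at most $\lfloor T/k\rfloor$ steps, and a missing output counting as an error at every point). 3. For every probability distribution $\mathcal D$ on $\mathcal X\times\mathcal Y$, every $n$ with $\log n\ge 1$ and every time $T$ at which $\mathcal A^+$ is halted, $$\mathbb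 E_{Z\sim\mathcal D^n}\big[\mathcal L_{\mathcal D}(\mathcal A^+_T(Z))\big]\;\le\;\min_{1\le i\le\log n}\ \mathbb E_{Z\sim\mathcal D^{\lfloor 0.99n\rfloor}}\big[\mathcal L_{\mathcal D}(\bar M_i(Z))\big]+10\sqrt2\,\sqrt{\frac{\log\log n+\log 2}{n}},$$ where $\bar M_i(Z)$ is the output of $M_i$ on $Z$ when run for at most $T/\log n$ steps, and where the predictor $\mathcal A^+_T(Z)$ is run for at most $T$ steps. -/

import Mathlib

/-! ### Turing machines

Deterministic Turing machines with finitely many two-way infinite tapes, over the alphabet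
consisting of the blank, the two bits and a separator. -/

/-- The tape alphabet. -/
inductive TapeSym : Type
  | blank : TapeSym
  | bit (b : Bool) : TapeSym
  | sep : TapeSym
  deriving DecidableEq

instance : Inhabited TapeSym := ⟨TapeSym.blank⟩

/-- A deterministic multi-tape Turing machine. `K` is the set of tapes, `Q` the set of states;
`δ q a` is the action in state `q` when `a k` is the symbol under the head of tape `k`: `none` means
that the machine halts, and `some (q', act)` means that it goes to state `q'`, writes `(act k).1`
on tape `k` and then moves the head of tape `k` as `(act k).2` says (`none`: the head stays). -/
structure TM : Type 1 where
  K : Type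
  finK : Finite K
  Q : Type
  finQ : Finite Q
  inp : K
  out : K
  start : Q
  δ : Q → (K → TapeSym) → Option (Q × (K → TapeSym × Option Turing.Dir))

namespace TM

/-- A configuration: the state, and the tapes (each with the position of its head). -/
structure Cfg (M : TM) : Type where
  state : M.Q
  tape : M.K → Turing.Tape TapeSym

variable (M : TM)

/-- Write a symbol, then move the head. -/
def act (a : TapeSym × Option Turing.Dir) (t : Turing.Tape TapeSym) : Turing.Tape TapeSym :=
  match a.2 with
  | none => t.write a.1
  | some d => (t.write a.1).move d

/-- One step; `none` if the machine halts. -/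
def step (c : M.Cfg) : Option M.Cfg :=
  (M.δ c.state fun k => (c.tape k).head).map fun p =>
    ⟨p.1, fun k => act (p.2 k) (c.tape k)⟩

/-- The machine has halted in the configuration `c`. -/
def Halted (c : M.Cfg) : Prop := M.step c = none

open Classical in
/-- The initial configuration: the word `v` on the input tape with the head on its first letter,
all other tapes blank. -/
noncomputable def init (v : List TapeSym) : M.Cfg :=
  ⟨M.start, fun k => Turing.Tape.mk₁ (if k = M.inp then v else [])⟩

/-- The configuration after `t` steps on input `v` (a machine that has halted does not move). -/
noncomputable def run (v : List TapeSym) (t : ℕ) : M.Cfg :=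
  (fun c => (M.step c).getD c)^[t] (M.init v)

end TM

/-- The tape carries, from the head to the right, the binary word `w` followed by a blank. -/
def Spells (t : Turing.Tape TapeSym) (w : List Bool) : Prop :=
  ∀ j : ℕ, j ≤ w.length → t.nth j = (w.map TapeSym.bit).getD j TapeSym.blank

theorem Spells.unique {t : Turing.Tape TapeSym} {w w' : List Bool} (h : Spells t w)
    (h' : Spells t w') : w = w' := by
  have key : ∀ {u u' : List Bool}, Spells t u → Spells t u' → u'.length ≤ u.length := by
    intro u u' hu hu'
    by_contra! hlt
    have h1 := hu u.length le_rfl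
    have h2 := hu' u.length hlt.le
    rw [h1] at h2
    simp [List.getD_eq_getElem?_getD, hlt] at h2
  have hl : w.length = w'.length := le_antisymm (key h' h) (key h h')
  refine List.ext_getElem hl fun j hj hj' => ?_
  have h1 := h j hj.le
  rw [h' j hj'.le] at h1
  simp [List.getD_eq_getElem?_getD, hj, hj'] at h1
  exact h1.symm

open Classical in
/-- The binary word on a tape, if there is one. -/
noncomputable def readWord (t : Turing.Tape TapeSym) : Option (List Bool) :=
  if h : ∃ w, Spells t w then some h.choose else none

theorem readWord_eq_some {t : Turing.Tape TapeSym} {w : List Bool} :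
    readWord t = some w ↔ Spells t w := by
  unfold readWord
  constructor
  · intro h
    split at h
    · rename_i hw
      rw [← Option.some.inj h]
      exact hw.choose_spec
    · simp at h
  · intro h
    have hw : ∃ w, Spells t w := ⟨w, h⟩
    rw [dif_pos hw, hw.choose_spec.unique h]

namespace TM

variable (M : TM)

/-- What the output tape shows after `t` steps on input `v`. -/
noncomputable def shows (v : List TapeSym) (t : ℕ) : Option (List Bool) :=
  readWord ((M.run v t).tape M.out)

open Classical in
/-- The output of `M` on input `v` when it is run for at most `s` steps: there is one only if `M`
halts within `s` steps with a binary word on its output tape. -/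
noncomputable def result (v : List TapeSym) (s : ℕ) : Option (List Bool) :=
  if M.Halted (M.run v s) then M.shows v s else none

/-- After exactly `t` steps on input `v`, the machine is in one of the states in `tick`. -/
def TicksAt (tick : Set M.Q) (v : List TapeSym) (t : ℕ) : Prop := (M.run v t).state ∈ tick

/-- The number of steps of the machine on input `v` before the tick number `T`
(the ticks are numbered from `0`). -/
noncomputable def tickTime (tick : Set M.Q) (v : List TapeSym) (T : ℕ) : ℕ :=
  Nat.nth (M.TicksAt tick v) T

end TM

/-! ### Descriptions of machines by binary words, and the enumeration of machines -/

/-- The natural numbers given by a binary word `1…10 1…10 …` in unary notation; `m` ones have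
already been read. -/
def unaryFieldsAux : ℕ → List Bool → List ℕ
  | _, [] => []
  | m, true :: w => unaryFieldsAux (m + 1) w
  | m, false :: w => m :: unaryFieldsAux 0 w

/-- The sequence of natural numbers given by a binary word in unary notation. -/
def unaryFields (w : List Bool) : List ℕ := unaryFieldsAux 0 w

/-- The symbol with a given number. -/
def symOfNat : ℕ → TapeSym
  | 0 => TapeSym.blank
  | 1 => TapeSym.bit false
  | 2 => TapeSym.bit true
  | _ => TapeSym.sep

/-- The head movement with a given number. -/
def moveOfNat : ℕ → Option Turing.Dir
  | 0 => none
  | 1 => some Turing.Dir.left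
  | _ => some Turing.Dir.right

/-- The machine described by a sequence `k, q, o, r₀, r₁, …` of numbers: it has the tapes `0, …, k`,
the states `0, …, q`, input tape `0`, output tape `o` and start state `0`. What follows is its
program, a list of rules of `2 + 3 (k + 1)` numbers each: a state, the next state, and for every
tape the symbol read, the symbol written and the movement. The machine executes the first rule that
applies, and halts if there is none. (Numbers of states and tapes that are too large are reduced
modulo `q + 1` and `k + 1`, an incomplete last rule is ignored.) -/
def machineOfFields (L : List ℕ) : TM :=
  let k := L.getD 0 0
  let q := L.getD 1 0
  let size := 2 + 3 * (k + 1)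
  let field : ℕ → ℕ → ℕ := fun r j => L.getD (3 + r * size + j) 0
  { K := Fin (k + 1)
    finK := inferInstance
    Q := Fin (q + 1)
    finQ := inferInstance
    inp := 0
    out := Fin.ofNat (k + 1) (L.getD 2 0)
    start := 0
    δ := fun p a =>
      ((List.range ((L.length - 3) / size)).find? fun r =>
        decide (Fin.ofNat (q + 1) (field r 0) = p ∧
          ∀ j : Fin (k + 1), symOfNat (field r (2 + 3 * j)) = a j)).map fun r =>
        (Fin.ofNat (q + 1) (field r 1), fun j =>
          (symOfNat (field r (3 + 3 * j)), moveOfNat (field r (4 + 3 * j)))) }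

/-- The machine described by a binary word. -/
def decodeTM (w : List Bool) : TM := machineOfFields (unaryFields w)

/-- The `i`-th binary word (`i ≥ 1`), the words being ordered by length and then
lexicographically: the binary expansion of `i` without its leading one. -/
def binaryWord (i : ℕ) : List Bool := (Nat.bits i).reverse.tail

/-- The enumeration `M₁, M₂, …` of all Turing machines, in the lexicographic order of their
descriptions. -/
def machine (i : ℕ) : TM := decodeTM (binaryWord i)

/-! ### Supervised classification -/

section Learning

variable {X Y : Type*}

/-- A binary word as a word over the tape alphabet. -/
def bitsToSym (w : List Bool) : List TapeSym := w.map TapeSym.bit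

/-- The word that presents the samples `(x₁, y₁), …, (xₘ, yₘ)` to a machine: the encodings of
`x₁, y₁, x₂, y₂, …`, each followed by a separator. -/
def encodeSamples (encX : X → List Bool) (encY : Y → List Bool) {m : ℕ} (Z : Fin m → X × Y) :
    List TapeSym :=
  (List.ofFn Z).flatMap fun z =>
    bitsToSym (encX z.1) ++ [TapeSym.sep] ++ bitsToSym (encY z.2) ++ [TapeSym.sep]

/-- The output `f` of a learner predicts the label `y` at the point `x` within `s` steps: `f` is the
description of a machine which, on the encoding of `x`, halts within `s` steps with the encoding of
`y` as its output. -/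
def Predicts (encX : X → List Bool) (encY : Y → List Bool) (s : ℕ) (f : Option (List Bool))
    (z : X × Y) : Prop :=
  ∃ w, f = some w ∧ (decodeTM w).result (bitsToSym (encX z.1)) s = some (encY z.2)

/-- The test error on the distribution `D` of the output `f` of a learner, the predictor being run
for at most `s` steps: the probability that it does not output the correct label. In particular it
is `1` if the learner has not output any predictor. -/
noncomputable def testError [MeasurableSpace X] [MeasurableSpace Y] (encX : X → List Bool)
    (encY : Y → List Bool) (D : MeasureTheory.Measure (X × Y)) (s : ℕ) (f : Option (List Bool)) :
    ℝ :=
  D.real {z | ¬ Predicts encX encY s f z}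

/-- The output of the learner `Mᵢ` on the samples `Z`, when it is run for at most `s` steps. -/
noncomputable def learned (encX : X → List Bool) (encY : Y → List Bool) (i s : ℕ) {m : ℕ}
    (Z : Fin m → X × Y) : Option (List Bool) :=
  (machine i).result (encodeSamples encX encY Z) s

/-- The training part of the samples: the first `⌊0.99 n⌋` of them. -/
def trainPart {n : ℕ} (Z : Fin n → X × Y) : Fin (99 * n / 100) → X × Y :=
  fun j => Z (Fin.castLE (by omega) j)

/-- The number of errors on the remaining samples of the output `f` of a learner, the predictor
being run for at most `s` steps. -/
noncomputable def heldOutErrors (encX : X → List Bool) (encY : Y → List Bool) (s : ℕ)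
    (f : Option (List Bool)) {n : ℕ} (Z : Fin n → X × Y) : ℕ :=
  {j : Fin n | 99 * n / 100 ≤ (j : ℕ) ∧ ¬ Predicts encX encY s f (Z j)}.ncard

/-- `f` is a current best predictor after `s` steps of each of the machines `M₁, …, Mₖ` on the
training part of the samples: it is the output of one of them, and none of the outputs has fewer
errors on the remaining samples. -/
def IsCurrentBest (encX : X → List Bool) (encY : Y → List Bool) (k s : ℕ) {n : ℕ}
    (Z : Fin n → X × Y) (f : Option (List Bool)) : Prop :=
  ∃ j ∈ Set.Icc 1 k, f = learned encX encY j s (trainPart Z) ∧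
    ∀ i ∈ Set.Icc 1 k, heldOutErrors encX encY s f Z ≤
      heldOutErrors encX encY s (learned encX encY i s (trainPart Z)) Z

end Learning

/-!
The learner `A` works in stages. In stage `T` it simulates each of the first `k = ⌊log n⌋` machines
for `T / k` steps on the training part of the samples, counts the errors of the resulting predictors
(each run for `T / k` steps, too) on the held-out part, and writes the best of them on the output
tape. Every stage starts afresh, so that the output of stage `T` is a function `bestOutput v T` of
the input `v` and of `T`, and all that has to be known about it is that it selects correctly
(`isCurrentBest_bestOutput`) and that it is computable in polynomial time (`PolyTime.bestOutput`).

*Polynomial time.* The data are binary trees, which are written on a stack as self-delimiting words.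
A function of trees is `Feasible` if one program for a machine with five stacks replaces the argument
on top of the main stack by the value in polynomially many steps. This notion is closed under
composition, pairing, case distinction and under iteration as long as the intermediate values remain
of polynomial size (`Feasible.iterate`). `PolyTime` transfers it to functions of numbers, lists and
options, and `fun_prop` then derives that a function is computable in polynomial time from its
definition. The two functions that need an argument of their own are the simulation of a machine
given by its description (`simResult_eq`, `PolyTime.simResult`) and `⌊log n⌋`, for which one has to
decide whether `exp j ≤ n`: the Padé approximants of the exponential function at `j` are quotients of
integers that satisfy a simple recurrence, the error of the approximant number `4 j²` is so small
that the question reduces to an inequality of integers (`exp_le_iff`), and these integers have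
polynomially many binary digits.

*The clock.* `clockMachine F G` runs a program `F` that reads the input, and then the program `G` of
one stage over and over again, with a tick state in between (`clockMachine_ticks`). Since the stage
`T` takes a time that is polynomial in `|v| + T`, so does everything until tick `T`
(`exists_learner`).

*The error.* The `k` candidates depend only on the training samples, so that conditionally on these
the held-out error of each candidate is an average of `N ≥ n / 100` independent variables. By
Hoeffding's lemma the exponential moments of the difference between the true error and the held-out
error are at most `exp (t ^ 2 / (8 N))`; summing over the candidates and optimizing `t`, the selected
candidate is in expectation worse than any fixed one by at most `√(log k / (2 N))`
(`integral_selected_le`). As `k ≤ log n`, this is less than the claimed bound. A larger time budget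
only helps a predictor, and it only helps a learner to produce its output in time, which accounts for
the different budgets on both sides (`Predicts.mono`, `Predicts.learned_mono`). The encodings being
injective, the domain is countable and all functions on samples are measurable.
-/

section Machines

open Turing

/-! ### Programs for a machine with five stacks -/

/-- The five tapes of the machine under construction, each used as a stack: the input tape, the
output tape, the stack with the data, a stack for data that are put aside, and a scratch stack for
counters and copies. -/
inductive Stk : Type
  | inp | out | main | aux | cnt
  deriving DecidableEq

instance : Finite Stk :=
  Finite.of_injective (fun k : Stk => match k with
    | .inp => (0 : Fin 5) | .out => 1 | .main => 2 | .aux => 3 | .cnt => 4) (by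
    intro a b h; cases a <;> cases b <;> first | rfl | simp at h)

/-- The five tapes, with their contents and the positions of the heads. -/
abbrev Tapes := Stk → Tape TapeSym

/-- A fragment of a Turing machine: like a machine, except that instead of halting it performs a
last action and leaves through its exit (the next state `none`). -/
structure Frag where
  Q : Type
  finQ : Finite Q
  start : Q
  δ : Q → (Stk → TapeSym) → Option Q × (Stk → TapeSym × Option Dir)

/-- Perform one action on every tape. -/
def actAll (p : Stk → TapeSym × Option Dir) (τ : Tapes) : Tapes := fun k => TM.act (p k) (τ k)

/-- The symbols under the heads. -/
def heads (τ : Tapes) : Stk → TapeSym := fun k => (τ k).head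

namespace Frag

/-- `F.Exec q τ t τ'`: started in state `q` on the tapes `τ`, the fragment leaves through its exit
after exactly `t` steps, with the tapes `τ'`. -/
inductive Exec (F : Frag) : F.Q → Tapes → ℕ → Tapes → Prop
  | exit {q τ a} (h : F.δ q (heads τ) = (none, a)) : Exec F q τ 1 (actAll a τ)
  | step {q q' τ a t τ'} (h : F.δ q (heads τ) = (some q', a))
      (h' : Exec F q' (actAll a τ) t τ') : Exec F q τ (t + 1) τ'

/-- The action that changes nothing. -/
def noAct (h : Stk → TapeSym) : Stk → TapeSym × Option Dir := fun k => (h k, none)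

@[simp] theorem actAll_noAct (τ : Tapes) : actAll (noAct (heads τ)) τ = τ := by
  funext k
  simp [actAll, noAct, TM.act, heads]

/-- Run `F`, then `G`. -/
def seq (F G : Frag) : Frag where
  Q := F.Q ⊕ G.Q
  finQ := by have := F.finQ; have := G.finQ; infer_instance
  start := .inl F.start
  δ := fun q h => match q with
    | .inl q => match F.δ q h with
      | (some q', a) => (some (.inl q'), a)
      | (none, a) => (some (.inr G.start), a)
    | .inr q => match G.δ q h with
      | (some q', a) => (some (.inr q'), a)
      | (none, a) => (none, a)

/-- Run `F` or `G`, according to a test on the symbol on top of the stack `k`. -/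
def ite (k : Stk) (p : TapeSym → Bool) (F G : Frag) : Frag where
  Q := Option (F.Q ⊕ G.Q)
  finQ := by have := F.finQ; have := G.finQ; infer_instance
  start := none
  δ := fun q h => match q with
    | none => (some (some (if p (h k) then .inl F.start else .inr G.start)), noAct h)
    | some (.inl q) => match F.δ q h with
      | (some q', a) => (some (some (.inl q')), a)
      | (none, a) => (none, a)
    | some (.inr q) => match G.δ q h with
      | (some q', a) => (some (some (.inr q')), a)
      | (none, a) => (none, a)

/-- Run `F` as long as the symbol on top of the stack `k` passes a test. -/
def loop (k : Stk) (p : TapeSym → Bool) (F : Frag) : Frag where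
  Q := Option F.Q
  finQ := by have := F.finQ; infer_instance
  start := none
  δ := fun q h => match q with
    | none => (if p (h k) then some (some F.start) else none, noAct h)
    | some q => match F.δ q h with
      | (some q', a) => (some (some q'), a)
      | (none, a) => (some none, a)

/-- A single step. -/
def prim (f : (Stk → TapeSym) → (Stk → TapeSym × Option Dir)) : Frag where
  Q := Unit
  finQ := inferInstance
  start := ()
  δ := fun _ h => (none, f h)

theorem Exec.prim (f) (τ : Tapes) : (prim f).Exec () τ 1 (actAll (f (heads τ)) τ) :=
  .exit rfl

theorem Exec.seq_right {F G : Frag} {q τ t τ'} (h : G.Exec q τ t τ') :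
    (seq F G).Exec (.inr q) τ t τ' := by
  induction h with
  | exit h => exact .exit (by simp [seq, h])
  | step h _ ih => exact .step (by simp [seq, h]) ih

theorem Exec.seq {F G : Frag} {q τ t τ' t' τ''} (h : F.Exec q τ t τ')
    (h' : G.Exec G.start τ' t' τ'') : (seq F G).Exec (.inl q) τ (t + t') τ'' := by
  induction h with
  | exit h => rw [add_comm]; exact .step (by simp [Frag.seq, h]) h'.seq_right
  | step h _ ih => rw [add_right_comm]; exact .step (by simp [Frag.seq, h]) (ih h')

theorem Exec.ite_left {k p} {F G : Frag} {q τ t τ'} (h : F.Exec q τ t τ') :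
    (ite k p F G).Exec (some (.inl q)) τ t τ' := by
  induction h with
  | exit h => exact .exit (by simp [ite, h])
  | step h _ ih => exact .step (by simp [ite, h]) ih

theorem Exec.ite_right {k p} {F G : Frag} {q τ t τ'} (h : G.Exec q τ t τ') :
    (ite k p F G).Exec (some (.inr q)) τ t τ' := by
  induction h with
  | exit h => exact .exit (by simp [ite, h])
  | step h _ ih => exact .step (by simp [ite, h]) ih

theorem Exec.ite_true {k p} {F G : Frag} {τ t τ'} (hp : p (τ k).head = true)
    (h : F.Exec F.start τ t τ') : (ite k p F G).Exec none τ (t + 1) τ' := by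
  refine .step (a := noAct (heads τ)) (q' := some (.inl F.start)) ?_ ?_
  · simp [ite, heads, hp]
  · simpa using h.ite_left

theorem Exec.ite_false {k p} {F G : Frag} {τ t τ'} (hp : p (τ k).head = false)
    (h : G.Exec G.start τ t τ') : (ite k p F G).Exec none τ (t + 1) τ' := by
  refine .step (a := noAct (heads τ)) (q' := some (.inr G.start)) ?_ ?_
  · simp [ite, heads, hp]
  · simpa using h.ite_right

theorem Exec.loop_body {k p} {F : Frag} {q τ t τ' t' τ''} (h : F.Exec q τ t τ')
    (h' : (loop k p F).Exec none τ' t' τ'') : (loop k p F).Exec (some q) τ (t + t') τ'' := by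
  induction h with
  | exit h => rw [add_comm]; exact .step (by simp [loop, h]) h'
  | step h _ ih => rw [add_right_comm]; exact .step (by simp [loop, h]) (ih h')

theorem Exec.loop_cons {k p} {F : Frag} {τ t τ' t' τ''} (hp : p (τ k).head = true)
    (h : F.Exec F.start τ t τ') (h' : (loop k p F).Exec none τ' t' τ'') :
    (loop k p F).Exec none τ (t + t' + 1) τ'' := by
  refine .step (a := noAct (heads τ)) (q' := some F.start) ?_ ?_
  · simp [loop, heads, hp]
  · simpa using h.loop_body h'

theorem Exec.loop_nil {k p} {F : Frag} {τ : Tapes} (hp : p (τ k).head = false) :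
    (loop k p F).Exec none τ 1 τ := by
  have := Exec.exit (F := loop k p F) (q := none) (τ := τ) (a := noAct (heads τ))
    (by simp [loop, heads, hp])
  simpa using this

end Frag

/-- The contents of the five stacks. -/
structure Stacks where
  inp : List TapeSym
  out : List TapeSym
  main : List TapeSym
  aux : List TapeSym
  cnt : List TapeSym

namespace Stacks

/-- The content of one stack. -/
def get (σ : Stacks) : Stk → List TapeSym
  | .inp => σ.inp | .out => σ.out | .main => σ.main | .aux => σ.aux | .cnt => σ.cnt

/-- Replace the content of one stack. -/
def set (σ : Stacks) (k : Stk) (l : List TapeSym) : Stacks :=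
  match k with
  | .inp => { σ with inp := l }
  | .out => { σ with out := l }
  | .main => { σ with main := l }
  | .aux => { σ with aux := l }
  | .cnt => { σ with cnt := l }

theorem get_set (σ : Stacks) (k j : Stk) (l : List TapeSym) :
    (σ.set k l).get j = if j = k then l else σ.get j := by
  cases k <;> cases j <;> rfl

/-- A stack is kept on a tape from the head to the right, with the top under the head. -/
def tapes (σ : Stacks) : Tapes := fun k => Tape.mk₁ (σ.get k)

end Stacks

theorem mk₁_head (l : List TapeSym) : (Tape.mk₁ l).head = l.headI := by
  cases l <;> rfl

theorem mk₁_pop (l : List TapeSym) :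
    ((Tape.mk₁ l).write .blank).move Dir.right = Tape.mk₁ l.tail := by
  have h : (ListBlank.mk ([] : List TapeSym)).cons TapeSym.blank = ListBlank.mk [] := by
    rw [ListBlank.cons_mk]
    exact Quotient.sound' (Or.inr ⟨1, rfl⟩)
  rw [Tape.mk₁, Tape.mk₂, Tape.write_mk', Tape.move_right_mk', ListBlank.head_cons,
    ListBlank.tail_cons, h, ListBlank.tail_mk]
  rfl

theorem mk₁_push (l : List TapeSym) (a : TapeSym) :
    ((Tape.mk₁ l).move Dir.left).write a = Tape.mk₁ (a :: l) := by
  simp [Tape.mk₁, Tape.mk₂, Tape.move_left_mk', Tape.write_mk',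
    ListBlank.cons_mk]

namespace Frag

/-- Within `T` steps, the fragment transforms the stacks `σ` into `σ'`. -/
def Runs (F : Frag) (σ σ' : Stacks) (T : ℕ) : Prop :=
  ∃ t ≤ T, F.Exec F.start σ.tapes t σ'.tapes

theorem Runs.mono {F : Frag} {σ σ' T T'} (h : F.Runs σ σ' T) (hT : T ≤ T') : F.Runs σ σ' T' :=
  let ⟨t, ht, h⟩ := h
  ⟨t, ht.trans hT, h⟩

theorem Runs.seq {F G : Frag} {σ σ' σ'' T T'} (h : F.Runs σ σ' T) (h' : G.Runs σ' σ'' T') :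
    (seq F G).Runs σ σ'' (T + T') :=
  let ⟨_, ht, h⟩ := h
  let ⟨_, ht', h'⟩ := h'
  ⟨_, add_le_add ht ht', h.seq h'⟩

theorem tapes_head (σ : Stacks) (k : Stk) : (σ.tapes k).head = (σ.get k).headI := mk₁_head _

theorem Runs.ite_true {k p} {F G : Frag} {σ σ' T} (hp : p (σ.get k).headI = true)
    (h : F.Runs σ σ' T) : (ite k p F G).Runs σ σ' (T + 1) :=
  let ⟨_, ht, h⟩ := h
  ⟨_, Nat.succ_le_succ ht, h.ite_true (by rwa [tapes_head])⟩

theorem Runs.ite_false {k p} {F G : Frag} {σ σ' T} (hp : p (σ.get k).headI = false)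
    (h : G.Runs σ σ' T) : (ite k p F G).Runs σ σ' (T + 1) :=
  let ⟨_, ht, h⟩ := h
  ⟨_, Nat.succ_le_succ ht, h.ite_false (by rwa [tapes_head])⟩

theorem Runs.loop_cons {k p} {F : Frag} {σ σ' σ'' T T'} (hp : p (σ.get k).headI = true)
    (h : F.Runs σ σ' T) (h' : (loop k p F).Runs σ' σ'' T') :
    (loop k p F).Runs σ σ'' (T + T' + 1) :=
  let ⟨_, ht, h⟩ := h
  let ⟨_, ht', h'⟩ := h'
  ⟨_, Nat.succ_le_succ (add_le_add ht ht'), h.loop_cons (by rwa [tapes_head]) h'⟩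

theorem Runs.loop_nil {k p} {F : Frag} {σ : Stacks} (hp : p (σ.get k).headI = false) :
    (loop k p F).Runs σ σ 1 :=
  ⟨1, le_rfl, .loop_nil (by rwa [tapes_head])⟩

/-- Do nothing. -/
def nop : Frag := prim noAct

/-- Pop the stack `k`. -/
def pop (k : Stk) : Frag :=
  prim fun h j => if j = k then (.blank, some .right) else (h j, none)

/-- Push a symbol, which may depend on the tops of the other stacks, on the stack `k`. -/
def pushWith (k : Stk) (f : (Stk → TapeSym) → TapeSym) : Frag :=
  seq (prim fun h j => (h j, if j = k then some .left else none))
    (prim fun h j => (if j = k then f h else h j, none))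

/-- Push a symbol on the stack `k`. -/
def push (k : Stk) (a : TapeSym) : Frag := pushWith k fun _ => a

/-- Push a copy of the top of the stack `k` on the stack `k'`. -/
def copyTop (k k' : Stk) : Frag := pushWith k' fun h => h k

/-- Move the top of the stack `k` to the stack `k'`. -/
def xfer (k k' : Stk) : Frag := seq (copyTop k k') (pop k)

theorem nop_runs (σ : Stacks) : nop.Runs σ σ 1 := by
  refine ⟨1, le_rfl, ?_⟩
  have := Exec.prim noAct σ.tapes
  rwa [actAll_noAct] at this

theorem pop_runs (k : Stk) (σ : Stacks) : (pop k).Runs σ (σ.set k (σ.get k).tail) 1 := by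
  refine ⟨1, le_rfl, ?_⟩
  have h := Exec.prim (fun h j => if j = k then (.blank, some .right) else (h j, none)) σ.tapes
  refine (?_ : (σ.set k (σ.get k).tail).tapes = _) ▸ h
  funext j
  by_cases hj : j = k
  · subst hj
    simp [actAll, TM.act, Stacks.tapes, Stacks.get_set, mk₁_pop]
  · simp [actAll, TM.act, heads, Stacks.tapes, Stacks.get_set, hj]

theorem pushWith_runs (k : Stk) (f : (Stk → TapeSym) → TapeSym) (a : TapeSym) (σ : Stacks)
    (hf : ∀ h : Stk → TapeSym, (∀ j, j ≠ k → h j = (σ.get j).headI) → f h = a) :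
    (pushWith k f).Runs σ (σ.set k (a :: σ.get k)) 2 := by
  refine ⟨2, le_rfl, ?_⟩
  have key : ∀ j, actAll (fun j => (heads σ.tapes j, if j = k then some Dir.left else none))
      σ.tapes j = if j = k then (Tape.mk₁ (σ.get k)).move Dir.left else σ.tapes j := by
    intro j
    by_cases hj : j = k
    · subst hj
      simp [actAll, TM.act, heads, Stacks.tapes]
    · simp [actAll, TM.act, heads, hj]
  have h₁ := Exec.prim (fun h j => (h j, if j = k then some Dir.left else none)) σ.tapes
  simp only [funext key] at h₁
  have h₂ := Exec.prim (fun h j => (if j = k then f h else h j, none))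
    fun j => if j = k then (Tape.mk₁ (σ.get k)).move Dir.left else σ.tapes j
  refine (?_ : (σ.set k (a :: σ.get k)).tapes = _) ▸ h₁.seq h₂
  rw [hf]
  · funext j
    by_cases hj : j = k
    · subst hj
      simp [actAll, TM.act, Stacks.tapes, Stacks.get_set, mk₁_push]
    · simp [actAll, TM.act, heads, Stacks.tapes, Stacks.get_set, hj]
  · intro j hj
    simp [heads, hj, tapes_head]

theorem push_runs (k : Stk) (a : TapeSym) (σ : Stacks) :
    (push k a).Runs σ (σ.set k (a :: σ.get k)) 2 :=
  pushWith_runs k _ a σ fun _ _ => rfl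

theorem copyTop_runs {k k' : Stk} (hk : k ≠ k') (σ : Stacks) :
    (copyTop k k').Runs σ (σ.set k' ((σ.get k).headI :: σ.get k')) 2 :=
  pushWith_runs k' _ _ σ fun _ h => h k hk

theorem xfer_runs {k k' : Stk} (hk : k ≠ k') (σ : Stacks) :
    (xfer k k').Runs σ ((σ.set k' ((σ.get k).headI :: σ.get k')).set k (σ.get k).tail) 3 := by
  have := (copyTop_runs hk σ).seq (pop_runs k _)
  rwa [Stacks.get_set, if_neg hk] at this

end Frag

/-! ### Computation with trees -/

/-- Binary trees, the data on which the machine computes. -/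
inductive STree : Type
  | nil : STree
  | node : STree → STree → STree

namespace STree

/-- The prefix code of a tree, which is self-delimiting. -/
def word : STree → List TapeSym
  | nil => [.bit false]
  | node x y => .bit true :: (x.word ++ y.word)

/-- The number of symbols in the code of a tree. -/
def size : STree → ℕ
  | nil => 1
  | node x y => x.size + y.size + 1

@[simp] theorem length_word (x : STree) : x.word.length = x.size := by
  induction x with
  | nil => rfl
  | node x y hx hy => simp [word, size, hx, hy]

theorem size_pos (x : STree) : 0 < x.size := by
  cases x <;> simp [size]

theorem ne_sep_of_mem_word {x : STree} {s : TapeSym} (h : s ∈ x.word) : s ≠ .sep := by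
  induction x with
  | nil => simp [word] at h; simp [h]
  | node x y hx hy =>
    simp only [word, List.mem_cons, List.mem_append] at h
    rcases h with rfl | h | h
    · simp
    · exact hx h
    · exact hy h

/-- The left subtree. -/
def left : STree → STree
  | nil => nil
  | node x _ => x

/-- The right subtree. -/
def right : STree → STree
  | nil => nil
  | node _ y => y

/-- The length of the right spine; a tree is used as a counter with this value. -/
def spine : STree → ℕ
  | nil => 0
  | node _ y => y.spine + 1

theorem spine_lt_size (x : STree) : x.spine < x.size := by
  induction x with
  | nil => simp [spine, size]
  | node x y _ hy => simp only [spine, size]; omega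

/-- The tree is not just a leaf. -/
def isNode : STree → Bool
  | nil => false
  | node _ _ => true

end STree

namespace Frag

/-- The symbol is the digit one. -/
def isOne (s : TapeSym) : Bool := decide (s = .bit true)

/-- The symbol is not a separator. -/
def notSep (s : TapeSym) : Bool := decide (s ≠ .sep)

/-- Move the code of one tree from the main stack to the auxiliary stack, which reverses it. The
stack `cnt` holds one digit for every tree that is still to be read. -/
def moveTree : Frag :=
  seq (push .cnt .sep) <| seq (push .cnt (.bit true)) <|
    seq (loop .cnt isOne <| seq (pop .cnt) <| ite .main isOne
      (seq (push .cnt (.bit true)) (seq (push .cnt (.bit true)) (xfer .main .aux)))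
      (xfer .main .aux)) (pop .cnt)

/-- The loop of `moveTree` in continuation form: reading a tree and then doing what `F` does from
there costs a number of steps that is linear in the size of the tree. In this form the induction on
the tree applies to both subtrees of a node in succession. -/
theorem moveTree_loop_runs (x : STree) {i o m a c σ T} :
    let F := loop .cnt isOne <| seq (pop .cnt) <| ite .main isOne
      (seq (push .cnt (.bit true)) (seq (push .cnt (.bit true)) (xfer .main .aux)))
      (xfer .main .aux)
    F.Runs ⟨i, o, m, x.word.reverse ++ a, c⟩ σ T →
      F.Runs ⟨i, o, x.word ++ m, a, .bit true :: c⟩ σ (T + 10 * x.size) := by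
  intro F
  induction x generalizing m a c T with
  | nil =>
    intro h
    refine Runs.mono (Runs.loop_cons rfl ((pop_runs _ _).seq
      (Runs.ite_false rfl (xfer_runs (by decide) _))) h) ?_
    simp only [STree.size]
    omega
  | node x y hx hy =>
    intro h
    have h' : F.Runs ⟨i, o, m, y.word.reverse ++ (x.word.reverse ++ .bit true :: a), c⟩ σ T := by
      simpa [STree.word] using h
    have h'' := hx (hy h')
    have e : (x.node y).word ++ m = .bit true :: (x.word ++ (y.word ++ m)) := by simp [STree.word]
    rw [e]
    refine Runs.mono (Runs.loop_cons rfl ((pop_runs _ _).seq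
      (Runs.ite_true rfl ((push_runs _ _ _).seq ((push_runs _ _ _).seq
        (xfer_runs (by decide) _))))) h'') ?_
    simp only [STree.size]
    omega

theorem moveTree_runs (x : STree) (i o m a c) :
    moveTree.Runs ⟨i, o, x.word ++ m, a, c⟩ ⟨i, o, m, x.word.reverse ++ a, c⟩
      (6 + 10 * x.size) :=
  Runs.mono ((push_runs _ _ _).seq ((push_runs _ _ _).seq
    ((moveTree_loop_runs x (Runs.loop_nil rfl)).seq (pop_runs _ _)))) (by omega)

theorem xfer_aux_runs (w : List TapeSym) (hw : ∀ s ∈ w, s ≠ .sep) (i o m a c) :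
    (loop .aux notSep (xfer .aux .main)).Runs ⟨i, o, m, w ++ .sep :: a, c⟩
      ⟨i, o, w.reverse ++ m, .sep :: a, c⟩ (4 * w.length + 1) := by
  induction w generalizing m with
  | nil => exact Runs.loop_nil rfl
  | cons s w ih =>
    have := ih (fun t ht => hw t (List.mem_cons_of_mem _ ht)) (s :: m)
    rw [List.reverse_cons, List.append_assoc]
    refine Runs.mono (Runs.loop_cons ?_ (xfer_runs (by decide) _) this) ?_
    · exact decide_eq_true (hw s List.mem_cons_self)
    · simp only [List.length_cons]; omega

theorem xfer_cnt_runs (w : List TapeSym) (hw : ∀ s ∈ w, s ≠ .sep) (i o m a c) :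
    (loop .cnt notSep (xfer .cnt .aux)).Runs ⟨i, o, m, a, w ++ .sep :: c⟩
      ⟨i, o, m, w.reverse ++ a, .sep :: c⟩ (4 * w.length + 1) := by
  induction w generalizing a with
  | nil => exact Runs.loop_nil rfl
  | cons s w ih =>
    have := ih (fun t ht => hw t (List.mem_cons_of_mem _ ht)) (s :: a)
    rw [List.reverse_cons, List.append_assoc]
    refine Runs.mono (Runs.loop_cons ?_ (xfer_runs (by decide) _) this) ?_
    · exact decide_eq_true (hw s List.mem_cons_self)
    · simp only [List.length_cons]; omega

theorem xfer_copy_runs (w : List TapeSym) (hw : ∀ s ∈ w, s ≠ .sep) (i o m a c) :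
    (loop .aux notSep (seq (copyTop .aux .cnt) (xfer .aux .main))).Runs
      ⟨i, o, m, w ++ .sep :: a, c⟩
      ⟨i, o, w.reverse ++ m, .sep :: a, w.reverse ++ c⟩ (6 * w.length + 1) := by
  induction w generalizing m c with
  | nil => exact Runs.loop_nil rfl
  | cons s w ih =>
    have := ih (fun t ht => hw t (List.mem_cons_of_mem _ ht)) (s :: m) (s :: c)
    simp only [List.reverse_cons, List.append_assoc]
    refine Runs.mono (Runs.loop_cons ?_ ((copyTop_runs (by decide) _).seq
      (xfer_runs (by decide) _)) this) ?_
    · exact decide_eq_true (hw s List.mem_cons_self)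
    · simp only [List.length_cons]; omega

theorem drop_aux_runs (w : List TapeSym) (hw : ∀ s ∈ w, s ≠ .sep) (i o m a c) :
    (loop .aux notSep (pop .aux)).Runs ⟨i, o, m, w ++ .sep :: a, c⟩
      ⟨i, o, m, .sep :: a, c⟩ (2 * w.length + 1) := by
  induction w with
  | nil => exact Runs.loop_nil rfl
  | cons s w ih =>
    have := ih (fun t ht => hw t (List.mem_cons_of_mem _ ht))
    refine Runs.mono (Runs.loop_cons ?_ (pop_runs _ _) this) ?_
    · exact decide_eq_true (hw s List.mem_cons_self)
    · simp only [List.length_cons]; omega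

/-- Put the tree on top of the main stack aside. -/
def stash : Frag := seq (push .aux .sep) moveTree

theorem stash_runs (x : STree) (i o m a c) :
    stash.Runs ⟨i, o, x.word ++ m, a, c⟩ ⟨i, o, m, x.word.reverse ++ .sep :: a, c⟩
      (8 + 10 * x.size) :=
  Runs.mono ((push_runs _ _ _).seq (moveTree_runs _ _ _ _ _ _)) (by omega)

/-- Bring back the tree that was put aside last. -/
def unstash : Frag := seq (loop .aux notSep (xfer .aux .main)) (pop .aux)

theorem unstash_runs (x : STree) (i o m a c) :
    unstash.Runs ⟨i, o, m, x.word.reverse ++ .sep :: a, c⟩ ⟨i, o, x.word ++ m, a, c⟩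
      (2 + 4 * x.size) := by
  have := (xfer_aux_runs x.word.reverse (fun s hs => STree.ne_sep_of_mem_word
    (List.mem_reverse.1 hs)) i o m a c).seq (pop_runs .aux _)
  rw [List.reverse_reverse] at this
  refine Runs.mono this ?_
  simp only [List.length_reverse, STree.length_word]
  omega

/-- Remove the tree on top of the main stack. -/
def discard : Frag := seq stash (seq (loop .aux notSep (pop .aux)) (pop .aux))

theorem discard_runs (x : STree) (i o m a c) :
    discard.Runs ⟨i, o, x.word ++ m, a, c⟩ ⟨i, o, m, a, c⟩ (10 + 12 * x.size) := by
  refine Runs.mono ((stash_runs x i o m a c).seq ((drop_aux_runs x.word.reverse (fun s hs =>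
    STree.ne_sep_of_mem_word (List.mem_reverse.1 hs)) i o m a c).seq (pop_runs .aux _))) ?_
  simp only [List.length_reverse, STree.length_word]
  omega

/-- Duplicate the tree on top of the main stack. -/
def dup : Frag :=
  seq stash <| seq (push .cnt .sep) <|
    seq (loop .aux notSep (seq (copyTop .aux .cnt) (xfer .aux .main))) <|
      seq (loop .cnt notSep (xfer .cnt .aux)) <| seq (pop .cnt) unstash

theorem dup_runs (x : STree) (i o m a c) :
    dup.Runs ⟨i, o, x.word ++ m, a, c⟩ ⟨i, o, x.word ++ (x.word ++ m), a, c⟩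
      (15 + 24 * x.size) := by
  have hw : ∀ s ∈ x.word, s ≠ .sep := fun s hs => STree.ne_sep_of_mem_word hs
  have h₁ := xfer_copy_runs x.word.reverse (fun s hs => hw s (List.mem_reverse.1 hs))
    i o m a (.sep :: c)
  rw [List.reverse_reverse] at h₁
  have h₂ := xfer_cnt_runs x.word hw i o (x.word ++ m) (.sep :: a) c
  refine Runs.mono ((stash_runs x i o m a c).seq ((push_runs _ _ _).seq (h₁.seq (h₂.seq
    ((pop_runs _ _).seq (unstash_runs x _ _ _ _ _)))))) ?_
  simp only [List.length_reverse, STree.length_word]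
  omega

end Frag

theorem Polynomial.eval_mono_nat (P : Polynomial ℕ) {m n : ℕ} (h : m ≤ n) :
    P.eval m ≤ P.eval n := by
  simp only [Polynomial.eval_eq_sum, Polynomial.sum]
  exact Finset.sum_le_sum fun i _ => Nat.mul_le_mul_left _ (Nat.pow_le_pow_left h i)

/-- One machine fragment transforms, for every index `i`, the tree `u i` on top of the main stack
into the tree `v i`, in polynomial time and without any other effect. The pairs `(u i, v i)` are the
graph of a partial function of trees, so this is polynomial-time computability on a domain. What
lies below on the stacks is arbitrary, which makes feasible transformations composable. -/
def Feasible {ι : Type*} (u v : ι → STree) : Prop :=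
  ∃ (F : Frag) (P : Polynomial ℕ), ∀ i, (v i).size ≤ P.eval (u i).size ∧
    ∀ a b m c d, F.Runs ⟨a, b, (u i).word ++ m, c, d⟩ ⟨a, b, (v i).word ++ m, c, d⟩
      (P.eval (u i).size)

namespace Feasible

open Frag

variable {ι κ : Type*} {u v w : ι → STree}

theorem reindex (h : Feasible u v) (e : κ → ι) : Feasible (u ∘ e) (v ∘ e) :=
  let ⟨F, P, h⟩ := h
  ⟨F, P, fun i => h (e i)⟩

theorem size_le (h : Feasible u v) : ∃ P : Polynomial ℕ, ∀ i, (v i).size ≤ P.eval (u i).size :=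
  let ⟨_, P, h⟩ := h
  ⟨P, fun i => (h i).1⟩

theorem congr {u' v' : ι → STree} (h : Feasible u v) (hu : ∀ i, u' i = u i)
    (hv : ∀ i, v' i = v i) : Feasible u' v' := by
  rw [funext hu, funext hv]
  exact h

theorem refl (u : ι → STree) : Feasible u u :=
  ⟨nop, .X + 1, fun _ => ⟨by simp, fun _ _ _ _ _ => (nop_runs _).mono (by simp)⟩⟩

theorem trans (h : Feasible u v) (h' : Feasible v w) : Feasible u w := by
  obtain ⟨F, P, h⟩ := h
  obtain ⟨G, Q, h'⟩ := h'
  refine ⟨seq F G, P + Q.comp P, fun i => ⟨?_, fun a b m c d => ?_⟩⟩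
  · rw [Polynomial.eval_add, Polynomial.eval_comp]
    exact ((h' i).1.trans (Q.eval_mono_nat (h i).1)).trans (Nat.le_add_left _ _)
  · rw [Polynomial.eval_add, Polynomial.eval_comp]
    exact (((h i).2 a b m c d).seq ((h' i).2 a b m c d)).mono
      (Nat.add_le_add_left (Q.eval_mono_nat (h i).1) _)

/-- Two feasible functions of the same tree are combined on the machine by duplicating the tree and
keeping the first value aside. -/
theorem pair (h : Feasible u v) (h' : Feasible u w) :
    Feasible u fun i => (v i).node (w i) := by
  obtain ⟨F, P, h⟩ := h
  obtain ⟨G, Q, h'⟩ := h'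
  refine ⟨seq dup (seq F (seq stash (seq G (seq unstash (push .main (.bit true)))))),
    40 + 24 * .X + 15 * P + Q, fun i => ⟨?_, fun a b m c d => ?_⟩⟩
  · have h1 := (h i).1
    have h2 := (h' i).1
    simp only [STree.size, Polynomial.eval_add, Polynomial.eval_mul, Polynomial.eval_X,
      Polynomial.eval_ofNat]
    omega
  · have h1 := (h i).1
    have e : ((v i).node (w i)).word ++ m = .bit true :: ((v i).word ++ ((w i).word ++ m)) := by
      simp [STree.word]
    rw [e]
    refine ((dup_runs (u i) a b m c d).seq (((h i).2 a b _ c d).seq ((stash_runs _ _ _ _ _ _).seq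
      (((h' i).2 a b _ _ d).seq ((unstash_runs (v i) _ _ _ _ _).seq (push_runs _ _ _)))))).mono ?_
    simp only [Polynomial.eval_add, Polynomial.eval_mul, Polynomial.eval_X, Polynomial.eval_ofNat]
    omega

theorem const_nil (u : ι → STree) : Feasible u fun _ => .nil := by
  refine ⟨seq discard (push .main (.bit false)), 12 + 12 * .X, fun i => ⟨?_, fun a b m c d => ?_⟩⟩
  · simp only [STree.size, Polynomial.eval_add, Polynomial.eval_mul, Polynomial.eval_X,
      Polynomial.eval_ofNat]
    omega
  · refine ((discard_runs (u i) a b m c d).seq (push_runs _ _ _)).mono ?_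
    simp only [Polynomial.eval_add, Polynomial.eval_mul, Polynomial.eval_X, Polynomial.eval_ofNat]
    omega

theorem const (u : ι → STree) (x : STree) : Feasible u fun _ => x := by
  induction x with
  | nil => exact const_nil u
  | node x y hx hy => exact hx.pair hy

theorem left (u : ι → STree) : Feasible u fun i => (u i).left := by
  refine ⟨Frag.ite .main isOne (seq (pop .main) (seq stash (seq discard unstash)))
    nop, 30 + 30 * .X, fun i => ?_⟩
  simp only [Polynomial.eval_add, Polynomial.eval_mul, Polynomial.eval_X, Polynomial.eval_ofNat]
  rcases hu : u i with _ | ⟨x, y⟩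
  · refine ⟨by simp [STree.left, STree.size], fun a b m c d => ?_⟩
    exact (Runs.ite_false rfl (nop_runs _)).mono (by omega)
  · refine ⟨by simp only [STree.left, STree.size]; omega, fun a b m c d => ?_⟩
    have e : (x.node y).word ++ m = .bit true :: (x.word ++ (y.word ++ m)) := by simp [STree.word]
    rw [e]
    refine (Runs.ite_true rfl ((pop_runs _ _).seq ((stash_runs x _ _ _ _ _).seq
      ((discard_runs y _ _ _ _ _).seq (unstash_runs x _ _ _ _ _))))).mono ?_
    simp only [STree.size]
    omega

theorem right (u : ι → STree) : Feasible u fun i => (u i).right := by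
  refine ⟨Frag.ite .main isOne (seq (pop .main) discard)
    nop, 30 + 30 * .X, fun i => ?_⟩
  simp only [Polynomial.eval_add, Polynomial.eval_mul, Polynomial.eval_X, Polynomial.eval_ofNat]
  rcases hu : u i with _ | ⟨x, y⟩
  · refine ⟨by simp [STree.right, STree.size], fun a b m c d => ?_⟩
    exact (Runs.ite_false rfl (nop_runs _)).mono (by omega)
  · refine ⟨by simp only [STree.right, STree.size]; omega, fun a b m c d => ?_⟩
    have e : (x.node y).word ++ m = .bit true :: (x.word ++ (y.word ++ m)) := by simp [STree.word]
    rw [e]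
    refine (Runs.ite_true rfl ((pop_runs _ _).seq (discard_runs x _ _ _ _ _))).mono ?_
    simp only [STree.size]
    omega

/-- A case distinction, according to whether a feasible tree `w i` is a node. Each branch only has
to be feasible where it is taken. -/
theorem branch (p : ι → Bool) (hw : Feasible u w) (hp : ∀ i, (w i).isNode = p i)
    (ht : Feasible (fun i : {i // p i = true} => u i) fun i => v i)
    (hf : Feasible (fun i : {i // p i = false} => u i) fun i => v i) : Feasible u v := by
  obtain ⟨F, P, hw⟩ := hw
  obtain ⟨G, Q, ht⟩ := ht
  obtain ⟨H, R, hf⟩ := hf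
  refine ⟨seq dup (seq F (Frag.ite .main isOne (seq discard G) (seq discard H))),
    100 + 24 * .X + 13 * P + Q + R, fun i => ?_⟩
  simp only [Polynomial.eval_add, Polynomial.eval_mul, Polynomial.eval_X, Polynomial.eval_ofNat]
  obtain ⟨h, h'⟩ := hw i
  have hpi := hp i
  cases hi : p i
  · have hf := hf ⟨i, hi⟩
    simp only at hf
    refine ⟨by omega, fun a b m c d => ?_⟩
    have hn : (w i).word = [.bit false] := by
      cases hw' : w i
      · rfl
      · simp [hw', STree.isNode, hi] at hpi
    refine ((dup_runs (u i) a b m c d).seq ((h' a b _ c d).seq (Runs.ite_false ?_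
      ((discard_runs (w i) _ _ _ _ _).seq (hf.2 a b m c d))))).mono ?_
    · simp [Stacks.get, hn, isOne]
    · omega
  · have ht := ht ⟨i, hi⟩
    simp only at ht
    refine ⟨by omega, fun a b m c d => ?_⟩
    refine ((dup_runs (u i) a b m c d).seq ((h' a b _ c d).seq (Runs.ite_true ?_
      ((discard_runs (w i) _ _ _ _ _).seq (ht.2 a b m c d))))).mono ?_
    · cases hw' : w i
      · simp [hw', STree.isNode, hi] at hpi
      · simp [Stacks.get, STree.word, isOne]
    · omega

/-- The length of the spine of a tree is converted into a row of digits on the auxiliary stack. -/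
theorem spine_runs (x : STree) (i o m a c) :
    (seq (loop .main isOne (seq (pop .main) (seq discard (push .aux (.bit true)))))
      (pop .main)).Runs ⟨i, o, x.word ++ m, a, c⟩
      ⟨i, o, m, List.replicate x.spine (.bit true) ++ a, c⟩ (20 * x.size) := by
  suffices h : (loop .main isOne (seq (pop .main) (seq discard (push .aux (.bit true))))).Runs
      ⟨i, o, x.word ++ m, a, c⟩
      ⟨i, o, .bit false :: m, List.replicate x.spine (.bit true) ++ a, c⟩ (20 * x.size - 1) by
    refine (h.seq (pop_runs _ _)).mono ?_
    have := x.size_pos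
    omega
  induction x generalizing a with
  | nil => exact (Runs.loop_nil rfl).mono (by simp [STree.size])
  | node x y _ ih =>
    have ih := ih (.bit true :: a)
    have e : (x.node y).word ++ m = .bit true :: (x.word ++ (y.word ++ m)) := by simp [STree.word]
    have e' : List.replicate (x.node y).spine (TapeSym.bit true) ++ a =
        List.replicate y.spine (.bit true) ++ .bit true :: a := by
      rw [STree.spine, List.replicate_succ', List.append_assoc]
      rfl
    rw [e, e']
    refine (Runs.loop_cons rfl ((pop_runs _ _).seq ((discard_runs x _ _ _ _ _).seq
      (push_runs _ _ _))) ih).mono ?_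
    have := x.size_pos
    have := y.size_pos
    simp only [STree.size]
    omega

/-- Iteration of a feasible step, `n i` times. The number of iterations is given by a tree that is
computed along with the initial state, and the states `s i j` have to remain of polynomial size. -/
theorem iterate (n : ι → ℕ) (x : ι → STree) (hx : ∀ i, (x i).spine = n i) (s : ι → ℕ → STree)
    (hs : Feasible (fun p : {p : ι × ℕ // p.2 < n p.1} => s p.1.1 p.1.2)
      fun p => s p.1.1 (p.1.2 + 1))
    (Q : Polynomial ℕ) (hQ : ∀ i, ∀ j ≤ n i, (s i j).size ≤ Q.eval ((x i).node (s i 0)).size) :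
    Feasible (fun i => (x i).node (s i 0)) fun i => s i (n i) := by
  obtain ⟨F, P, h⟩ := hs
  refine ⟨seq (pop .main) (seq (push .aux .sep) (seq (seq (loop .main isOne (seq (pop .main)
    (seq discard (push .aux (.bit true))))) (pop .main))
    (seq (loop .aux isOne (seq (pop .aux) F)) (pop .aux)))),
    Q + 5 + 20 * .X + .X * (2 + P.comp Q), fun i => ⟨?_, fun a b m c d => ?_⟩⟩
  · simp only [Polynomial.eval_add]
    exact (hQ i (n i) le_rfl).trans (by omega)
  · have key : ∀ k j, j + k = n i → (loop .aux isOne (seq (pop .aux) F)).Runs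
        ⟨a, b, (s i j).word ++ m, List.replicate k (.bit true) ++ .sep :: c, d⟩
        ⟨a, b, (s i (n i)).word ++ m, .sep :: c, d⟩
        (k * (2 + P.eval (Q.eval ((x i).node (s i 0)).size)) + 1) := by
      intro k
      induction k with
      | zero =>
        rintro j rfl
        exact (Runs.loop_nil rfl).mono (by omega)
      | succ k ih =>
        intro j hj
        have h1 := (h ⟨(i, j), by simp; omega⟩).2 a b m (List.replicate k (.bit true) ++ .sep :: c) d
        have h2 := P.eval_mono_nat (hQ i j (by omega))
        refine (Runs.loop_cons rfl ((pop_runs _ _).seq h1) (ih (j + 1) (by omega))).mono ?_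
        simp only
        rw [Nat.succ_mul]
        omega
    have e : ((x i).node (s i 0)).word ++ m =
        .bit true :: ((x i).word ++ ((s i 0).word ++ m)) := by simp [STree.word]
    rw [e]
    have h1 := spine_runs (x i) a b ((s i 0).word ++ m) (.sep :: c) d
    rw [hx i] at h1
    refine ((pop_runs _ _).seq ((push_runs _ _ _).seq (h1.seq
      ((key (n i) 0 (by omega)).seq (pop_runs _ _))))).mono ?_
    simp only [Polynomial.eval_add, Polynomial.eval_mul, Polynomial.eval_X, Polynomial.eval_ofNat,
      Polynomial.eval_comp]
    have h2 : n i ≤ ((x i).node (s i 0)).size := by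
      rw [← hx i]
      have := (x i).spine_lt_size
      simp only [STree.size]
      omega
    have h3 := Nat.mul_le_mul_right (2 + P.eval (Q.eval ((x i).node (s i 0)).size)) h2
    have h4 : (x i).size ≤ ((x i).node (s i 0)).size := by simp only [STree.size]; omega
    omega

end Feasible

section PolynomialTime

/-! ### Representation of data by trees -/

/-- Types whose elements are represented by trees. The representation is not required to be
injective: the closure properties of `PolyTime` do not depend on it. -/
class Enc (α : Type) where
  /-- The tree that represents an element. -/
  enc : α → STree

/-- The size of the representation. -/
def esize {α : Type} [Enc α] (a : α) : ℕ := (Enc.enc a).size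

/-- A Boolean as a tree: `true` is a node. -/
def STree.ofBool : Bool → STree
  | false => nil
  | true => node nil nil

/-- A natural number in unary notation. -/
def STree.ofNat : ℕ → STree
  | 0 => nil
  | n + 1 => node nil (ofNat n)

/-- A list of trees as a tree, the entries along the right spine. -/
def STree.ofList {α : Type} (f : α → STree) : List α → STree
  | [] => nil
  | a :: l => node (f a) (ofList f l)

/-- An optional tree as a tree. -/
def STree.ofOption {α : Type} (f : α → STree) : Option α → STree
  | none => nil
  | some a => node nil (f a)

instance : Enc Bool := ⟨.ofBool⟩

/-- Natural numbers are represented in unary notation. -/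
instance : Enc ℕ := ⟨.ofNat⟩

instance {α β : Type} [Enc α] [Enc β] : Enc (α × β) := ⟨fun p => .node (Enc.enc p.1) (Enc.enc p.2)⟩

instance {α : Type} [Enc α] : Enc (List α) := ⟨.ofList Enc.enc⟩

instance {α : Type} [Enc α] : Enc (Option α) := ⟨.ofOption Enc.enc⟩

variable {α β γ δ : Type} [Enc α] [Enc β] [Enc γ] [Enc δ]

/-- `f` is computable in polynomial time (as a function of the size of the representation), with the
argument and the value on top of the main stack. -/
@[fun_prop]
def PolyTime (f : α → β) : Prop := Feasible (fun a => Enc.enc a) fun a => Enc.enc (f a)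

/-- `f` is bounded by a polynomial in the size of the argument. -/
def PolyBdd (f : α → ℕ) : Prop := ∃ P : Polynomial ℕ, ∀ a, f a ≤ P.eval (esize a)

/-! ### Sizes -/

@[simp] theorem esize_prod (a : α) (b : β) : esize (a, b) = esize a + esize b + 1 := rfl

@[simp] theorem esize_nil : esize ([] : List α) = 1 := rfl

@[simp] theorem esize_cons (a : α) (l : List α) : esize (a :: l) = esize a + esize l + 1 := rfl

@[simp] theorem esize_none : esize (none : Option α) = 1 := rfl

@[simp] theorem esize_some (a : α) : esize (some a) = esize a + 2 := by
  change 1 + esize a + 1 = _; omega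

@[simp] theorem esize_nat (n : ℕ) : esize n = 2 * n + 1 := by
  induction n with
  | zero => rfl
  | succ n ih => change 1 + esize n + 1 = _; omega

theorem esize_bool (b : Bool) : esize b ≤ 3 := by cases b <;> decide

theorem esize_append (l l' : List α) : esize (l ++ l') + 1 = esize l + esize l' := by
  induction l with
  | nil => simp; omega
  | cons a l ih => simp only [List.cons_append, esize_cons]; omega

theorem esize_reverse (l : List α) : esize l.reverse = esize l := by
  induction l with
  | nil => rfl
  | cons a l ih =>
    have := esize_append l.reverse [a]
    simp only [List.reverse_cons, esize_cons, esize_nil] at *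
    omega

theorem length_lt_esize (l : List α) : l.length < esize l := by
  induction l with
  | nil => simp
  | cons a l ih => simp only [List.length_cons, esize_cons]; omega

theorem esize_lt_of_mem {a : α} {l : List α} (h : a ∈ l) : esize a < esize l := by
  induction l with
  | nil => simp at h
  | cons b l ih =>
    rcases List.mem_cons.1 h with rfl | h
    · simp only [esize_cons]; omega
    · have := ih h
      simp only [esize_cons]; omega

theorem esize_list_le {l : List α} {B : ℕ} (h : ∀ a ∈ l, esize a ≤ B) :
    esize l ≤ 1 + l.length * (B + 1) := by
  induction l with
  | nil => simp
  | cons a l ih =>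
    have h1 := h a List.mem_cons_self
    have h2 := ih fun b hb => h b (List.mem_cons_of_mem _ hb)
    simp only [esize_cons, List.length_cons, Nat.succ_mul]
    omega

theorem esize_le_of_sublist {l l' : List α} (h : l.Sublist l') : esize l ≤ esize l' := by
  induction h with
  | slnil => rfl
  | cons a _ ih => simp only [esize_cons]; omega
  | cons_cons a _ ih => simp only [esize_cons]; omega

namespace PolyBdd

variable {f g : α → ℕ}

theorem mono (hg : PolyBdd g) (h : ∀ a, f a ≤ g a) : PolyBdd f :=
  let ⟨P, hP⟩ := hg
  ⟨P, fun a => (h a).trans (hP a)⟩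

theorem const (n : ℕ) : PolyBdd fun _ : α => n := ⟨.C n, fun a => by simp⟩

theorem add (hf : PolyBdd f) (hg : PolyBdd g) : PolyBdd fun a => f a + g a :=
  let ⟨P, hP⟩ := hf
  let ⟨Q, hQ⟩ := hg
  ⟨P + Q, fun a => by rw [Polynomial.eval_add]; exact add_le_add (hP a) (hQ a)⟩

theorem mul (hf : PolyBdd f) (hg : PolyBdd g) : PolyBdd fun a => f a * g a :=
  let ⟨P, hP⟩ := hf
  let ⟨Q, hQ⟩ := hg
  ⟨P * Q, fun a => by rw [Polynomial.eval_mul]; exact Nat.mul_le_mul (hP a) (hQ a)⟩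

theorem eval (hf : PolyBdd f) (P : Polynomial ℕ) : PolyBdd fun a => P.eval (f a) :=
  let ⟨Q, hQ⟩ := hf
  ⟨P.comp Q, fun a => by rw [Polynomial.eval_comp]; exact P.eval_mono_nat (hQ a)⟩

theorem esize {f : α → β} (hf : PolyTime f) : PolyBdd fun a => esize (f a) := hf.size_le

theorem length {f : α → List β} (hf : PolyTime f) : PolyBdd fun a => (f a).length :=
  (PolyBdd.esize hf).mono fun _ => (length_lt_esize _).le

end PolyBdd

namespace PolyTime

theorem bdd {f : α → ℕ} (hf : PolyTime f) : PolyBdd f :=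
  (PolyBdd.esize hf).mono fun a => by rw [esize_nat]; omega

/-! ### Basic functions -/

@[fun_prop] theorem id : PolyTime fun a : α => a := Feasible.refl _

@[fun_prop] theorem const (b : β) : PolyTime fun _ : α => b := Feasible.const _ _

theorem congr {f g : α → β} (hf : PolyTime f) (h : ∀ x, g x = f x) : PolyTime g := by
  rwa [funext h]

@[fun_prop] theorem comp {f : β → γ} {g : α → β} (hf : PolyTime f) (hg : PolyTime g) :
    PolyTime fun x => f (g x) :=
  Feasible.trans hg (Feasible.reindex hf g)

@[fun_prop] theorem prodMk {f : α → β} {g : α → γ} (hf : PolyTime f) (hg : PolyTime g) :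
    PolyTime fun x => (f x, g x) :=
  Feasible.pair hf hg

@[fun_prop] theorem fst {f : α → β × γ} (hf : PolyTime f) : PolyTime fun x => (f x).1 :=
  Feasible.trans hf (Feasible.left _)

@[fun_prop] theorem snd {f : α → β × γ} (hf : PolyTime f) : PolyTime fun x => (f x).2 :=
  Feasible.trans hf (Feasible.right _)

@[fun_prop] theorem cond {p : α → Bool} {f g : α → β} (hp : PolyTime p) (hf : PolyTime f)
    (hg : PolyTime g) : PolyTime fun x => bif p x then f x else g x := by
  refine Feasible.branch p hp (fun a => ?_) ?_ ?_
  · cases p a <;> rfl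
  · exact (Feasible.reindex hf fun i : {i // p i = true} => i.1).congr (fun _ => rfl)
      fun i => by simp [i.2]
  · exact (Feasible.reindex hg fun i : {i // p i = false} => i.1).congr (fun _ => rfl)
      fun i => by simp [i.2]

@[fun_prop] theorem and {p q : α → Bool} (hp : PolyTime p) (hq : PolyTime q) :
    PolyTime fun x => p x && q x := by
  have h : PolyTime fun x => bif p x then q x else false := by fun_prop
  exact h.congr fun x => by cases p x <;> rfl

@[fun_prop] theorem or {p q : α → Bool} (hp : PolyTime p) (hq : PolyTime q) :
    PolyTime fun x => p x || q x := by
  have h : PolyTime fun x => bif p x then true else q x := by fun_prop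
  exact h.congr fun x => by cases p x <;> rfl

@[fun_prop] theorem not {p : α → Bool} (hp : PolyTime p) : PolyTime fun x => !(p x) := by
  have h : PolyTime fun x => bif p x then false else true := by fun_prop
  exact h.congr fun x => by cases p x <;> rfl

@[fun_prop] theorem xor {p q : α → Bool} (hp : PolyTime p) (hq : PolyTime q) :
    PolyTime fun x => Bool.xor (p x) (q x) := by
  have h : PolyTime fun x => bif p x then !(q x) else q x := by fun_prop
  exact h.congr fun x => by cases p x <;> cases q x <;> rfl

/-! ### Options and lists -/

@[fun_prop] theorem some {f : α → β} (hf : PolyTime f) : PolyTime fun x => some (f x) :=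
  Feasible.pair (Feasible.const _ .nil) hf

@[fun_prop] theorem isSome {o : α → Option β} (ho : PolyTime o) :
    PolyTime fun x => (o x).isSome := by
  refine Feasible.branch (fun x => (o x).isSome) ho (fun x => ?_) ?_ ?_
  · cases o x <;> rfl
  · exact (Feasible.const _ (Enc.enc true)).congr (fun _ => rfl) fun i => congrArg _ i.2
  · exact (Feasible.const _ (Enc.enc false)).congr (fun _ => rfl) fun i => congrArg _ i.2

@[fun_prop] theorem optionElim {o : γ → Option α} {g : γ → β} {f : γ → α → β} (ho : PolyTime o)
    (hg : PolyTime g) (hf : PolyTime fun p : γ × α => f p.1 p.2) :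
    PolyTime fun x => (o x).elim (g x) (f x) := by
  refine Feasible.branch (fun x => (o x).isSome) ho (fun x => ?_) ?_ ?_
  · cases o x <;> rfl
  · have h1 : Feasible (fun i : {x // (o x).isSome = true} => Enc.enc i.1)
        fun i => (Enc.enc i.1).node (Enc.enc ((o i.1).get i.2)) := by
      refine Feasible.pair (Feasible.refl _) ?_
      refine ((Feasible.reindex ho (fun i : {x // (o x).isSome = true} => i.1)).trans
        (Feasible.right _)).congr (fun _ => rfl) fun i => ?_
      obtain ⟨x, hx⟩ := i
      obtain ⟨a, ha⟩ := Option.isSome_iff_exists.1 hx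
      simp only [Function.comp, ha]
      rfl
    refine (h1.trans (Feasible.reindex hf (fun i : {x // (o x).isSome = true} =>
      (i.1, (o i.1).get i.2)))).congr (fun _ => rfl) fun i => ?_
    obtain ⟨x, hx⟩ := i
    obtain ⟨a, ha⟩ := Option.isSome_iff_exists.1 hx
    simp [ha]
  · refine (Feasible.reindex hg (fun i : {x // (o x).isSome = false} => i.1)).congr
      (fun _ => rfl) fun i => ?_
    have : o i.1 = none := by simpa using i.2
    simp [this]

@[fun_prop] theorem optionGetD {o : γ → Option α} {d : γ → α} (ho : PolyTime o)
    (hd : PolyTime d) : PolyTime fun x => (o x).getD (d x) := by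
  have h : PolyTime fun x => (o x).elim (d x) fun a => a := by fun_prop
  exact h.congr fun x => by cases o x <;> rfl

@[fun_prop] theorem optionMap {o : γ → Option α} {f : γ → α → β} (ho : PolyTime o)
    (hf : PolyTime fun p : γ × α => f p.1 p.2) : PolyTime fun x => (o x).map (f x) := by
  have h : PolyTime fun x => (o x).elim none fun a => Option.some (f x a) := by fun_prop
  exact h.congr fun x => by cases o x <;> rfl

@[fun_prop] theorem cons {a : γ → α} {l : γ → List α} (ha : PolyTime a) (hl : PolyTime l) :
    PolyTime fun x => a x :: l x :=
  Feasible.pair ha hl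

@[fun_prop] theorem tail {l : γ → List α} (hl : PolyTime l) : PolyTime fun x => (l x).tail := by
  exact (Feasible.trans hl (Feasible.right _)).congr (fun _ => rfl) fun x => by
    dsimp only; cases l x <;> rfl

@[fun_prop] theorem head? {l : γ → List α} (hl : PolyTime l) : PolyTime fun x => (l x).head? := by
  refine Feasible.branch (fun x => !(l x).isEmpty) hl (fun x => ?_) ?_ ?_
  · cases l x <;> rfl
  · refine (Feasible.pair (Feasible.const _ .nil) ((Feasible.reindex hl
      (fun i : {x // (!(l x).isEmpty) = true} => i.1)).trans (Feasible.left _))).congr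
      (fun _ => rfl) fun i => ?_
    obtain ⟨x, hx⟩ := i
    dsimp only [Function.comp] at *
    cases h : l x
    · simp [h] at hx
    · rfl
  · refine (Feasible.const _ .nil).congr (fun _ => rfl) fun i => ?_
    obtain ⟨x, hx⟩ := i
    dsimp only at *
    cases h : l x
    · rfl
    · simp [h] at hx

@[fun_prop] theorem headD {l : γ → List α} {d : γ → α} (hl : PolyTime l) (hd : PolyTime d) :
    PolyTime fun x => (l x).headD (d x) := by
  have h : PolyTime fun x => ((l x).head?).getD (d x) := by fun_prop
  exact h.congr fun x => by cases l x <;> rfl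

@[fun_prop] theorem isEmpty {l : γ → List α} (hl : PolyTime l) :
    PolyTime fun x => (l x).isEmpty := by
  have h : PolyTime fun x => !((l x).head?).isSome := by fun_prop
  exact h.congr fun x => by cases l x <;> rfl

@[fun_prop] theorem succ {f : α → ℕ} (hf : PolyTime f) : PolyTime fun x => f x + 1 :=
  Feasible.pair (Feasible.const _ .nil) hf

@[fun_prop] theorem pred {f : α → ℕ} (hf : PolyTime f) : PolyTime fun x => (f x).pred := by
  exact (Feasible.trans hf (Feasible.right _)).congr (fun _ => rfl) fun x => by
    dsimp only; cases f x <;> rfl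

/-! ### Recursion -/

/-- Iteration, for as long as the values remain of polynomial size. -/
theorem iterate {n : γ → ℕ} {f : γ → β → β} {b : γ → β} (hn : PolyTime n) (hb : PolyTime b)
    (hf : PolyTime fun p : γ × β => f p.1 p.2) {g : γ → ℕ} (hg : PolyBdd g)
    (h : ∀ x, ∀ j ≤ n x, esize ((f x)^[j] (b x)) ≤ g x) :
    PolyTime fun x => (f x)^[n x] (b x) := by
  obtain ⟨P, hP⟩ := hg
  have h1 : Feasible (fun x : γ => Enc.enc x) fun x => (Enc.enc (n x)).node
      ((Enc.enc x).node (Enc.enc ((f x)^[0] (b x)))) :=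
    Feasible.pair hn (Feasible.pair (Feasible.refl _) hb)
  refine (h1.trans (Feasible.iterate n (fun x => Enc.enc (n x)) (fun x => ?_) (fun x j =>
    (Enc.enc x).node (Enc.enc ((f x)^[j] (b x)))) ?_ (.X + P + 1) ?_)).trans (Feasible.right _)
  · generalize n x = k
    induction k with
    | zero => rfl
    | succ k ih => exact congrArg (· + 1) ih
  · refine Feasible.pair (Feasible.left _) ?_
    refine (Feasible.reindex hf (fun p : {p : γ × ℕ // p.2 < n p.1} =>
      (p.1.1, (f p.1.1)^[p.1.2] (b p.1.1)))).congr (fun _ => rfl) fun p => ?_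
    simp [Function.iterate_succ_apply']
  · intro x j hj
    set t := ((Enc.enc (n x)).node ((Enc.enc x).node (Enc.enc ((f x)^[0] (b x))))).size with ht
    have h2 : esize x ≤ t := by
      simp only [ht, STree.size, esize]
      omega
    have h3 := (hP x).trans (P.eval_mono_nat h2)
    have h4 := h x j hj
    simp only [STree.size, esize, Polynomial.eval_add, Polynomial.eval_X, Polynomial.eval_one] at *
    omega

/-- Recursion along a list, for as long as the values remain of polynomial size. -/
theorem foldl {l : γ → List α} {f : γ → β → α → β} {b : γ → β} (hl : PolyTime l)
    (hb : PolyTime b) (hf : PolyTime fun p : γ × β × α => f p.1 p.2.1 p.2.2) {g : γ → ℕ}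
    (hg : PolyBdd g) (h : ∀ x l', l' <+: l x → esize (l'.foldl (f x) (b x)) ≤ g x) :
    PolyTime fun x => (l x).foldl (f x) (b x) := by
  obtain ⟨P, hP⟩ := hg
  have h1 : Feasible (fun x : γ => Enc.enc x) fun x => (Enc.enc (l x)).node
      ((Enc.enc x).node ((Enc.enc ((l x).drop 0)).node
        (Enc.enc (((l x).take 0).foldl (f x) (b x))))) :=
    Feasible.pair hl (Feasible.pair (Feasible.refl _) (Feasible.pair hl hb))
  have h5 := (h1.trans (Feasible.iterate (fun x => (l x).length) (fun x => Enc.enc (l x))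
    (fun x => ?_) (fun x j => (Enc.enc x).node ((Enc.enc ((l x).drop j)).node
        (Enc.enc (((l x).take j).foldl (f x) (b x))))) ?_ (2 * .X + P + 2) ?_)).trans
        ((Feasible.right _).trans (Feasible.right _))
  · unfold PolyTime
    refine h5.congr (fun _ => rfl) fun x => ?_
    simp [STree.right]
  · generalize l x = k
    induction k with
    | nil => rfl
    | cons a k ih => exact congrArg (· + 1) ih
  · refine Feasible.pair (Feasible.left _) (Feasible.pair
      ((Feasible.right _).trans ((Feasible.left _).trans ?_)) ?_)
    · refine (Feasible.right _).congr (fun _ => rfl) fun p => ?_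
      obtain ⟨⟨x, j⟩, hj⟩ := p
      simp only [STree.right, STree.left]
      rw [List.drop_eq_getElem_cons hj]
      rfl
    · have h2 : Feasible (fun p : {p : γ × ℕ // p.2 < (l p.1).length} =>
          (Enc.enc p.1.1).node ((Enc.enc ((l p.1.1).drop p.1.2)).node
            (Enc.enc (((l p.1.1).take p.1.2).foldl (f p.1.1) (b p.1.1)))))
          fun p => (Enc.enc p.1.1).node ((Enc.enc
            (((l p.1.1).take p.1.2).foldl (f p.1.1) (b p.1.1))).node
              (Enc.enc ((l p.1.1)[p.1.2]'p.2))) := by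
        refine Feasible.pair (Feasible.left _) (Feasible.pair
          ((Feasible.right _).trans (Feasible.right _)) ?_)
        refine ((Feasible.right _).trans ((Feasible.left _).trans (Feasible.left _))).congr
          (fun _ => rfl) fun p => ?_
        obtain ⟨⟨x, j⟩, hj⟩ := p
        simp only [STree.right, STree.left]
        rw [List.drop_eq_getElem_cons hj]
        rfl
      have h3 := Feasible.reindex hf (fun p : {p : γ × ℕ // p.2 < (l p.1).length} =>
        (p.1.1, ((l p.1.1).take p.1.2).foldl (f p.1.1) (b p.1.1), (l p.1.1)[p.1.2]'p.2))
      refine (h2.trans h3).congr (fun _ => rfl) fun p => ?_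
      obtain ⟨⟨x, j⟩, hj⟩ := p
      simp only [Function.comp]
      rw [← List.take_concat_get' _ _ hj, List.foldl_append]
      rfl
  · intro x j hj
    set t := ((Enc.enc (l x)).node ((Enc.enc x).node ((Enc.enc ((l x).drop 0)).node
        (Enc.enc (((l x).take 0).foldl (f x) (b x)))))).size with ht
    have h2 : esize x + esize (l x) ≤ t := by
      simp only [ht, STree.size, esize]
      omega
    have h3 := (hP x).trans (P.eval_mono_nat ((Nat.le_add_right _ _).trans h2))
    have h4 := h x _ (List.take_prefix j (l x))
    have h6 := esize_le_of_sublist (List.drop_sublist j (l x))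
    simp only [STree.size, esize, Polynomial.eval_add, Polynomial.eval_mul, Polynomial.eval_X,
      Polynomial.eval_ofNat] at *
    omega

end PolyTime

namespace PolyTime

/-! ### Arithmetic in unary notation -/

@[fun_prop] theorem add {f g : α → ℕ} (hf : PolyTime f) (hg : PolyTime g) :
    PolyTime fun x => f x + g x := by
  have e : ∀ n j : ℕ, (fun n => n + 1)^[j] n = n + j := fun n j => Nat.succ_iterate n j
  have h := iterate (f := fun _ n => n + 1) hg hf (by fun_prop)
    (g := fun x => 2 * (f x + g x) + 1)
    (((PolyBdd.const 2).mul (hf.bdd.add hg.bdd)).add (.const 1)) fun x j hj => by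
      simp only [e, esize_nat]; omega
  exact h.congr fun x => by simp only [e]

@[fun_prop] theorem sub {f g : α → ℕ} (hf : PolyTime f) (hg : PolyTime g) :
    PolyTime fun x => f x - g x := by
  have h := iterate (f := fun _ n => n.pred) hg hf (by fun_prop)
    (g := fun x => 2 * f x + 1)
    (((PolyBdd.const 2).mul hf.bdd).add (.const 1)) fun x j hj => by
      simp only [Nat.pred_iterate, esize_nat]; omega
  exact h.congr fun x => by simp only [Nat.pred_iterate]

@[fun_prop] theorem mul {f g : α → ℕ} (hf : PolyTime f) (hg : PolyTime g) :
    PolyTime fun x => f x * g x := by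
  have e : ∀ a j : ℕ, (fun n => n + a)^[j] 0 = a * j := by
    intro a j
    induction j with
    | zero => rfl
    | succ j ih => rw [Function.iterate_succ_apply', ih, Nat.mul_succ]
  have h := iterate (f := fun x n => n + f x) hg (const 0) (by fun_prop)
    (g := fun x => 2 * (f x * g x) + 1)
    (((PolyBdd.const 2).mul (hf.bdd.mul hg.bdd)).add (.const 1)) fun x j hj => by
      simp only [e, esize_nat]
      have := Nat.mul_le_mul_left (f x) hj
      omega
  exact h.congr fun x => by simp only [e]

@[fun_prop] theorem isZero {f : α → ℕ} (hf : PolyTime f) : PolyTime fun x => f x == 0 := by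
  refine Feasible.branch (fun x => !(f x == 0)) hf (fun x => ?_) ?_ ?_
  · cases f x <;> rfl
  · exact (Feasible.const _ (Enc.enc false)).congr (fun _ => rfl) fun i =>
      congrArg _ (by simpa using i.2)
  · exact (Feasible.const _ (Enc.enc true)).congr (fun _ => rfl) fun i =>
      congrArg _ (by simpa using i.2)

@[fun_prop] theorem ble {f g : α → ℕ} (hf : PolyTime f) (hg : PolyTime g) :
    PolyTime fun x => Nat.ble (f x) (g x) := by
  have h : PolyTime fun x => f x - g x == 0 := by fun_prop
  refine h.congr fun x => ?_
  rw [Bool.eq_iff_iff, Nat.ble_eq, beq_iff_eq]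
  omega

@[fun_prop] theorem beq {f g : α → ℕ} (hf : PolyTime f) (hg : PolyTime g) :
    PolyTime fun x => f x == g x := by
  have h : PolyTime fun x => Nat.ble (f x) (g x) && Nat.ble (g x) (f x) := by fun_prop
  refine h.congr fun x => ?_
  rw [Bool.eq_iff_iff, Bool.and_eq_true, Nat.ble_eq, Nat.ble_eq, beq_iff_eq]
  omega

@[fun_prop] theorem mod {f g : α → ℕ} (hf : PolyTime f) (hg : PolyTime g) :
    PolyTime fun x => f x % g x := by
  have e : ∀ m j : ℕ, (fun r => bif r + 1 == m then 0 else r + 1)^[j] 0 = j % m := by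
    intro m j
    induction j with
    | zero => simp
    | succ j ih =>
      rw [Function.iterate_succ_apply', ih, Nat.add_mod j 1 m]
      simp only [cond_eq_ite, beq_iff_eq]
      rcases Nat.lt_or_ge m 2 with hm | hm
      · obtain rfl | rfl : m = 0 ∨ m = 1 := by omega
        · simp
        · simp [Nat.mod_one]
      · have := Nat.mod_lt j (show 0 < m by omega)
        rw [Nat.mod_eq_of_lt hm]
        split_ifs with h
        · rw [h, Nat.mod_self]
        · rw [Nat.mod_eq_of_lt (a := j % m + 1) (by omega)]
  have h := iterate (f := fun x r => bif r + 1 == g x then 0 else r + 1) hf (const 0) (by fun_prop)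
    (g := fun x => 2 * f x + 1)
    (((PolyBdd.const 2).mul hf.bdd).add (.const 1)) fun x j hj => by
      simp only [e, esize_nat]
      have := Nat.mod_le j (g x)
      omega
  exact h.congr fun x => by simp only [e]

@[fun_prop] theorem div {f g : α → ℕ} (hf : PolyTime f) (hg : PolyTime g) :
    PolyTime fun x => f x / g x := by
  have e : ∀ n m j : ℕ, (fun q => bif !(m == 0) && Nat.ble (m * (q + 1)) n then q + 1 else q)^[j] 0
      = min j (n / m) := by
    intro n m j
    induction j with
    | zero => simp
    | succ j ih =>
      rw [Function.iterate_succ_apply', ih]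
      rcases Nat.eq_zero_or_pos m with rfl | hm
      · simp
      · simp only [cond_eq_ite, Bool.and_eq_true, Nat.ble_eq, mul_comm m,
          ← Nat.le_div_iff_mul_le hm, Bool.not_eq_true', beq_eq_false_iff_ne]
        split <;> omega
  have h := iterate (f := fun x q => bif !(g x == 0) && Nat.ble (g x * (q + 1)) (f x) then q + 1
    else q) hf (const 0) (by fun_prop)
    (g := fun x => 2 * f x + 1)
    (((PolyBdd.const 2).mul hf.bdd).add (.const 1)) fun x j hj => by
      simp only [e, esize_nat]
      omega
  exact h.congr fun x => by
    simp only [e]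
    exact (min_eq_right (Nat.div_le_self _ _)).symm

/-! ### Lists -/

@[fun_prop] theorem length {l : γ → List α} (hl : PolyTime l) : PolyTime fun x => (l x).length := by
  have e : ∀ (l : List α) (n : ℕ), l.foldl (fun n _ => n + 1) n = n + l.length := by
    intro l
    induction l with
    | nil => simp
    | cons a l ih => intro n; simp [ih]; omega
  have h := foldl (f := fun _ n _ => n + 1) hl (const 0) (by fun_prop)
    (g := fun x => 2 * (l x).length + 1)
    (((PolyBdd.const 2).mul (PolyBdd.length hl)).add (.const 1)) fun x l' hl' => by
      simp only [e, esize_nat]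
      have := hl'.length_le
      omega
  exact h.congr fun x => by simp [e]

@[fun_prop] theorem reverse {l : γ → List α} (hl : PolyTime l) :
    PolyTime fun x => (l x).reverse := by
  have h := foldl (f := fun _ (r : List α) a => a :: r) hl (const []) (by fun_prop)
    (PolyBdd.esize hl) fun x l' hl' => by
      simp only [List.foldl_flip_cons_eq_append']
      rw [List.append_nil, esize_reverse]
      exact esize_le_of_sublist hl'.sublist
  exact h.congr fun x => by simp

theorem foldr {l : γ → List α} {f : γ → α → β → β} {b : γ → β} (hl : PolyTime l)
    (hb : PolyTime b) (hf : PolyTime fun p : γ × α × β => f p.1 p.2.1 p.2.2) {g : γ → ℕ}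
    (hg : PolyBdd g) (h : ∀ x l', l' <:+ l x → esize (l'.foldr (f x) (b x)) ≤ g x) :
    PolyTime fun x => (l x).foldr (f x) (b x) := by
  have h' := foldl (f := fun x b a => f x a b) hl.reverse hb
    (hf.comp (show PolyTime fun p : γ × β × α => (p.1, p.2.2, p.2.1) by fun_prop)) hg
    fun x l' hl' => by
      have := h x l'.reverse (by simpa using List.reverse_suffix.2 hl')
      rwa [List.foldr_reverse] at this
  exact h'.congr fun x => by rw [List.foldl_reverse]

@[fun_prop] theorem append {l l' : γ → List α} (hl : PolyTime l) (hl' : PolyTime l') :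
    PolyTime fun x => l x ++ l' x := by
  have h := foldr (f := fun _ a (r : List α) => a :: r) hl hl' (by fun_prop)
    ((PolyBdd.esize hl).add (PolyBdd.esize hl')) fun x r hr => by
      rw [List.foldr_cons_eq_append']
      have := esize_append r (l' x)
      have := esize_le_of_sublist hr.sublist
      omega
  exact h.congr fun x => by simp

@[fun_prop] theorem map {l : γ → List α} {f : γ → α → β} (hl : PolyTime l)
    (hf : PolyTime fun p : γ × α => f p.1 p.2) : PolyTime fun x => (l x).map (f x) := by
  obtain ⟨P, hP⟩ := PolyBdd.esize hf
  have h := foldr (f := fun x a r => f x a :: r) hl (const []) (by fun_prop)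
    (g := fun x => 1 + (l x).length * (P.eval (esize x + esize (l x) + 1) + 1))
    (.add (.const 1) ((PolyBdd.length hl).mul (.add (.eval (((PolyBdd.esize .id).add
      (PolyBdd.esize hl)).add (.const 1)) P) (.const 1)))) fun x r hr => by
      have e : r.foldr (fun a r => f x a :: r) [] = r.map (f x) := by
        induction r with
        | nil => rfl
        | cons a r ih => rw [List.foldr_cons, ih ((List.suffix_cons a r).trans hr), List.map_cons]
      rw [e]
      refine (esize_list_le (B := P.eval (esize x + esize (l x) + 1)) ?_).trans ?_
      · intro b hb
        obtain ⟨a, ha, rfl⟩ := List.mem_map.1 hb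
        refine (hP (x, a)).trans (P.eval_mono_nat ?_)
        have := esize_lt_of_mem (hr.subset ha)
        rw [esize_prod]
        omega
      · rw [List.length_map]
        exact Nat.add_le_add_left (Nat.mul_le_mul_right _ hr.length_le) _
  refine h.congr fun x => ?_
  generalize l x = r
  induction r with
  | nil => rfl
  | cons a r ih => rw [List.map_cons, ih]; rfl

@[fun_prop] theorem flatten {l : γ → List (List α)} (hl : PolyTime l) :
    PolyTime fun x => (l x).flatten := by
  have h := foldr (f := fun _ a (r : List α) => a ++ r) hl (const []) (by fun_prop)
    (PolyBdd.esize hl) fun x r hr => by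
      refine le_trans ?_ (esize_le_of_sublist hr.sublist)
      clear hr
      induction r with
      | nil => simp
      | cons a r ih =>
        have := esize_append a (r.foldr (fun a r => a ++ r) [])
        simp only [List.foldr_cons, esize_cons] at *
        omega
  refine h.congr fun x => ?_
  generalize l x = r
  induction r with
  | nil => rfl
  | cons a r ih => simp [ih]

@[fun_prop] theorem flatMap {l : γ → List α} {f : γ → α → List β} (hl : PolyTime l)
    (hf : PolyTime fun p : γ × α => f p.1 p.2) : PolyTime fun x => (l x).flatMap (f x) := by
  have h : PolyTime fun x => ((l x).map (f x)).flatten := by fun_prop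
  exact h.congr fun x => by rw [List.flatMap_def]

@[fun_prop] theorem filter {l : γ → List α} {p : γ → α → Bool} (hl : PolyTime l)
    (hp : PolyTime fun q : γ × α => p q.1 q.2) : PolyTime fun x => (l x).filter (p x) := by
  have h : PolyTime fun x => (l x).flatMap fun a => bif p x a then [a] else [] := by fun_prop
  refine h.congr fun x => ?_
  generalize l x = r
  induction r with
  | nil => rfl
  | cons a r ih => cases h : p x a <;> simp [h, ih]

@[fun_prop] theorem find? {l : γ → List α} {p : γ → α → Bool} (hl : PolyTime l)
    (hp : PolyTime fun q : γ × α => p q.1 q.2) : PolyTime fun x => (l x).find? (p x) := by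
  have h : PolyTime fun x => ((l x).filter (p x)).head? := by fun_prop
  exact h.congr fun x => by rw [List.head?_filter]

@[fun_prop] theorem all {l : γ → List α} {p : γ → α → Bool} (hl : PolyTime l)
    (hp : PolyTime fun q : γ × α => p q.1 q.2) : PolyTime fun x => (l x).all (p x) := by
  have h : PolyTime fun x => !((l x).find? fun a => !(p x a)).isSome := by fun_prop
  refine h.congr fun x => ?_
  rw [Bool.eq_iff_iff]
  simp

@[fun_prop] theorem range {n : γ → ℕ} (hn : PolyTime n) : PolyTime fun x => List.range (n x) := by
  have e : ∀ j, (fun l : List ℕ => l.length :: l)^[j] [] = (List.range j).reverse := by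
    intro j
    induction j with
    | zero => rfl
    | succ j ih => rw [Function.iterate_succ_apply', ih]; simp [List.range_succ]
  have h := (iterate (f := fun _ (l : List ℕ) => l.length :: l) hn (const []) (by fun_prop)
    (g := fun x => 1 + n x * (2 * n x + 1 + 1))
    (.add (.const 1) (hn.bdd.mul (.add (.add (.mul (.const 2) hn.bdd) (.const 1)) (.const 1))))
    fun x j hj => by
      rw [e, esize_reverse]
      refine (esize_list_le (B := 2 * n x + 1) fun a ha => ?_).trans ?_
      · rw [esize_nat]
        have := List.mem_range.1 ha
        omega
      · rw [List.length_range]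
        exact Nat.add_le_add_left (Nat.mul_le_mul_right _ hj) _).reverse
  exact h.congr fun x => by simp [e]

@[fun_prop] theorem drop {l : γ → List α} {n : γ → ℕ} (hl : PolyTime l) (hn : PolyTime n) :
    PolyTime fun x => (l x).drop (n x) := by
  have e : ∀ (l : List α) j, List.tail^[j] l = l.drop j := by
    intro l j
    induction j with
    | zero => rfl
    | succ j ih => rw [Function.iterate_succ_apply', ih, List.tail_drop]
  have h := iterate (f := fun _ (l : List α) => l.tail) hn hl (by fun_prop)
    (PolyBdd.esize hl) fun x j _ => by
      rw [e]
      exact esize_le_of_sublist (List.drop_sublist _ _)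
  exact h.congr fun x => by rw [e]

@[fun_prop] theorem getD {l : γ → List α} {n : γ → ℕ} {d : γ → α} (hl : PolyTime l)
    (hn : PolyTime n) (hd : PolyTime d) : PolyTime fun x => (l x).getD (n x) (d x) := by
  have h : PolyTime fun x => (((l x).drop (n x)).head?).getD (d x) := by fun_prop
  exact h.congr fun x => by rw [List.head?_drop, List.getD_eq_getElem?_getD]

end PolyTime

/-! ### Binary arithmetic -/

/-- Natural numbers, represented in binary notation. -/
structure BNat : Type where
  val : ℕ

instance : Enc BNat := ⟨fun n => Enc.enc n.val.bits⟩

/-- The number with the given binary digits, the least significant one first. -/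
def bitsVal (l : List Bool) : ℕ := l.foldr Nat.bit 0

theorem bitsVal_bits (n : ℕ) : bitsVal n.bits = n := by
  induction n using Nat.binaryRec' with
  | zero => rfl
  | bit b n h ih => rw [Nat.bits_append_bit _ _ h]; exact congrArg (Nat.bit b) ih

theorem esize_bits (n : ℕ) : esize n.bits ≤ 1 + 4 * n.size := by
  have := esize_list_le (l := n.bits) (B := 3) fun b _ => esize_bool b
  rw [← Nat.size_eq_bits_len]
  omega

/-- One step of the addition of binary numbers; the state consists of the remaining digits of the
summands, the carry, and the digits of the sum in reverse order. -/
def addStep (s : List Bool × List Bool × Bool × List Bool) :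
    List Bool × List Bool × Bool × List Bool :=
  (s.1.tail, s.2.1.tail,
    (s.1.headD false && s.2.1.headD false) || (s.2.2.1 && (s.1.headD false || s.2.1.headD false)),
    Bool.xor (Bool.xor (s.1.headD false) (s.2.1.headD false)) s.2.2.1 :: s.2.2.2)

theorem addStep_value (s : List Bool × List Bool × Bool × List Bool) :
    (addStep s).2.2.2.foldl (fun n b => Nat.bit b n)
      (bitsVal (addStep s).1 + bitsVal (addStep s).2.1 + (addStep s).2.2.1.toNat) =
    s.2.2.2.foldl (fun n b => Nat.bit b n) (bitsVal s.1 + bitsVal s.2.1 + s.2.2.1.toNat) := by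
  obtain ⟨la, lb, c, out⟩ := s
  rw [addStep, List.foldl_cons]
  congr 1
  rcases la with _ | ⟨a, la⟩ <;> rcases lb with _ | ⟨b, lb⟩ <;> cases c <;>
    (try cases a) <;> (try cases b) <;>
    simp [bitsVal, Nat.bit] <;> omega

theorem addStep_iterate (s : List Bool × List Bool × Bool × List Bool) (j : ℕ) :
    (addStep^[j] s).1 = s.1.drop j ∧ (addStep^[j] s).2.1 = s.2.1.drop j ∧
      (addStep^[j] s).2.2.2.length = s.2.2.2.length + j ∧
    (addStep^[j] s).2.2.2.foldl (fun n b => Nat.bit b n)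
      (bitsVal (addStep^[j] s).1 + bitsVal (addStep^[j] s).2.1 + (addStep^[j] s).2.2.1.toNat) =
    s.2.2.2.foldl (fun n b => Nat.bit b n) (bitsVal s.1 + bitsVal s.2.1 + s.2.2.1.toNat) := by
  induction j with
  | zero => simp
  | succ j ih =>
    rw [Function.iterate_succ_apply']
    refine ⟨?_, ?_, ?_, (addStep_value _).trans ih.2.2.2⟩
    · simp [addStep, ih.1]
    · simp [addStep, ih.2.1]
    · simp [addStep, ih.2.2.1]; omega

/-- Put a digit before a binary number; a leading zero is suppressed. -/
def consBit (l : List Bool) (b : Bool) : List Bool := bif !b && l.isEmpty then [] else b :: l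

theorem consBit_bits (n : ℕ) (b : Bool) : consBit n.bits b = (Nat.bit b n).bits := by
  rcases b with _ | _
  · rcases Nat.eq_zero_or_pos n with rfl | hn
    · rfl
    · have h0 : n.bits ≠ [] := fun h => by
        have := bitsVal_bits n
        rw [h] at this
        exact hn.ne this
      rw [Nat.bits_append_bit _ _ (by omega), consBit]
      cases h : n.bits
      · exact absurd h h0
      · rfl
  · rw [Nat.bits_append_bit _ _ (by simp), consBit]
    simp

theorem foldl_consBit (l : List Bool) (n : ℕ) :
    l.foldl consBit n.bits = (l.foldl (fun n b => Nat.bit b n) n).bits := by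
  induction l generalizing n with
  | nil => rfl
  | cons b l ih => rw [List.foldl_cons, consBit_bits, ih]; rfl

/-- The binary digits of the sum. -/
def addBits (a b : List Bool) : List Bool :=
  (addStep^[a.length + b.length] (a, b, false, [])).2.2.2.foldl consBit
    (bif (addStep^[a.length + b.length] (a, b, false, [])).2.2.1 then [true] else [])

theorem addBits_bits (a b : ℕ) : addBits a.bits b.bits = (a + b).bits := by
  obtain ⟨h1, h2, -, h3⟩ := addStep_iterate (a.bits, b.bits, false, [])
    (a.bits.length + b.bits.length)
  rw [addBits]
  rw [h1, h2, List.drop_of_length_le (by simp), List.drop_of_length_le (by simp)] at h3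
  simp only [bitsVal_bits, List.foldl_nil, Bool.toNat_false, add_zero] at h3
  rw [← h3, ← foldl_consBit]
  congr 1
  cases (addStep^[a.bits.length + b.bits.length] (a.bits, b.bits, false, [])).2.2.1 <;>
    simp [bitsVal]

/-- One step of the comparison of binary numbers. -/
def ltStep (s : List Bool × List Bool × Bool) : List Bool × List Bool × Bool :=
  (s.1.tail, s.2.1.tail,
    bif Bool.xor (s.1.headD false) (s.2.1.headD false) then s.2.1.headD false else s.2.2)

theorem ltStep_value (s : List Bool × List Bool × Bool) :
    (bitsVal (ltStep s).1 < bitsVal (ltStep s).2.1 ∨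
      bitsVal (ltStep s).1 = bitsVal (ltStep s).2.1 ∧ (ltStep s).2.2 = true) ↔
    (bitsVal s.1 < bitsVal s.2.1 ∨ bitsVal s.1 = bitsVal s.2.1 ∧ s.2.2 = true) := by
  obtain ⟨la, lb, c⟩ := s
  rcases la with _ | ⟨a, la⟩ <;> rcases lb with _ | ⟨b, lb⟩ <;> cases c <;>
    (try cases a) <;> (try cases b) <;>
    simp [ltStep, bitsVal, Nat.bit] <;> omega

theorem ltStep_iterate (s : List Bool × List Bool × Bool) (j : ℕ) :
    (ltStep^[j] s).1 = s.1.drop j ∧ (ltStep^[j] s).2.1 = s.2.1.drop j ∧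
    ((bitsVal (ltStep^[j] s).1 < bitsVal (ltStep^[j] s).2.1 ∨
      bitsVal (ltStep^[j] s).1 = bitsVal (ltStep^[j] s).2.1 ∧ (ltStep^[j] s).2.2 = true) ↔
    (bitsVal s.1 < bitsVal s.2.1 ∨ bitsVal s.1 = bitsVal s.2.1 ∧ s.2.2 = true)) := by
  induction j with
  | zero => simp
  | succ j ih =>
    rw [Function.iterate_succ_apply']
    refine ⟨?_, ?_, (ltStep_value _).trans ih.2.2⟩
    · simp [ltStep, ih.1]
    · simp [ltStep, ih.2.1]

/-- Comparison of binary numbers. -/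
def ltBits (a b : List Bool) : Bool := (ltStep^[a.length + b.length] (a, b, false)).2.2

theorem ltBits_bits (a b : ℕ) : ltBits a.bits b.bits = decide (a < b) := by
  obtain ⟨h1, h2, h3⟩ := ltStep_iterate (a.bits, b.bits, false) (a.bits.length + b.bits.length)
  rw [h1, h2, List.drop_of_length_le (by simp), List.drop_of_length_le (by simp)] at h3
  simp only [bitsVal_bits, lt_irrefl, false_or, true_and, Bool.false_eq_true, and_false,
    or_false] at h3
  rw [Bool.eq_iff_iff, decide_eq_true_iff, ← h3]
  rfl

namespace BNat

@[simp] theorem esize_eq (n : BNat) : esize n = esize n.val.bits := rfl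

theorem esize_le {n : BNat} {k : ℕ} (h : n.val < 2 ^ k) : esize n ≤ 1 + 4 * k := by
  have h1 := esize_bits n.val
  have h2 := Nat.size_le.2 h
  rw [esize_eq]
  omega

/-- Addition. -/
def add (a b : BNat) : BNat := ⟨a.val + b.val⟩

/-- Multiplication by a number in unary notation. -/
def smul (k : ℕ) (a : BNat) : BNat := ⟨k * a.val⟩

/-- Comparison. -/
def lt (a b : BNat) : Bool := decide (a.val < b.val)

end BNat

namespace PolyTime

@[fun_prop] theorem addBits {a b : γ → List Bool} (ha : PolyTime a) (hb : PolyTime b) :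
    PolyTime fun x => addBits (a x) (b x) := by
  have h0 : PolyTime addStep := by unfold addStep; fun_prop
  have h1 := iterate (n := fun x => (a x).length + (b x).length) (f := fun _ s => addStep s)
    (b := fun x => (a x, b x, false, [])) (by fun_prop) (by fun_prop) (by fun_prop)
    (g := fun x => esize (a x) + esize (b x) + 3 + (1 + ((a x).length + (b x).length) * 4) + 3)
    (.add (.add (.add (.add (.esize ha) (.esize hb)) (.const 3)) (.add (.const 1)
      (.mul (.add (.length ha) (.length hb)) (.const 4)))) (.const 3)) fun x j hj => by
      obtain ⟨h1, h2, h3, -⟩ := addStep_iterate (a x, b x, false, []) j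
      rw [← Prod.mk.eta (p := addStep^[j] _), ← Prod.mk.eta (p := (addStep^[j] _).2),
        ← Prod.mk.eta (p := (addStep^[j] _).2.2), h1, h2]
      simp only [esize_prod]
      have h4 := esize_le_of_sublist (List.drop_sublist j (a x))
      have h5 := esize_le_of_sublist (List.drop_sublist j (b x))
      have h6 := esize_bool (addStep^[j] (a x, b x, false, [])).2.2.1
      have h7 := esize_list_le (l := (addStep^[j] (a x, b x, false, [])).2.2.2) (B := 3)
        fun b _ => esize_bool b
      rw [h3] at h7
      simp only [List.length_nil] at h7
      omega
  have h2 : PolyTime fun p : γ × List Bool × Bool => consBit p.2.1 p.2.2 := by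
    unfold consBit; fun_prop
  have hl : PolyTime fun x => (addStep^[(a x).length + (b x).length]
    (a x, b x, false, [])).2.2.2 := by fun_prop
  refine foldl hl (by fun_prop) h2
    (g := fun x => 1 + ((addStep^[(a x).length + (b x).length]
      (a x, b x, false, [])).2.2.2.length + 1) * 4)
    (.add (.const 1) (.mul (.add (.length hl) (.const 1)) (.const 4))) fun x l' hl' => ?_
  have e : ∀ (l r : List Bool), (l.foldl consBit r).length ≤ l.length + r.length := by
    intro l
    induction l with
    | nil => simp
    | cons b l ih =>
      intro r
      refine (ih _).trans ?_
      rw [consBit]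
      cases (!b && r.isEmpty) <;> simp <;> omega
  refine (esize_list_le (B := 3) fun b _ => esize_bool b).trans ?_
  refine Nat.add_le_add_left (Nat.mul_le_mul_right _ ((e _ _).trans
    (add_le_add hl'.length_le ?_))) _
  cases (addStep^[(a x).length + (b x).length] (a x, b x, false, [])).2.2.1 <;> simp

@[fun_prop] theorem bnatAdd {a b : γ → BNat} (ha : PolyTime a) (hb : PolyTime b) :
    PolyTime fun x => (a x).add (b x) := by
  have ha' : PolyTime fun x => (a x).val.bits := ha
  have hb' : PolyTime fun x => (b x).val.bits := hb
  exact (ha'.addBits hb').congr fun x => (addBits_bits _ _).symm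

@[fun_prop] theorem bnatSMul {k : γ → ℕ} {a : γ → BNat} (hk : PolyTime k) (ha : PolyTime a) :
    PolyTime fun x => (a x).smul (k x) := by
  have e : ∀ (a : BNat) j, (a.add)^[j] ⟨0⟩ = a.smul j := by
    intro a j
    induction j with
    | zero => simp [BNat.smul]
    | succ j ih => rw [Function.iterate_succ_apply', ih]; simp [BNat.smul, BNat.add]; ring
  have h := iterate (f := fun x s => (a x).add s) (b := fun _ => ⟨0⟩) hk (by fun_prop)
    (by fun_prop) (g := fun x => 1 + 4 * (k x + esize (a x)))
    (.add (.const 1) (.mul (.const 4) (.add hk.bdd (.esize ha)))) fun x j hj => by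
      rw [e]
      refine BNat.esize_le ?_
      have h1 : (a x).val < 2 ^ esize (a x) := by
        refine (Nat.lt_size_self _).trans_le (Nat.pow_le_pow_right (by norm_num) ?_)
        rw [← Nat.size_eq_bits_len]
        exact (length_lt_esize (a x).val.bits).le
      have h2 : k x < 2 ^ k x := Nat.lt_two_pow_self
      rw [pow_add]
      exact (Nat.mul_le_mul_right _ hj).trans_lt (Nat.mul_lt_mul'' h2 h1)
  exact h.congr fun x => by rw [e]

@[fun_prop] theorem bnatLt {a b : γ → BNat} (ha : PolyTime a) (hb : PolyTime b) :
    PolyTime fun x => (a x).lt (b x) := by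
  have ha' : PolyTime fun x => (a x).val.bits := ha
  have hb' : PolyTime fun x => (b x).val.bits := hb
  have h0 : PolyTime ltStep := by unfold ltStep; fun_prop
  have h1 := iterate (n := fun x => (a x).val.bits.length + (b x).val.bits.length)
    (f := fun _ s => ltStep s)
    (b := fun x => ((a x).val.bits, (b x).val.bits, false)) (by fun_prop) (by fun_prop)
    (by fun_prop)
    (g := fun x => esize (a x) + esize (b x) + 5)
    (.add (.add (.esize ha) (.esize hb)) (.const 5)) fun x j hj => by
      obtain ⟨h1, h2, -⟩ := ltStep_iterate ((a x).val.bits, (b x).val.bits, false) j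
      rw [← Prod.mk.eta (p := ltStep^[j] _), ← Prod.mk.eta (p := (ltStep^[j] _).2), h1, h2]
      simp only [esize_prod, BNat.esize_eq]
      have h4 := esize_le_of_sublist (List.drop_sublist j (a x).val.bits)
      have h5 := esize_le_of_sublist (List.drop_sublist j (b x).val.bits)
      have h6 := esize_bool (ltStep^[j] ((a x).val.bits, (b x).val.bits, false)).2.2
      omega
  have h2 := h1.snd.snd
  exact h2.congr fun x => (ltBits_bits _ _).symm

end PolyTime

/-! ### The integer part of the logarithm -/

/-- The recurrence of the Padé approximants of the exponential function at `j`. With `u` and `v`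
for the solutions with the initial values `1, 2` and `0, 1`, the approximant number `m` of `exp j`
is `(u m + j * v m) / (u m - j * v m)`. -/
def pade (j a b : ℕ) : ℕ → ℕ
  | 0 => a
  | 1 => b
  | m + 2 => (4 * m + 6) * pade j a b (m + 1) + j ^ 2 * pade j a b m

/-- The integral of `(x (1 - x)) ^ m / m! * exp (j x)` over the unit interval, which is the error of
the Padé approximants up to a factor. -/
noncomputable def padeInt (j m : ℕ) : ℝ :=
  ∫ x in (0 : ℝ)..1, (x * (1 - x)) ^ m / (m.factorial : ℝ) * Real.exp (j * x)

theorem padeInt_zero (j : ℕ) : j * padeInt j 0 = Real.exp j - 1 := by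
  have h : ∀ x ∈ Set.uIcc (0 : ℝ) 1, HasDerivAt (fun x : ℝ => Real.exp (j * x))
      (j * ((x * (1 - x)) ^ 0 / (Nat.factorial 0 : ℝ) * Real.exp (j * x))) x := by
    intro x _
    have h1 : HasDerivAt (fun x : ℝ => (j : ℝ) * x) j x := by
      simpa using (hasDerivAt_id x).const_mul (j : ℝ)
    exact h1.exp.congr_deriv (by simp; ring)
  rw [padeInt, ← intervalIntegral.integral_const_mul,
    intervalIntegral.integral_eq_sub_of_hasDerivAt h
      (Continuous.intervalIntegrable (by fun_prop) _ _)]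
  simp

theorem hasDerivAt_mul_exp {g : ℝ → ℝ} {g' x : ℝ} (j : ℕ) (hg : HasDerivAt g g' x) :
    HasDerivAt (fun x : ℝ => g x * Real.exp (j * x)) ((g' + j * g x) * Real.exp (j * x)) x := by
  have h1 : HasDerivAt (fun x : ℝ => (j : ℝ) * x) j x := by
    simpa using (hasDerivAt_id x).const_mul (j : ℝ)
  exact (hg.mul h1.exp).congr_deriv (by ring)

theorem hasDerivAt_pow_factorial (m : ℕ) (x : ℝ) :
    HasDerivAt (fun x : ℝ => (x * (1 - x)) ^ (m + 1) / ((m + 1).factorial : ℝ))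
      ((x * (1 - x)) ^ m / (m.factorial : ℝ) * (1 - 2 * x)) x := by
  have h1 : HasDerivAt (fun x : ℝ => x * (1 - x)) (1 - 2 * x) x := by
    exact ((hasDerivAt_id x).mul ((hasDerivAt_id x).const_sub 1)).congr_deriv (by simp; ring)
  refine ((h1.pow (m + 1)).div_const ((m + 1).factorial : ℝ)).congr_deriv ?_
  have : (m.factorial : ℝ) ≠ 0 := by positivity
  have : (m : ℝ) + 1 ≠ 0 := by positivity
  push_cast [Nat.factorial_succ, Nat.add_sub_cancel]
  field_simp

theorem padeInt_one (j : ℕ) : (j : ℝ) ^ 2 * padeInt j 1 + 2 * padeInt j 0 = Real.exp j + 1 := by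
  have h : ∀ x ∈ Set.uIcc (0 : ℝ) 1, HasDerivAt
      (fun x : ℝ => (j * (x * (1 - x)) - (1 - 2 * x)) * Real.exp (j * x))
      ((j : ℝ) ^ 2 * ((x * (1 - x)) ^ 1 / (Nat.factorial 1 : ℝ) * Real.exp (j * x)) +
        2 * ((x * (1 - x)) ^ 0 / (Nat.factorial 0 : ℝ) * Real.exp (j * x))) x := by
    intro x _
    have h1 : HasDerivAt (fun x : ℝ => j * (x * (1 - x)) - (1 - 2 * x))
        (j * (1 - 2 * x) + 2) x := by
      have h2 := hasDerivAt_pow_factorial 0 x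
      simp only [zero_add, pow_one, Nat.factorial_one, Nat.cast_one, div_one, pow_zero,
        Nat.factorial_zero, one_mul] at h2
      exact ((h2.const_mul (j : ℝ)).sub
        (((hasDerivAt_id x).const_mul (2 : ℝ)).const_sub 1)).congr_deriv (by simp)
    exact (hasDerivAt_mul_exp j h1).congr_deriv (by simp; ring)
  rw [padeInt, padeInt, ← intervalIntegral.integral_const_mul,
    ← intervalIntegral.integral_const_mul, ← intervalIntegral.integral_add
      (Continuous.intervalIntegrable (by fun_prop) _ _)
      (Continuous.intervalIntegrable (by fun_prop) _ _),
    intervalIntegral.integral_eq_sub_of_hasDerivAt h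
      (Continuous.intervalIntegrable (by fun_prop) _ _)]
  simp; ring

theorem padeInt_add_two (j m : ℕ) :
    (j : ℝ) ^ 2 * padeInt j (m + 2) = padeInt j m - (4 * m + 6) * padeInt j (m + 1) := by
  have h : ∀ x ∈ Set.uIcc (0 : ℝ) 1, HasDerivAt
      (fun x : ℝ => (j * ((x * (1 - x)) ^ (m + 2) / ((m + 2).factorial : ℝ)) -
        (x * (1 - x)) ^ (m + 1) / ((m + 1).factorial : ℝ) * (1 - 2 * x)) * Real.exp (j * x))
      ((j : ℝ) ^ 2 * ((x * (1 - x)) ^ (m + 2) / ((m + 2).factorial : ℝ) * Real.exp (j * x)) -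
        ((x * (1 - x)) ^ m / (m.factorial : ℝ) * Real.exp (j * x) - (4 * m + 6) *
          ((x * (1 - x)) ^ (m + 1) / ((m + 1).factorial : ℝ) * Real.exp (j * x)))) x := by
    intro x _
    have h1 : HasDerivAt (fun x : ℝ => 1 - 2 * x) (-2) x := by
      simpa using ((hasDerivAt_id x).const_mul (2 : ℝ)).const_sub 1
    have h2 : HasDerivAt (fun x : ℝ => j * ((x * (1 - x)) ^ (m + 2) / ((m + 2).factorial : ℝ)) -
        (x * (1 - x)) ^ (m + 1) / ((m + 1).factorial : ℝ) * (1 - 2 * x)) _ x :=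
      ((hasDerivAt_pow_factorial (m + 1) x).const_mul (j : ℝ)).sub
        ((hasDerivAt_pow_factorial m x).mul h1)
    refine (hasDerivAt_mul_exp j h2).congr_deriv ?_
    have : (m.factorial : ℝ) ≠ 0 := by positivity
    have : (m : ℝ) + 1 ≠ 0 := by positivity
    have : (m : ℝ) + 1 + 1 ≠ 0 := by positivity
    have h3 : ((m + 1).factorial : ℝ) = (m + 1) * m.factorial := by
      push_cast [Nat.factorial_succ]; ring
    have h4 : ((m + 2).factorial : ℝ) = (m + 2) * ((m + 1) * m.factorial) := by
      push_cast [Nat.factorial_succ]; ring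
    rw [h4, h3]
    have : (m : ℝ) + 2 ≠ 0 := by positivity
    field_simp
    ring
  have h2 := intervalIntegral.integral_eq_sub_of_hasDerivAt h
    (Continuous.intervalIntegrable (by fun_prop) _ _)
  rw [intervalIntegral.integral_sub (Continuous.intervalIntegrable (by fun_prop) _ _)
    (Continuous.intervalIntegrable (by fun_prop) _ _),
    intervalIntegral.integral_sub (Continuous.intervalIntegrable (by fun_prop) _ _)
    (Continuous.intervalIntegrable (by fun_prop) _ _),
    intervalIntegral.integral_const_mul, intervalIntegral.integral_const_mul] at h2
  rw [← sub_eq_zero, padeInt, padeInt, padeInt, h2]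
  simp

/-- The error formula for the Padé approximants of the exponential function. -/
theorem pade_error (j m : ℕ) :
    ((pade j 1 2 m : ℝ) - j * pade j 0 1 m) * Real.exp j - (pade j 1 2 m + j * pade j 0 1 m) =
      (-1) ^ m * j ^ (2 * m + 1) * padeInt j m := by
  have h0 := padeInt_zero j
  induction m using Nat.twoStepInduction with
  | zero => simp [pade, h0]
  | one =>
    have h1 := padeInt_one j
    simp only [pade]
    push_cast
    linear_combination (j : ℝ) * h1 - 2 * h0
  | more m ih1 ih2 =>
    have h2 := padeInt_add_two j m
    simp only [pade]
    push_cast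
    linear_combination (4 * (m : ℝ) + 6) * ih2 + (j : ℝ) ^ 2 * ih1 -
      (-1) ^ m * (j : ℝ) ^ (2 * m + 3) * h2

theorem padeInt_pos (j m : ℕ) : 0 < padeInt j m := by
  refine intervalIntegral.intervalIntegral_pos_of_pos_on
    (Continuous.intervalIntegrable (by fun_prop) _ _) (fun x hx => ?_) one_pos
  have h1 : 0 < x := hx.1
  have h2 : 0 < 1 - x := by linarith [hx.2]
  positivity

theorem padeInt_le (j m : ℕ) : padeInt j m ≤ (1 / 4) ^ m / (m.factorial : ℝ) * Real.exp j := by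
  have h := intervalIntegral.integral_mono_on (μ := MeasureTheory.volume) (a := (0 : ℝ)) (b := 1)
    (f := fun x : ℝ => (x * (1 - x)) ^ m / (m.factorial : ℝ) * Real.exp (j * x))
    (g := fun _ => (1 / 4) ^ m / (m.factorial : ℝ) * Real.exp j) zero_le_one
    (Continuous.intervalIntegrable (by fun_prop) _ _)
    (Continuous.intervalIntegrable (by fun_prop) _ _) fun x hx => by
      have h1 : 0 ≤ x := hx.1
      have h2 : 0 ≤ 1 - x := by linarith [hx.2]
      have h3 : (j : ℝ) * x ≤ j := mul_le_of_le_one_right (by positivity) hx.2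
      have h4 : x * (1 - x) ≤ 1 / 4 := by nlinarith [sq_nonneg (x - 1 / 2)]
      gcongr
  simpa [padeInt] using h

/-- With `4 j²` steps of the recurrence the error is less than one, which is enough because the
approximants consist of integers. -/
theorem pade_error_lt_one {j : ℕ} (hj : 1 ≤ j) :
    (j : ℝ) ^ (2 * (4 * j ^ 2) + 1) * padeInt j (4 * j ^ 2) < 1 := by
  set m := 4 * j ^ 2 with hm
  have hmj : (m : ℝ) = 4 * (j : ℝ) ^ 2 := by rw [hm]; push_cast; ring
  have hj' : (1 : ℝ) ≤ j := by exact_mod_cast hj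
  have hf : (0 : ℝ) < m.factorial := by positivity
  have h1 : (j : ℝ) ^ (2 * m + 1) * padeInt j m ≤
      j * (((j : ℝ) ^ 2 / 4) ^ m / m.factorial) * Real.exp j := by
    calc _ ≤ (j : ℝ) ^ (2 * m + 1) * ((1 / 4) ^ m / (m.factorial : ℝ) * Real.exp j) := by
          gcongr; exact padeInt_le j m
      _ = _ := by rw [pow_succ, pow_mul, div_pow, div_pow, one_pow]; ring
  have h2 : ((j : ℝ) ^ 2 / 4) ^ m / m.factorial ≤ (Real.exp 1 / 16) ^ m := by
    have h3 := Real.pow_div_factorial_le_exp (x := (m : ℝ)) (by positivity) m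
    have h4 : (j : ℝ) ^ 2 / 4 = m / 16 := by rw [hmj]; ring
    rw [h4, div_pow, div_pow, ← Real.exp_nat_mul, mul_one, div_right_comm]
    gcongr
  have h5 : Real.exp 1 / 16 ≤ Real.exp (-1) := by
    rw [Real.exp_neg, div_le_iff₀ (by norm_num), inv_mul_eq_div, le_div_iff₀ (Real.exp_pos 1)]
    nlinarith [Real.exp_one_lt_d9, Real.exp_pos 1]
  have h6 : (Real.exp 1 / 16) ^ m ≤ Real.exp (-m) := by
    calc _ ≤ Real.exp (-1) ^ m := by gcongr
      _ = Real.exp (-m) := by rw [← Real.exp_nat_mul]; ring_nf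
  have h7 : (j : ℝ) < Real.exp j := by linarith [Real.add_one_le_exp (j : ℝ)]
  calc _ ≤ j * (((j : ℝ) ^ 2 / 4) ^ m / m.factorial) * Real.exp j := h1
    _ ≤ j * Real.exp (-m) * Real.exp j := by gcongr; exact h2.trans h6
    _ < Real.exp j * Real.exp (-m) * Real.exp j := by gcongr
    _ = Real.exp (2 * j - m) := by rw [← Real.exp_add, ← Real.exp_add]; ring_nf
    _ ≤ 1 := by rw [Real.exp_le_one_iff, hmj]; nlinarith

/-- The test for `exp j ≤ n` with integers. For even `m` the error formula reads
`0 < (u - j v) * exp j - (u + j v) < 1`, so that `exp j ≤ n` is equivalent to the inequality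
`u + j v < n (u - j v)` of integers. -/
theorem exp_le_iff {j n : ℕ} (hj : 1 ≤ j) :
    Real.exp j ≤ n ↔ pade j 1 2 (4 * j ^ 2) + (n + 1) * j * pade j 0 1 (4 * j ^ 2) <
      n * pade j 1 2 (4 * j ^ 2) := by
  have h1 := pade_error j (4 * j ^ 2)
  have h2 := pade_error_lt_one hj
  have h3 : 0 < (j : ℝ) ^ (2 * (4 * j ^ 2) + 1) * padeInt j (4 * j ^ 2) := by
    have := padeInt_pos j (4 * j ^ 2)
    positivity
  rw [(Even.neg_one_pow ⟨2 * j ^ 2, by ring⟩ : (-1 : ℝ) ^ (4 * j ^ 2) = 1), one_mul] at h1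
  rw [← h1] at h2 h3
  set u := pade j 1 2 (4 * j ^ 2)
  set v := pade j 0 1 (4 * j ^ 2)
  have hA : (0 : ℝ) < u - j * v := by
    by_contra! h
    have := Real.exp_pos j
    have : (0 : ℝ) ≤ u + j * v := by positivity
    nlinarith
  constructor
  · intro h
    have h4 : ((u : ℝ) - j * v) * Real.exp j ≤ (u - j * v) * n := by gcongr
    have h5 : (u : ℝ) + (n + 1) * j * v < n * u := by nlinarith
    exact_mod_cast h5
  · intro h
    have h5 : (u : ℝ) + (n + 1) * j * v + 1 ≤ n * u := by exact_mod_cast h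
    by_contra! h6
    have h7 : ((u : ℝ) - j * v) * n < (u - j * v) * Real.exp j := by gcongr
    nlinarith

/-- Four successive terms of the recurrence, in binary notation, together with the index. -/
def padeState (j m : ℕ) : ℕ × (BNat × BNat) × BNat × BNat :=
  (m, (⟨pade j 1 2 m⟩, ⟨pade j 1 2 (m + 1)⟩), ⟨pade j 0 1 m⟩, ⟨pade j 0 1 (m + 1)⟩)

/-- One step of the recurrence. -/
def padeStep (j : ℕ) (s : ℕ × (BNat × BNat) × BNat × BNat) : ℕ × (BNat × BNat) × BNat × BNat :=
  (s.1 + 1, (s.2.1.2, (s.2.1.2.smul (4 * s.1 + 6)).add (s.2.1.1.smul (j * j))),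
    s.2.2.2, (s.2.2.2.smul (4 * s.1 + 6)).add (s.2.2.1.smul (j * j)))

theorem padeStep_iterate (j m : ℕ) : (padeStep j)^[m] (padeState j 0) = padeState j m := by
  induction m with
  | zero => rfl
  | succ m ih =>
    rw [Function.iterate_succ_apply', ih]
    simp only [padeStep, padeState, BNat.add, BNat.smul, pade, sq]

/-- Decide whether `exp j ≤ n`. -/
def expLe (j n : ℕ) : Bool :=
  let s := (padeStep j)^[4 * (j * j)] (padeState j 0)
  (s.2.1.1.add (s.2.2.1.smul ((n + 1) * j))).lt (s.2.1.1.smul n)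

theorem expLe_iff {j n : ℕ} (hj : 1 ≤ j) : expLe j n = true ↔ Real.exp j ≤ n := by
  rw [exp_le_iff hj, expLe, padeStep_iterate, ← sq]
  simp only [padeState, BNat.add, BNat.lt, BNat.smul]
  exact ⟨fun h => of_decide_eq_true h, fun h => decide_eq_true h⟩

/-- The integer part of the natural logarithm, as the number of those `j` between `1` and `n` with
`exp j ≤ n`. -/
def logFloor (n : ℕ) : ℕ := ((List.range n).filter fun i => expLe (i + 1) n).length

theorem length_filter_range_lt (n k : ℕ) :
    ((List.range n).filter fun i => decide (i < k)).length = min n k := by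
  induction n with
  | zero => simp
  | succ n ih =>
    rw [List.range_succ, List.filter_append, List.length_append, ih]
    by_cases h : n < k <;> simp [h] <;> omega

theorem logFloor_eq (n : ℕ) : logFloor n = ⌊Real.log n⌋₊ := by
  have h : ∀ i, expLe (i + 1) n = decide (i < ⌊Real.log n⌋₊) := by
    intro i
    rw [Bool.eq_iff_iff, decide_eq_true_iff, expLe_iff (Nat.le_add_left 1 i)]
    rcases Nat.eq_zero_or_pos n with rfl | hn
    · simp [Real.exp_pos]
    · rw [← Nat.succ_le_iff, Nat.le_floor_iff' (Nat.succ_ne_zero i),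
        Real.le_log_iff_exp_le (by exact_mod_cast hn)]
  rw [logFloor, List.filter_congr fun i _ => h i, length_filter_range_lt]
  refine min_eq_right (Nat.floor_le_of_le ?_)
  rcases Nat.eq_zero_or_pos n with rfl | hn
  · simp
  · exact (Real.log_le_self (by positivity))

/-- The terms of the recurrence have a number of binary digits that is polynomial in `j` and `M`. -/
theorem pade_le {j a b B M : ℕ} (ha : a ≤ 1) (hb : b ≤ 2) (hB : 4 * M + 6 + j ^ 2 ≤ B) :
    ∀ m ≤ M + 1, pade j a b m ≤ B ^ m := by
  intro m
  induction m using Nat.twoStepInduction with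
  | zero => intro _; simpa [pade] using ha
  | one => intro _; simp only [pade, pow_one]; omega
  | more m ih1 ih2 =>
    intro hm
    have h1 := ih1 (by omega)
    have h2 := ih2 (by omega)
    have h3 : B ^ m ≤ B ^ (m + 1) := Nat.pow_le_pow_right (by omega) (by omega)
    calc pade j a b (m + 2) ≤ (4 * m + 6) * B ^ (m + 1) + j ^ 2 * B ^ (m + 1) := by
          simp only [pade]; gcongr; exact h1.trans h3
      _ = (4 * m + 6 + j ^ 2) * B ^ (m + 1) := by ring
      _ ≤ B * B ^ (m + 1) := by gcongr; omega
      _ = B ^ (m + 2) := by ring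

theorem esize_padeState {j m M : ℕ} (hm : m ≤ M) : esize (padeState j m) ≤
    2 * M + 20 + 16 * ((4 * M + 6 + j * j) * (M + 1)) := by
  set B := 4 * M + 6 + j ^ 2 with hB
  have key : ∀ a b i, a ≤ 1 → b ≤ 2 → i ≤ M + 1 →
      esize (⟨pade j a b i⟩ : BNat) ≤ 1 + 4 * (B * (M + 1)) := by
    intro a b i ha hb hi
    refine BNat.esize_le ?_
    rw [pow_mul]
    calc pade j a b i ≤ B ^ i := pade_le ha hb le_rfl i hi
      _ ≤ B ^ (M + 1) := Nat.pow_le_pow_right (by omega) hi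
      _ < (2 ^ B) ^ (M + 1) := Nat.pow_lt_pow_left Nat.lt_two_pow_self (by omega)
  have h1 := key 1 2 m (by omega) (by omega) (by omega)
  have h2 := key 1 2 (m + 1) (by omega) (by omega) (by omega)
  have h3 := key 0 1 m (by omega) (by omega) (by omega)
  have h4 := key 0 1 (m + 1) (by omega) (by omega) (by omega)
  rw [← sq, ← hB]
  simp only [padeState, esize_prod, esize_nat]
  omega

namespace PolyTime

@[fun_prop] theorem expLe {j n : γ → ℕ} (hj : PolyTime j) (hn : PolyTime n) :
    PolyTime fun x => expLe (j x) (n x) := by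
  have h0 : PolyTime fun p : γ × ℕ × (BNat × BNat) × BNat × BNat => padeStep (j p.1) p.2 := by
    unfold padeStep; fun_prop
  have h1 := iterate (n := fun x => 4 * (j x * j x)) (f := fun x s => padeStep (j x) s)
    (b := fun _ => padeState 0 0) (by fun_prop) (by fun_prop) h0
    (g := fun x => 2 * (4 * (j x * j x)) + 20 +
      16 * ((4 * (4 * (j x * j x)) + 6 + j x * j x) * (4 * (j x * j x) + 1)))
    (bdd (by fun_prop)) fun x i hi => by
      rw [show padeState 0 0 = padeState (j x) 0 from rfl, padeStep_iterate]
      exact esize_padeState hi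
  have h2 : PolyTime fun x => (padeStep (j x))^[4 * (j x * j x)] (padeState (j x) 0) := h1
  unfold _root_.expLe
  fun_prop

@[fun_prop] theorem logFloor {n : γ → ℕ} (hn : PolyTime n) : PolyTime fun x => logFloor (n x) := by
  unfold _root_.logFloor
  fun_prop

end PolyTime

/-! ### The universal machine -/

/-- The number of a symbol, in the numbering used by descriptions of machines. -/
def TapeSym.num : TapeSym → ℕ
  | .blank => 0
  | .bit false => 1
  | .bit true => 2
  | .sep => 3

instance : Enc TapeSym := ⟨fun s => Enc.enc s.num⟩

theorem TapeSym.num_injective : Function.Injective TapeSym.num := by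
  rintro (_ | (_ | _) | _) (_ | (_ | _) | _) h <;> first | rfl | simp [num] at h

theorem esize_sym (s : TapeSym) : esize s ≤ 7 := by
  change esize s.num ≤ 7
  rw [esize_nat]
  rcases s with _ | (_ | _) | _ <;> simp [TapeSym.num]

/-- A list that spells the contents of a tape: the part to the left of the head, from right to left,
and the part from the head to the right. -/
abbrev ListTape : Type := List TapeSym × List TapeSym

/-- The tape with given contents. -/
def ListTape.toTape (t : ListTape) : Tape TapeSym := .mk' (.mk t.1) (.mk t.2)

/-- Write a symbol on a tape and move the head. -/
def ListTape.act (s : TapeSym) (m : ℕ) (t : ListTape) : ListTape :=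
  bif m == 0 then (t.1, s :: t.2.tail) else
    bif m == 1 then (t.1.tail, t.1.headD .blank :: s :: t.2.tail) else (s :: t.1, t.2.tail)

theorem headD_blank_eq_headI (l : List TapeSym) : l.headD .blank = l.headI := by
  cases l <;> rfl

theorem ListTape.toTape_act (s : TapeSym) (m : ℕ) (t : ListTape) :
    (t.act s m).toTape = TM.act (s, moveOfNat m) t.toTape := by
  obtain ⟨l, r⟩ := t
  rcases m with _ | _ | m
  · simp [act, toTape, TM.act, moveOfNat, ListBlank.cons_mk, ListBlank.tail_mk]
  · simp [act, toTape, TM.act, moveOfNat, ListBlank.cons_mk, ListBlank.tail_mk,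
      ← headD_blank_eq_headI]
  · simp [act, toTape, TM.act, moveOfNat, ListBlank.cons_mk, ListBlank.tail_mk]

theorem ListTape.length_act (s : TapeSym) (m : ℕ) (t : ListTape) :
    (t.act s m).1.length + (t.act s m).2.length ≤ t.1.length + t.2.length + 2 := by
  obtain ⟨l, r⟩ := t
  rcases m with _ | _ | m <;> simp [act] <;> omega

/-- The binary word at the beginning of a list, up to the first blank or the end of the list; there
is none if a separator comes first. -/
def readOut (r : List TapeSym) : Option (List Bool) :=
  r.foldr (fun s o => bif s == .blank then some [] else bif s == .sep then none else
    o.map fun w => (s == .bit true) :: w) (some [])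

theorem readOut_bit (b : Bool) (r : List TapeSym) :
    readOut (.bit b :: r) = (readOut r).map fun w => b :: w := by
  cases b <;> rfl

theorem readOut_eq_some {r : List TapeSym} {w : List Bool} : readOut r = some w ↔
    ∀ j ≤ w.length, r.getI j = (w.map TapeSym.bit).getD j .blank := by
  induction r generalizing w with
  | nil =>
    cases w with
    | nil => simp [readOut, List.getI]; rfl
    | cons b w =>
      simp only [readOut, List.foldr_nil, Option.some.injEq, List.nil_eq, reduceCtorEq, false_iff]
      intro h
      exact absurd (h 0 (Nat.zero_le _)) (by simp [List.getI])
  | cons s r ih =>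
    cases w with
    | nil =>
      rcases s with _ | b | _
      · simp [List.getI, show readOut (.blank :: r) = some [] from rfl]
      · simp [List.getI, readOut_bit]
      · simp [List.getI, show readOut (.sep :: r) = none from rfl]
    | cons b w =>
      have h0 : (∀ j ≤ (b :: w).length, (s :: r).getI j =
          ((b :: w).map TapeSym.bit).getD j .blank) ↔ s = .bit b ∧
          ∀ j ≤ w.length, r.getI j = (w.map TapeSym.bit).getD j .blank := by
        constructor
        · intro h
          refine ⟨by simpa using h 0 (Nat.zero_le _), fun j hj => ?_⟩
          simpa using h (j + 1) (by simpa using hj)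
        · rintro ⟨rfl, h⟩ j hj
          rcases j with _ | j
          · simp
          · simpa using h j (by simpa using hj)
      rw [h0, ← ih]
      rcases s with _ | c | _
      · simp [show readOut (.blank :: r) = some [] from rfl]
      · simp only [readOut_bit, Option.map_eq_some_iff, List.cons.injEq, TapeSym.bit.injEq]
        constructor
        · rintro ⟨w', h, rfl, rfl⟩
          exact ⟨rfl, h⟩
        · rintro ⟨rfl, h⟩
          exact ⟨w, h, rfl, rfl⟩
      · simp [show readOut (.sep :: r) = none from rfl]

theorem readWord_toTape (t : ListTape) : readWord t.toTape = readOut t.2 := by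
  ext w
  rw [readWord_eq_some, readOut_eq_some, Spells]
  simp only [ListTape.toTape, Tape.mk'_nth_nat, ListBlank.nth_mk]

/-- A configuration of a simulated machine: the number of the state, and the tapes. -/
abbrev SimCfg : Type := ℕ × List ListTape

/-- The entry number `j` in the rule number `r`. -/
def ruleField (L : List ℕ) (r j : ℕ) : ℕ := L.getD (3 + r * (2 + 3 * (L.getD 0 0 + 1)) + j) 0

/-- The configuration that is represented. -/
def SimCfg.toCfg (L : List ℕ) (c : SimCfg) : (machineOfFields L).Cfg :=
  ⟨Fin.ofNat (L.getD 1 0 + 1) c.1, fun j : Fin (L.getD 0 0 + 1) => (c.2.getD j ([], [])).toTape⟩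

/-- The rule that applies in a configuration. -/
def simRule (L : List ℕ) (c : SimCfg) : Option ℕ :=
  (List.range ((L.length - 3) / (2 + 3 * (L.getD 0 0 + 1)))).find? fun r =>
    ruleField L r 0 % (L.getD 1 0 + 1) == c.1 % (L.getD 1 0 + 1) &&
      (List.range (L.getD 0 0 + 1)).all fun j =>
        symOfNat (ruleField L r (2 + 3 * j)) == (c.2.getD j ([], [])).2.headD .blank

/-- The configuration after the execution of a rule. -/
def simApply (L : List ℕ) (r : ℕ) (c : SimCfg) : SimCfg :=
  (ruleField L r 1 % (L.getD 1 0 + 1), (List.range (L.getD 0 0 + 1)).map fun j =>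
    (c.2.getD j ([], [])).act (symOfNat (ruleField L r (3 + 3 * j))) (ruleField L r (4 + 3 * j)))

/-- One step of the simulation. -/
def simStep (L : List ℕ) (c : SimCfg) : SimCfg := (simRule L c).elim c fun r => simApply L r c

/-- The initial configuration. -/
def simInit (L : List ℕ) (v : List TapeSym) : SimCfg :=
  (0, (List.range (L.getD 0 0 + 1)).map fun j => ([], bif j == 0 then v else []))

theorem step_toCfg (L : List ℕ) (c : SimCfg) : (machineOfFields L).step (c.toCfg L) =
    (simRule L c).map fun r => (simApply L r c).toCfg L := by
  have h : simRule L c = (List.range ((L.length - 3) / (2 + 3 * (L.getD 0 0 + 1)))).find? fun r =>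
      decide (Fin.ofNat (L.getD 1 0 + 1) (ruleField L r 0) = Fin.ofNat (L.getD 1 0 + 1) c.1 ∧
        ∀ j : Fin (L.getD 0 0 + 1), symOfNat (ruleField L r (2 + 3 * j)) =
          ((c.2.getD j ([], [])).toTape).head) := by
    rw [simRule]
    congr 1
    funext r
    rw [Bool.eq_iff_iff, decide_eq_true_iff, Bool.and_eq_true, beq_iff_eq, List.all_eq_true]
    refine and_congr ?_ ?_
    · rw [Fin.ext_iff]; rfl
    · simp only [List.mem_range, beq_iff_eq, ListTape.toTape, Tape.mk'_head,
        ListBlank.head_mk, headD_blank_eq_headI]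
      exact ⟨fun h j => h j j.2, fun h j hj => h ⟨j, hj⟩⟩
  rw [h, TM.step]
  change Option.map _ (Option.map _ (List.find? _ _)) = _
  refine (Option.map_map _ _ _).trans ?_
  refine congrFun (congrArg Option.map ?_) _
  funext r
  simp only [Function.comp, SimCfg.toCfg, simApply]
  congr 1
  · apply Fin.ext
    simp [ruleField]
  · refine funext fun (j : Fin (L.getD 0 0 + 1)) => ?_
    have hj : (j : ℕ) < L.getD 0 0 + 1 := j.2
    simp only [List.getD_eq_getElem?_getD, List.getElem?_map]
    rw [List.getElem?_range (by simpa using hj)]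
    simp [ListTape.toTape_act, ruleField]

theorem toCfg_simInit (L : List ℕ) (v : List TapeSym) :
    (simInit L v).toCfg L = (machineOfFields L).init v := by
  simp only [SimCfg.toCfg, simInit, TM.init]
  congr 1
  refine funext fun (j : Fin (L.getD 0 0 + 1)) => ?_
  have hj : (j : ℕ) < L.getD 0 0 + 1 := j.2
  simp only [List.getD_eq_getElem?_getD, List.getElem?_map]
  rw [List.getElem?_range (by simpa using hj)]
  have h : (j : ℕ) = 0 ↔ j = (machineOfFields L).inp := by
    rw [show (machineOfFields L).inp = (0 : Fin (L.getD 0 0 + 1)) from rfl]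
    exact (Fin.ext_iff (b := (0 : Fin (L.getD 0 0 + 1)))).symm
  by_cases hj0 : (j : ℕ) = 0
  · refine Eq.trans (b := Tape.mk₁ v) ?_ (congrArg Tape.mk₁ (if_pos (h.1 hj0)).symm)
    simp [hj0, ListTape.toTape, Tape.mk₁, Tape.mk₂]
  · refine Eq.trans (b := Tape.mk₁ []) ?_
      (congrArg Tape.mk₁ (if_neg fun h' => hj0 (h.2 h')).symm)
    have : ((j : ℕ) == 0) = false := by simpa using hj0
    simp [this, ListTape.toTape, Tape.mk₁, Tape.mk₂]

theorem toCfg_simStep_iterate (L : List ℕ) (v : List TapeSym) (s : ℕ) :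
    ((simStep L)^[s] (simInit L v)).toCfg L = (machineOfFields L).run v s := by
  induction s with
  | zero => exact toCfg_simInit L v
  | succ s ih =>
    rw [TM.run, Function.iterate_succ_apply', Function.iterate_succ_apply', ← TM.run, ← ih,
      step_toCfg, simStep]
    cases simRule L ((simStep L)^[s] (simInit L v)) <;> rfl

/-- The output in a configuration, if the machine has halted. -/
def simOutput (L : List ℕ) (c : SimCfg) : Option (List Bool) :=
  bif (simRule L c).isSome then none else
    readOut (c.2.getD (L.getD 2 0 % (L.getD 0 0 + 1)) ([], [])).2

/-- The output of the machine described by `w` on the input `v`, run for at most `s` steps. -/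
def simResult (w : List Bool) (v : List TapeSym) (s : ℕ) : Option (List Bool) :=
  simOutput (unaryFields w) ((simStep (unaryFields w))^[s] (simInit (unaryFields w) v))

/-- The simulation is faithful. -/
theorem simResult_eq (w : List Bool) (v : List TapeSym) (s : ℕ) :
    simResult w v s = (decodeTM w).result v s := by
  rw [TM.result, TM.Halted, TM.shows, decodeTM, ← toCfg_simStep_iterate, step_toCfg, simResult,
    simOutput]
  simp only [Option.map_eq_none_iff, cond_eq_ite]
  cases h : simRule (unaryFields w) ((simStep (unaryFields w))^[s] (simInit (unaryFields w) v))
  · simp only [Option.isSome_none, if_true, Bool.false_eq_true, if_false]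
    exact (readWord_toTape _).symm
  · simp

/-! ### The universal machine works in polynomial time -/

/-- The decoding of a machine as a recursion along the word from the left, with an accumulator. -/
theorem unaryFieldsAux_eq_foldl (w : List Bool) (m : ℕ) (l : List ℕ) :
    l.reverse ++ unaryFieldsAux m w = (w.foldl (fun (s : ℕ × List ℕ) b =>
      bif b then (s.1 + 1, s.2) else (0, s.1 :: s.2)) (m, l)).2.reverse := by
  induction w generalizing m l with
  | nil => simp [unaryFieldsAux]
  | cons b w ih =>
    cases b
    · rw [unaryFieldsAux, List.foldl_cons, cond_false, ← ih]
      simp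
    · rw [unaryFieldsAux, List.foldl_cons, cond_true, ← ih]

/-- The simulated tapes grow by at most two cells per step, so that the simulation is polynomial. -/
theorem simStep_invariant (L : List ℕ) (v : List TapeSym) (i : ℕ) :
    let c := (simStep L)^[i] (simInit L v)
    c.1 ≤ L.getD 1 0 ∧ c.2.length = L.getD 0 0 + 1 ∧
      ∀ t ∈ c.2, t.1.length + t.2.length ≤ v.length + 2 * i := by
  induction i with
  | zero =>
    refine ⟨Nat.zero_le _, by simp [simInit], fun t ht => ?_⟩
    obtain ⟨j, -, rfl⟩ := List.mem_map.1 ht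
    cases j == 0 <;> simp
  | succ i ih =>
    rw [Function.iterate_succ_apply']
    generalize (simStep L)^[i] (simInit L v) = c at ih
    dsimp only at ih ⊢
    rw [simStep]
    cases simRule L c with
    | none => exact ⟨ih.1, ih.2.1, fun t ht => (ih.2.2 t ht).trans (by omega)⟩
    | some r =>
      refine ⟨Nat.lt_succ_iff.1 (Nat.mod_lt _ (Nat.succ_pos _)), by simp [simApply], fun t ht => ?_⟩
      obtain ⟨j, -, rfl⟩ := List.mem_map.1 ht
      refine (ListTape.length_act _ _ _).trans ?_
      by_cases hj : j < c.2.length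
      · have h1 := ih.2.2 _ (List.getElem_mem hj)
        simp only [List.getD_eq_getElem?_getD, List.getElem?_eq_getElem hj, Option.getD_some]
        omega
      · simp only [List.getD_eq_getElem?_getD, List.getElem?_eq_none (not_lt.1 hj),
          Option.getD_none]
        simp only [List.length_nil]
        omega

theorem esize_symList (l : List TapeSym) : esize l ≤ 1 + l.length * 8 :=
  esize_list_le (B := 7) fun s _ => esize_sym s

theorem esize_simStep_iterate (L : List ℕ) (v : List TapeSym) (i : ℕ) :
    esize ((simStep L)^[i] (simInit L v)) ≤ 2 * L.getD 1 0 + 3 + (L.getD 0 0 + 1) *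
      (4 + (v.length + 2 * i) * 8) := by
  obtain ⟨h1, h2, h3⟩ := simStep_invariant L v i
  generalize (simStep L)^[i] (simInit L v) = c at h1 h2 h3
  obtain ⟨p, ts⟩ := c
  have h4 := esize_list_le (l := ts) (B := 3 + (v.length + 2 * i) * 8) fun t ht => by
    obtain ⟨l, r⟩ := t
    have h5 := h3 _ ht
    have h6 := esize_symList l
    have h7 := esize_symList r
    simp only [esize_prod] at h5 ⊢
    omega
  dsimp only at h1 h2
  rw [h2] at h4
  rw [esize_prod, esize_nat]
  rw [show 4 + (v.length + 2 * i) * 8 = 3 + (v.length + 2 * i) * 8 + 1 by ring]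
  omega

namespace PolyTime

@[fun_prop] theorem symBeq {f g : α → TapeSym} (hf : PolyTime f) (hg : PolyTime g) :
    PolyTime fun x => f x == g x := by
  have hf' : PolyTime fun x => (f x).num := hf
  have hg' : PolyTime fun x => (g x).num := hg
  refine (hf'.beq hg').congr fun x => ?_
  rw [Bool.eq_iff_iff, beq_iff_eq, beq_iff_eq, TapeSym.num_injective.eq_iff]

@[fun_prop] theorem symOfNat {f : α → ℕ} (hf : PolyTime f) : PolyTime fun x => symOfNat (f x) := by
  have h : PolyTime fun x => bif f x == 0 then TapeSym.blank else
      bif f x == 1 then .bit false else bif f x == 2 then .bit true else .sep := by fun_prop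
  refine h.congr fun x => ?_
  rcases f x with _ | _ | _ | n <;> simp [_root_.symOfNat]

@[fun_prop] theorem bit {f : α → Bool} (hf : PolyTime f) : PolyTime fun x => TapeSym.bit (f x) := by
  have h : PolyTime fun x => bif f x then TapeSym.bit true else .bit false := by fun_prop
  exact h.congr fun x => by cases f x <;> rfl

@[fun_prop] theorem listTapeAct {s : γ → TapeSym} {m : γ → ℕ} {t : γ → ListTape} (hs : PolyTime s)
    (hm : PolyTime m) (ht : PolyTime t) : PolyTime fun x => (t x).act (s x) (m x) := by
  unfold ListTape.act
  fun_prop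

@[fun_prop] theorem readOut {r : γ → List TapeSym} (hr : PolyTime r) :
    PolyTime fun x => readOut (r x) := by
  refine foldr hr (const _) (by fun_prop) (g := fun x => 3 + (r x).length * 4)
    (.add (.const 3) (.mul (.length hr) (.const 4))) fun x l hl => ?_
  change esize (_root_.readOut l) ≤ _
  have h : ∀ w ∈ _root_.readOut l, w.length ≤ l.length := by
    clear hl
    induction l with
    | nil => simp [_root_.readOut]
    | cons s l ih =>
      rw [_root_.readOut, List.foldr_cons, ← _root_.readOut]
      intro w hw
      cases h1 : s == .blank <;> cases h2 : s == .sep <;> rw [h1, h2] at hw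
      · obtain ⟨w', hw', rfl⟩ := Option.map_eq_some_iff.1 (show Option.map _ _ = _ from hw)
        simpa using ih w' hw'
      · simp at hw
      · obtain rfl : [] = w := by simpa using hw
        simp
      · obtain rfl : [] = w := by simpa using hw
        simp
  have h0 := hl.length_le
  cases h1 : _root_.readOut l with
  | none => simp; omega
  | some w =>
    have h2 := h w h1
    have h3 := esize_list_le (l := w) (B := 3) fun b _ => esize_bool b
    rw [esize_some]
    omega

@[fun_prop] theorem ruleField {L : γ → List ℕ} {r j : γ → ℕ} (hL : PolyTime L) (hr : PolyTime r)
    (hj : PolyTime j) : PolyTime fun x => ruleField (L x) (r x) (j x) := by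
  unfold _root_.ruleField
  fun_prop

@[fun_prop] theorem simRule {L : γ → List ℕ} {c : γ → SimCfg} (hL : PolyTime L)
    (hc : PolyTime c) : PolyTime fun x => simRule (L x) (c x) := by
  unfold _root_.simRule
  fun_prop

@[fun_prop] theorem simApply {L : γ → List ℕ} {r : γ → ℕ} {c : γ → SimCfg} (hL : PolyTime L)
    (hr : PolyTime r) (hc : PolyTime c) : PolyTime fun x => simApply (L x) (r x) (c x) := by
  unfold _root_.simApply
  fun_prop

@[fun_prop] theorem simStep {L : γ → List ℕ} {c : γ → SimCfg} (hL : PolyTime L)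
    (hc : PolyTime c) : PolyTime fun x => simStep (L x) (c x) := by
  unfold _root_.simStep
  fun_prop

@[fun_prop] theorem simInit {L : γ → List ℕ} {v : γ → List TapeSym} (hL : PolyTime L)
    (hv : PolyTime v) : PolyTime fun x => simInit (L x) (v x) := by
  unfold _root_.simInit
  fun_prop

@[fun_prop] theorem unaryFields {w : γ → List Bool} (hw : PolyTime w) :
    PolyTime fun x => unaryFields (w x) := by
  have h := foldl (f := fun _ (s : ℕ × List ℕ) b => bif b then (s.1 + 1, s.2) else (0, s.1 :: s.2))
    (b := fun _ => (0, [])) hw (const _) (by fun_prop) (g := fun x => 3 + (w x).length * 2)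
    (.add (.const 3) (.mul (.length hw) (.const 2))) fun x l hl => by
      have e : ∀ (l : List Bool) (s : ℕ × List ℕ), esize (l.foldl (fun (s : ℕ × List ℕ) b =>
          bif b then (s.1 + 1, s.2) else (0, s.1 :: s.2)) s) ≤ esize s + l.length * 2 := by
        intro l
        induction l with
        | nil => intro s; simp
        | cons b l ih =>
          intro s
          refine (ih _).trans ?_
          obtain ⟨m, l'⟩ := s
          cases b <;> simp <;> omega
      refine (e l _).trans ?_
      have := hl.length_le
      simp only [esize_prod, esize_nat, esize_nil]
      omega
  have h' := h.snd.reverse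
  refine h'.congr fun x => ?_
  rw [← unaryFieldsAux_eq_foldl]
  simp [_root_.unaryFields]

theorem simOutput {L : γ → List ℕ} {c : γ → SimCfg} (hL : PolyTime L)
    (hc : PolyTime c) : PolyTime fun x => simOutput (L x) (c x) := by
  unfold _root_.simOutput
  fun_prop

/-- The universal machine has polynomial overhead. -/
@[fun_prop] theorem simResult {w : γ → List Bool} {v : γ → List TapeSym} {s : γ → ℕ}
    (hw : PolyTime w) (hv : PolyTime v) (hs : PolyTime s) :
    PolyTime fun x => simResult (w x) (v x) (s x) := by
  have h1 := iterate (f := fun x c => _root_.simStep (_root_.unaryFields (w x)) c)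
    (b := fun x => _root_.simInit (_root_.unaryFields (w x)) (v x)) hs (by fun_prop) (by fun_prop)
    (g := fun x => 2 * (_root_.unaryFields (w x)).getD 1 0 + 3 +
      ((_root_.unaryFields (w x)).getD 0 0 + 1) * (4 + ((v x).length + 2 * s x) * 8))
    (bdd (by fun_prop)) fun x j hj => by
      refine (esize_simStep_iterate _ _ _).trans ?_
      gcongr
  have h2 : PolyTime fun x => (_root_.simStep (_root_.unaryFields (w x)))^[s x]
    (_root_.simInit (_root_.unaryFields (w x)) (v x)) := h1
  unfold _root_.simResult
  exact simOutput (by fun_prop) h2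

end PolyTime

/-! ### Selection of the best predictor -/

/-- The binary words in a list of symbols, each of them being followed by a separator. -/
def splitWords (v : List TapeSym) : List (List Bool) :=
  v.foldr (fun s l => bif s == .sep then [] :: l else
    ((s == .bit true) :: l.headD []) :: l.tail) []

theorem splitWords_append (w : List Bool) (v : List TapeSym) :
    splitWords (bitsToSym w ++ .sep :: v) = w :: splitWords v := by
  induction w with
  | nil => rfl
  | cons b w ih =>
    have h : splitWords (bitsToSym (b :: w) ++ .sep :: v) =
        (b :: (splitWords (bitsToSym w ++ .sep :: v)).headD []) ::
          (splitWords (bitsToSym w ++ .sep :: v)).tail := by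
      cases b <;> rfl
    rw [h, ih]
    rfl

/-- The word that presents the first `m` samples, whose encodings are listed in `l`. -/
def joinWords (l : List (List Bool)) (m : ℕ) : List TapeSym :=
  (List.range m).flatMap fun i => bitsToSym (l.getD (2 * i) []) ++ [.sep] ++
    bitsToSym (l.getD (2 * i + 1) []) ++ [.sep]

/-- Decide whether the predictor `f` maps `x` to `y` within `s` steps. -/
def predictsB (s : ℕ) (f : Option (List Bool)) (x y : List Bool) : Bool :=
  f.elim false fun w => (simResult w (bitsToSym x) s).elim false fun y' => y' == y

/-- The number of errors of the predictor `f` on the samples with the numbers `m, …, n - 1`. -/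
def countErrors (l : List (List Bool)) (n m s : ℕ) (f : Option (List Bool)) : ℕ :=
  ((List.range n).filter fun i => Nat.ble m i &&
    !(predictsB s f (l.getD (2 * i) []) (l.getD (2 * i + 1) []))).length

/-- The outputs of the first `k` machines, each with the number of its errors. -/
def candidates (l : List (List Bool)) (n m k s : ℕ) : List (Option (List Bool) × ℕ) :=
  (List.range k).map fun j =>
    (simResult (binaryWord (j + 1)) (joinWords l m) s,
      countErrors l n m s (simResult (binaryWord (j + 1)) (joinWords l m) s))

/-- An entry with the least second component. -/
def leastSnd {β : Type} (l : List (β × ℕ)) (d : β × ℕ) : β × ℕ :=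
  l.foldl (fun b a => bif Nat.ble b.2 a.2 then b else a) d

theorem leastSnd_mem {β : Type} (l : List (β × ℕ)) (d : β × ℕ) : leastSnd l d ∈ d :: l := by
  induction l generalizing d with
  | nil => simp [leastSnd]
  | cons a l ih =>
    have h := ih (bif Nat.ble d.2 a.2 then d else a)
    change leastSnd l _ ∈ _
    cases h1 : Nat.ble d.2 a.2 <;> simp only [h1, cond_true, cond_false, List.mem_cons] at h ⊢ <;>
      tauto

theorem leastSnd_le {β : Type} (l : List (β × ℕ)) (d : β × ℕ) :
    ∀ a ∈ d :: l, (leastSnd l d).2 ≤ a.2 := by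
  induction l generalizing d with
  | nil => simp [leastSnd]
  | cons a l ih =>
    have h := ih (bif Nat.ble d.2 a.2 then d else a)
    change ∀ b ∈ _, (leastSnd l _).2 ≤ _
    intro b hb
    have h0 := h _ List.mem_cons_self
    rcases List.mem_cons.1 hb with rfl | hb
    · refine h0.trans ?_
      cases h1 : Nat.ble b.2 a.2
      · have : ¬ b.2 ≤ a.2 := fun h => by
          rw [Nat.ble_eq_true_of_le h] at h1; cases h1
        simp; omega
      · simp
    · rcases List.mem_cons.1 hb with rfl | hb
      · refine h0.trans ?_
        cases h1 : Nat.ble d.2 b.2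
        · simp
        · simpa using Nat.le_of_ble_eq_true h1
      · exact h b (List.mem_cons_of_mem _ hb)

/-- The candidates at the time `T`, for the list `l` of the encodings of `n = l.length / 2` samples:
the outputs of the first `⌊log n⌋` machines, each run for `T / ⌊log n⌋` steps. -/
def candidatesAt (l : List (List Bool)) (T : ℕ) : List (Option (List Bool) × ℕ) :=
  candidates l (l.length / 2) (99 * (l.length / 2) / 100) (logFloor (l.length / 2))
    (T / logFloor (l.length / 2))

/-- The best candidate. -/
def bestOf (c : List (Option (List Bool) × ℕ)) : Option (List Bool) :=
  (leastSnd c (c.headD (none, 0))).1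

/-- The current best predictor, as a function of the input and the time. -/
def bestOutput (v : List TapeSym) (T : ℕ) : Option (List Bool) :=
  bestOf (candidatesAt (splitWords v) T)

section Correctness

variable {X Y : Type*} (encX : X → List Bool) (encY : Y → List Bool)

theorem splitWords_encodeSamples {n : ℕ} (Z : Fin n → X × Y) :
    splitWords (encodeSamples encX encY Z) =
      (List.ofFn Z).flatMap fun z => [encX z.1, encY z.2] := by
  rw [encodeSamples]
  induction List.ofFn Z with
  | nil => rfl
  | cons z l ih =>
    have h : ∀ v, bitsToSym (encX z.1) ++ [.sep] ++ bitsToSym (encY z.2) ++ [.sep] ++ v =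
        bitsToSym (encX z.1) ++ .sep :: (bitsToSym (encY z.2) ++ .sep :: v) := by
      intro v; simp
    rw [List.flatMap_cons, h, splitWords_append, splitWords_append, ih]
    rfl

theorem length_flatMap_pair {ι : Type*} {β : Type} (l : List ι) (f g : ι → β) :
    (l.flatMap fun z => [f z, g z]).length = 2 * l.length := by
  induction l with
  | nil => rfl
  | cons a l ih => simp only [List.flatMap_cons, List.length_append, ih, List.length_cons]; simp; omega

theorem getD_flatMap_pair {ι : Type*} {β : Type} (l : List ι) (f g : ι → β) (d : β) (i : ℕ)
    (hi : i < l.length) : (l.flatMap fun z => [f z, g z]).getD (2 * i) d = f l[i] ∧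
      (l.flatMap fun z => [f z, g z]).getD (2 * i + 1) d = g l[i] := by
  induction l generalizing i with
  | nil => simp at hi
  | cons a l ih =>
    rcases i with _ | i
    · simp
    · have := ih i (by simpa using hi)
      simpa [Nat.mul_succ] using this

theorem joinWords_eq {n m : ℕ} (hm : m ≤ n) (Z : Fin n → X × Y) :
    joinWords (splitWords (encodeSamples encX encY Z)) m =
      encodeSamples encX encY fun j : Fin m => Z (Fin.castLE hm j) := by
  rw [splitWords_encodeSamples, encodeSamples, joinWords, List.ofFn_eq_map (n := m),
    List.flatMap_map, ← List.map_coe_finRange_eq_range, List.flatMap_map]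
  refine congrArg (fun f => List.flatMap f (List.finRange m)) (funext fun j => ?_)
  have h := getD_flatMap_pair (List.ofFn Z) (fun z => encX z.1) (fun z => encY z.2) [] j
    (by rw [List.length_ofFn]; omega)
  rw [h.1, h.2, List.getElem_ofFn]
  rfl

theorem predictsB_iff (s : ℕ) (f : Option (List Bool)) (z : X × Y) :
    predictsB s f (encX z.1) (encY z.2) = true ↔ Predicts encX encY s f z := by
  rw [predictsB, Predicts]
  rcases f with _ | w
  · simp
  · simp only [Option.elim_some, simResult_eq, Option.some.injEq, exists_eq_left']
    cases (decodeTM w).result (bitsToSym (encX z.1)) s <;> simp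

theorem length_filter_range (n : ℕ) (p : ℕ → Bool) :
    ((List.range n).filter p).length = {j : Fin n | p j = true}.ncard := by
  rw [← List.map_coe_finRange_eq_range, List.filter_map, List.length_map,
    Set.ncard_eq_toFinset_card', Set.toFinset_ofPred, Fin.univ_def, Finset.card_def,
    Finset.filter_val, Multiset.filter_coe, Multiset.coe_card]
  congr 2
  funext j
  simp

theorem countErrors_eq {n : ℕ} (Z : Fin n → X × Y) (s : ℕ) (f : Option (List Bool)) :
    countErrors (splitWords (encodeSamples encX encY Z)) n (99 * n / 100) s f =
      heldOutErrors encX encY s f Z := by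
  rw [countErrors, length_filter_range, heldOutErrors]
  congr 1
  ext j
  have h := getD_flatMap_pair (List.ofFn Z) (fun z => encX z.1) (fun z => encY z.2) [] j
    (by rw [List.length_ofFn]; omega)
  rw [Set.mem_ofPred_eq, Set.mem_ofPred_eq, splitWords_encodeSamples, h.1, h.2, List.getElem_ofFn,
    Bool.and_eq_true, Nat.ble_eq, Bool.not_eq_true', ← predictsB_iff, Bool.not_eq_true]

theorem isCurrentBest_bestOutput {n : ℕ} (Z : Fin n → X × Y) (T : ℕ) (hn : 1 ≤ ⌊Real.log n⌋₊) :
    IsCurrentBest encX encY ⌊Real.log n⌋₊ (T / ⌊Real.log n⌋₊) Z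
      (bestOutput (encodeSamples encX encY Z) T) := by
  have hl : (splitWords (encodeSamples encX encY Z)).length / 2 = n := by
    rw [splitWords_encodeSamples, length_flatMap_pair, List.length_ofFn]
    omega
  rw [← logFloor_eq] at hn ⊢
  set k := logFloor n with hk
  rw [bestOutput, bestOf, candidatesAt, hl, ← hk]
  set c := candidates (splitWords (encodeSamples encX encY Z)) n (99 * n / 100) k (T / k) with hc
  have hc' : c = (List.range k).map fun j =>
      (learned encX encY (j + 1) (T / k) (trainPart Z), heldOutErrors encX encY (T / k)
        (learned encX encY (j + 1) (T / k) (trainPart Z)) Z) := by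
    rw [hc, candidates]
    refine List.map_congr_left fun j _ => ?_
    rw [countErrors_eq, joinWords_eq encX encY (by omega), simResult_eq]
    rfl
  have h1 : leastSnd c (c.headD (none, 0)) ∈ c := by
    have h2 := leastSnd_mem c (c.headD (none, 0))
    rcases List.mem_cons.1 h2 with h3 | h3
    · rw [h3]
      cases hc0 : c with
      | nil => simp [hc', Nat.one_le_iff_ne_zero.1 hn] at hc0
      | cons a l => simp
    · exact h3
  have h4 := leastSnd_le c (c.headD (none, 0))
  generalize leastSnd c (c.headD (none, 0)) = b at h1 h4
  rw [hc'] at h1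
  obtain ⟨j, hj, rfl⟩ := List.mem_map.1 h1
  refine ⟨j + 1, ⟨by omega, List.mem_range.1 hj⟩, rfl, fun i hi => ?_⟩
  refine h4 (learned encX encY i (T / k) (trainPart Z), heldOutErrors encX encY
    (T / k) (learned encX encY i (T / k) (trainPart Z)) Z) (List.mem_cons_of_mem _ ?_)
  rw [hc']
  refine List.mem_map.2 ⟨i - 1, List.mem_range.2 (by have := hi.1; have := hi.2; omega), ?_⟩
  rw [Nat.sub_add_cancel hi.1]

end Correctness

namespace PolyTime

@[fun_prop] theorem bitsToSym {w : γ → List Bool} (hw : PolyTime w) :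
    PolyTime fun x => bitsToSym (w x) := by
  unfold _root_.bitsToSym
  fun_prop

@[fun_prop] theorem splitWords {v : γ → List TapeSym} (hv : PolyTime v) :
    PolyTime fun x => splitWords (v x) := by
  refine foldr hv (const []) (by fun_prop) (g := fun x => 1 + (v x).length * 8)
    (.add (.const 1) (.mul (.length hv) (.const 8))) fun x l hl => ?_
  refine le_trans ?_ (Nat.add_le_add_left (Nat.mul_le_mul_right _ hl.length_le) _)
  clear hl
  induction l with
  | nil => simp
  | cons s l ih =>
    rw [List.foldr_cons]
    generalize List.foldr (fun (s : TapeSym) (l : List (List Bool)) => bif s == .sep then [] :: l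
      else ((s == .bit true) :: l.headD []) :: l.tail) [] l = r at ih
    cases s == .sep
    · have h3 := esize_bool (s == .bit true)
      rcases r with _ | ⟨w, r⟩ <;> simp at ih ⊢ <;> omega
    · simp; omega

@[fun_prop] theorem joinWords {l : γ → List (List Bool)} {m : γ → ℕ} (hl : PolyTime l)
    (hm : PolyTime m) : PolyTime fun x => joinWords (l x) (m x) := by
  unfold _root_.joinWords
  fun_prop

theorem boolListBeq {a b : γ → List Bool} (ha : PolyTime a) (hb : PolyTime b) :
    PolyTime fun x => a x == b x := by
  have h : PolyTime fun x => (a x).length == (b x).length && (List.range (a x).length).all fun i =>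
    !(Bool.xor ((a x).getD i false) ((b x).getD i false)) := by fun_prop
  refine h.congr fun x => ?_
  rw [Bool.eq_iff_iff, beq_iff_eq, Bool.and_eq_true, beq_iff_eq, List.all_eq_true]
  constructor
  · intro h
    simp [h]
  · rintro ⟨h1, h2⟩
    refine List.ext_getElem h1 fun i hi hi' => ?_
    have := h2 i (List.mem_range.2 hi)
    simpa [hi, hi'] using this

@[fun_prop] theorem predictsB {s : γ → ℕ} {f : γ → Option (List Bool)} {a b : γ → List Bool}
    (hs : PolyTime s) (hf : PolyTime f) (ha : PolyTime a) (hb : PolyTime b) :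
    PolyTime fun x => predictsB (s x) (f x) (a x) (b x) := by
  unfold _root_.predictsB
  refine optionElim hf (const _) (optionElim (by fun_prop) (const _) (boolListBeq ?_ ?_)) <;>
    fun_prop

@[fun_prop] theorem countErrors {l : γ → List (List Bool)} {n m s : γ → ℕ}
    {f : γ → Option (List Bool)} (hl : PolyTime l) (hn : PolyTime n) (hm : PolyTime m)
    (hs : PolyTime s) (hf : PolyTime f) :
    PolyTime fun x => countErrors (l x) (n x) (m x) (s x) (f x) := by
  unfold _root_.countErrors
  fun_prop

@[fun_prop] theorem binaryWord {i : γ → ℕ} (hi : PolyTime i) :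
    PolyTime fun x => binaryWord (i x) := by
  -- a conversion from unary to binary notation
  have h : PolyTime fun x => BNat.smul (i x) ⟨1⟩ := by fun_prop
  have h' : PolyTime fun x => (i x).bits :=
    Feasible.congr h (fun _ => rfl) fun x => congrArg (fun n => Enc.enc (Nat.bits n))
      (mul_one (i x)).symm
  exact h'.reverse.tail

@[fun_prop] theorem candidates {l : γ → List (List Bool)} {n m k s : γ → ℕ} (hl : PolyTime l)
    (hn : PolyTime n) (hm : PolyTime m) (hk : PolyTime k) (hs : PolyTime s) :
    PolyTime fun x => candidates (l x) (n x) (m x) (k x) (s x) := by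
  unfold _root_.candidates
  fun_prop

@[fun_prop] theorem leastSnd {l : γ → List (β × ℕ)} {d : γ → β × ℕ} (hl : PolyTime l)
    (hd : PolyTime d) : PolyTime fun x => leastSnd (l x) (d x) := by
  refine foldl hl hd (by fun_prop) ((PolyBdd.esize hd).add (.esize hl)) fun x l' hl' => ?_
  rcases List.mem_cons.1 (leastSnd_mem l' (d x)) with h | h
  · rw [← _root_.leastSnd, h]; omega
  · have h1 := esize_lt_of_mem h
    have h2 := esize_le_of_sublist hl'.sublist
    rw [← _root_.leastSnd]
    omega

theorem candidatesAt {l : γ → List (List Bool)} {T : γ → ℕ} (hl : PolyTime l)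
    (hT : PolyTime T) : PolyTime fun x => candidatesAt (l x) (T x) := by
  unfold _root_.candidatesAt
  fun_prop

theorem bestOf {c : γ → List (Option (List Bool) × ℕ)} (hc : PolyTime c) :
    PolyTime fun x => bestOf (c x) := by
  unfold _root_.bestOf
  fun_prop

/-- The current best predictor is computable in polynomial time. -/
@[fun_prop] theorem bestOutput {v : γ → List TapeSym} {T : γ → ℕ} (hv : PolyTime v)
    (hT : PolyTime T) : PolyTime fun x => bestOutput (v x) (T x) := by
  unfold _root_.bestOutput
  exact (candidatesAt hv.splitWords hT).bestOf

end PolyTime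

end PolynomialTime

/-! ### Input and output -/

namespace Frag

/-- Push a word on the main stack. -/
def pushWord : List TapeSym → Frag
  | [] => nop
  | s :: w => seq (pushWord w) (push .main s)

theorem pushWord_runs (w : List TapeSym) (i o m a c) :
    (pushWord w).Runs ⟨i, o, m, a, c⟩ ⟨i, o, w ++ m, a, c⟩ (2 * w.length + 1) := by
  induction w with
  | nil => exact nop_runs _
  | cons s w ih => exact (ih.seq (push_runs _ _ _)).mono (by simp only [List.length_cons]; omega)

/-- The symbol is not blank. -/
def notBlank (s : TapeSym) : Bool := decide (s ≠ .blank)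

/-- The code of a list with the first entry `s` begins with this word, and the code of its tail
follows. -/
def consCode (s : TapeSym) : List TapeSym := .bit true :: (Enc.enc s).word

/-- Replace the input by the code of the list of its symbols, on the main stack. The list is
reversed, because the symbols are pushed in the order in which they are read. -/
def readInput : Frag :=
  seq (pushWord [.bit false]) <| loop .inp notBlank <|
    seq (ite .inp (fun s => decide (s = .sep)) (pushWord (consCode .sep))
      (ite .inp isOne (pushWord (consCode (.bit true))) (pushWord (consCode (.bit false)))))
    (pop .inp)

theorem readInput_loop_runs (v l : List TapeSym) (hv : ∀ s ∈ v, s ≠ .blank) (o m a c) :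
    (loop .inp notBlank <|
      seq (ite .inp (fun s => decide (s = .sep)) (pushWord (consCode .sep))
        (ite .inp isOne (pushWord (consCode (.bit true))) (pushWord (consCode (.bit false)))))
      (pop .inp)).Runs ⟨v, o, (Enc.enc l).word ++ m, a, c⟩
      ⟨[], o, (Enc.enc (v.reverse ++ l)).word ++ m, a, c⟩ (30 * v.length + 1) := by
  induction v generalizing l with
  | nil => exact Runs.loop_nil rfl
  | cons s v ih =>
    have h1 := ih (s :: l) fun t ht => hv t (List.mem_cons_of_mem _ ht)
    have h2 : (Enc.enc (s :: l)).word ++ m = consCode s ++ ((Enc.enc l).word ++ m) := by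
      change TapeSym.bit true :: ((Enc.enc s).word ++ (Enc.enc l).word) ++ m = _
      simp [consCode]
    rw [List.reverse_cons, List.append_assoc, List.singleton_append]
    rw [h2] at h1
    have h3 : (ite .inp (fun s => decide (s = .sep)) (pushWord (consCode .sep))
        (ite .inp isOne (pushWord (consCode (.bit true))) (pushWord (consCode (.bit false))))).Runs
        ⟨s :: v, o, (Enc.enc l).word ++ m, a, c⟩
        ⟨s :: v, o, consCode s ++ ((Enc.enc l).word ++ m), a, c⟩ 19 := by
      rcases s with _ | (_ | _) | _
      · exact absurd rfl (hv _ List.mem_cons_self)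
      · exact (Runs.ite_false rfl (Runs.ite_false rfl (pushWord_runs _ _ _ _ _ _))).mono (by decide)
      · exact (Runs.ite_false rfl (Runs.ite_true rfl (pushWord_runs _ _ _ _ _ _))).mono (by decide)
      · exact (Runs.ite_true rfl (pushWord_runs _ _ _ _ _ _)).mono (by decide)
    refine (Runs.loop_cons (decide_eq_true (hv s List.mem_cons_self))
      (h3.seq (pop_runs _ _)) h1).mono ?_
    simp only [List.length_cons]
    omega

theorem readInput_runs (v : List TapeSym) (hv : ∀ s ∈ v, s ≠ .blank) (o m a c) :
    readInput.Runs ⟨v, o, m, a, c⟩ ⟨[], o, (Enc.enc v.reverse).word ++ m, a, c⟩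
      (30 * v.length + 4) := by
  have h := readInput_loop_runs v [] hv o m a c
  rw [List.append_nil] at h
  exact ((pushWord_runs [.bit false] _ _ _ _ _).seq h).mono
    (by simp only [List.length_singleton]; omega)

/-- What is written on the output tape for an optional word: the word in reverse order (its letters
are pushed one by one), and a separator if there is none, because an empty tape carries the empty
word. -/
def outWord : Option (List Bool) → List TapeSym
  | none => [.sep]
  | some w => w.reverse.map .bit

/-- Write the optional word on top of the main stack on the output tape. -/
def writeOutput : Frag :=
  seq (loop .out notBlank (pop .out)) <| ite .main isOne
    (seq (pop .main) <| seq (pop .main) <| seq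
      (loop .main isOne <| seq (pop .main) <| ite .main isOne
        (seq (pop .main) (seq (pop .main) (seq (pop .main) (push .out (.bit true)))))
        (seq (pop .main) (push .out (.bit false))))
      (pop .main))
    (seq (pop .main) (push .out .sep))

theorem clearOutput_runs (w : List TapeSym) (hw : ∀ s ∈ w, s ≠ .blank) (i m a c) :
    (loop .out notBlank (pop .out)).Runs ⟨i, w, m, a, c⟩ ⟨i, [], m, a, c⟩ (2 * w.length + 1) := by
  induction w with
  | nil => exact Runs.loop_nil rfl
  | cons s w ih =>
    have := ih (fun t ht => hw t (List.mem_cons_of_mem _ ht))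
    refine (Runs.loop_cons (decide_eq_true (hw s List.mem_cons_self)) (pop_runs _ _) this).mono ?_
    simp only [List.length_cons]; omega

theorem writeOutput_loop_runs (w : List Bool) (i o m a c) :
    (loop .main isOne <| seq (pop .main) <| ite .main isOne
      (seq (pop .main) (seq (pop .main) (seq (pop .main) (push .out (.bit true)))))
      (seq (pop .main) (push .out (.bit false)))).Runs
      ⟨i, o, (Enc.enc w).word ++ m, a, c⟩
      ⟨i, w.reverse.map .bit ++ o, .bit false :: m, a, c⟩ (10 * w.length + 1) := by
  induction w generalizing o with
  | nil => exact Runs.loop_nil rfl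
  | cons b w ih =>
    have h1 := ih (.bit b :: o)
    have h2 : (Enc.enc (b :: w)).word ++ m =
        .bit true :: ((Enc.enc b).word ++ ((Enc.enc w).word ++ m)) := by
      change TapeSym.bit true :: ((Enc.enc b).word ++ (Enc.enc w).word) ++ m = _
      simp
    rw [h2]
    rw [List.reverse_cons, List.map_append, List.append_assoc]
    cases b
    · refine (Runs.loop_cons rfl ((pop_runs _ _).seq (Runs.ite_false rfl
        ((pop_runs _ _).seq (push_runs _ _ _)))) h1).mono ?_
      simp only [List.length_cons]; omega
    · refine (Runs.loop_cons rfl ((pop_runs _ _).seq (Runs.ite_true rfl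
        ((pop_runs _ _).seq ((pop_runs _ _).seq ((pop_runs _ _).seq (push_runs _ _ _)))))) h1).mono ?_
      simp only [List.length_cons]; omega

theorem writeOutput_runs (f : Option (List Bool)) (i o m a c) (ho : ∀ s ∈ o, s ≠ .blank) :
    writeOutput.Runs ⟨i, o, (Enc.enc f).word ++ m, a, c⟩ ⟨i, outWord f, m, a, c⟩
      (2 * o.length + 10 * esize f) := by
  have h1 := clearOutput_runs o ho i ((Enc.enc f).word ++ m) a c
  cases f with
  | none =>
    refine (h1.seq (Runs.ite_false rfl ((pop_runs _ _).seq (push_runs _ _ _)))).mono ?_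
    rw [esize_none]; omega
  | some w =>
    have h2 := writeOutput_loop_runs w i [] m a c
    rw [List.append_nil] at h2
    refine (h1.seq (Runs.ite_true rfl ((pop_runs _ _).seq ((pop_runs _ _).seq
      (h2.seq (pop_runs _ _)))))).mono ?_
    have := length_lt_esize w
    rw [esize_some]; omega

theorem outWord_ne_blank (f : Option (List Bool)) : ∀ s ∈ outWord f, s ≠ .blank := by
  intro s hs
  rcases f with _ | w
  · simp only [outWord, List.mem_singleton] at hs
    rw [hs]; exact TapeSym.noConfusion
  · obtain ⟨b, -, rfl⟩ := List.mem_map.1 hs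
    exact TapeSym.noConfusion

theorem length_outWord (f : Option (List Bool)) : (outWord f).length ≤ esize f := by
  rcases f with _ | w
  · simp [outWord]
  · have := length_lt_esize w
    simp only [outWord, List.length_map, List.length_reverse, esize_some]
    omega

theorem readWord_outWord (f : Option (List Bool)) :
    readWord (Tape.mk₁ (outWord (f.map List.reverse))) = f := by
  change readWord (ListTape.toTape ([], outWord (f.map List.reverse))) = f
  rw [readWord_toTape]
  rcases f with _ | w
  · rfl
  · simp only [Option.map_some, outWord, List.reverse_reverse]
    induction w with
    | nil => rfl
    | cons b w ih => rw [List.map_cons, readOut_bit, ih]; rfl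

/-! ### A machine with a clock -/

/-- The machine that runs `F` once and then `G` over and over again. Before each run of `G` it
passes through a tick state. -/
def clockMachine (F G : Frag) : TM where
  K := Stk
  finK := inferInstance
  Q := F.Q ⊕ Option G.Q
  finQ := by have := F.finQ; have := G.finQ; infer_instance
  inp := .inp
  out := .out
  start := .inl F.start
  δ := fun q h => match q with
    | .inl q => match F.δ q h with
      | (some q', a) => some (.inl q', a)
      | (none, a) => some (.inr none, a)
    | .inr none => some (.inr (some G.start), noAct h)
    | .inr (some q) => match G.δ q h with
      | (some q', a) => some (.inr (some q'), a)
      | (none, a) => some (.inr none, a)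

variable {F G : Frag}

theorem step_clockMachine_ne_none (c : (clockMachine F G).Cfg) :
    (clockMachine F G).step c ≠ none := by
  rw [TM.step, ne_eq, Option.map_eq_none_iff]
  rcases c with ⟨q | _ | q, τ⟩
  · dsimp only [clockMachine]
    rcases F.δ q _ with ⟨_ | _, _⟩ <;> simp
  · simp [clockMachine]
  · dsimp only [clockMachine]
    rcases G.δ q _ with ⟨_ | _, _⟩ <;> simp

/-- One step of a machine, as a total function. -/
def next (M : TM) (c : M.Cfg) : M.Cfg := (M.step c).getD c

theorem next_tick (τ : Tapes) :
    next (clockMachine F G) ⟨.inr none, τ⟩ = ⟨.inr (some G.start), τ⟩ := by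
  change (⟨.inr (some G.start), actAll (noAct (heads τ)) τ⟩ : (clockMachine F G).Cfg) = _
  rw [actAll_noAct]

theorem next_inl_some {q q' : F.Q} {τ : Tapes} {a} (h : F.δ q (heads τ) = (some q', a)) :
    next (clockMachine F G) ⟨.inl q, τ⟩ = ⟨.inl q', actAll a τ⟩ := by
  have : (clockMachine F G).δ (.inl q) (heads τ) = some (.inl q', a) := by
    simp [clockMachine, h]
  rw [next, TM.step]
  change (Option.map _ ((clockMachine F G).δ (.inl q) (heads τ))).getD _ = _
  rw [this]
  rfl

theorem next_inl_none {q : F.Q} {τ : Tapes} {a} (h : F.δ q (heads τ) = (none, a)) :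
    next (clockMachine F G) ⟨.inl q, τ⟩ = ⟨.inr none, actAll a τ⟩ := by
  have : (clockMachine F G).δ (.inl q) (heads τ) = some (.inr none, a) := by
    simp [clockMachine, h]
  rw [next, TM.step]
  change (Option.map _ ((clockMachine F G).δ (.inl q) (heads τ))).getD _ = _
  rw [this]
  rfl

theorem next_inr_some {q q' : G.Q} {τ : Tapes} {a} (h : G.δ q (heads τ) = (some q', a)) :
    next (clockMachine F G) ⟨.inr (some q), τ⟩ = ⟨.inr (some q'), actAll a τ⟩ := by
  have : (clockMachine F G).δ (.inr (some q)) (heads τ) = some (.inr (some q'), a) := by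
    simp [clockMachine, h]
  rw [next, TM.step]
  change (Option.map _ ((clockMachine F G).δ (.inr (some q)) (heads τ))).getD _ = _
  rw [this]
  rfl

theorem next_inr_none {q : G.Q} {τ : Tapes} {a} (h : G.δ q (heads τ) = (none, a)) :
    next (clockMachine F G) ⟨.inr (some q), τ⟩ = ⟨.inr none, actAll a τ⟩ := by
  have : (clockMachine F G).δ (.inr (some q)) (heads τ) = some (.inr none, a) := by
    simp [clockMachine, h]
  rw [next, TM.step]
  change (Option.map _ ((clockMachine F G).δ (.inr (some q)) (heads τ))).getD _ = _
  rw [this]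
  rfl

theorem iterate_next_inl {q τ t τ'} (h : F.Exec q τ t τ') :
    (next (clockMachine F G))^[t] ⟨.inl q, τ⟩ = ⟨.inr none, τ'⟩ ∧
      ∀ i < t, ((next (clockMachine F G))^[i] ⟨.inl q, τ⟩).state ≠ .inr none := by
  induction h with
  | exit h =>
    refine ⟨next_inl_none h, fun i hi => ?_⟩
    obtain rfl : i = 0 := by omega
    exact fun h => by cases h
  | step h _ ih =>
    rw [Function.iterate_succ_apply, next_inl_some h]
    refine ⟨ih.1, fun i hi => ?_⟩
    rcases i with _ | i
    · exact fun h => by cases h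
    · rw [Function.iterate_succ_apply, next_inl_some h]
      exact ih.2 i (by omega)

theorem iterate_next_inr {q τ t τ'} (h : G.Exec q τ t τ') :
    (next (clockMachine F G))^[t] ⟨.inr (some q), τ⟩ = ⟨.inr none, τ'⟩ ∧
      ∀ i < t, ((next (clockMachine F G))^[i] ⟨.inr (some q), τ⟩).state ≠ .inr none := by
  induction h with
  | exit h =>
    refine ⟨next_inr_none h, fun i hi => ?_⟩
    obtain rfl : i = 0 := by omega
    exact fun h => by cases h
  | step h _ ih =>
    rw [Function.iterate_succ_apply, next_inr_some h]
    refine ⟨ih.1, fun i hi => ?_⟩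
    rcases i with _ | i
    · exact fun h => by cases h
    · rw [Function.iterate_succ_apply, next_inr_some h]
      exact ih.2 i (by omega)

/-- The tick state. -/
def tickSet (F G : Frag) : Set (clockMachine F G).Q := {.inr none}

/-- The ticks of the clock, for given running times of the fragments. -/
theorem clockMachine_ticks {v : List TapeSym} {σ : ℕ → Tapes} {t₀ : ℕ} {t : ℕ → ℕ}
    (h₀ : F.Exec F.start ((clockMachine F G).init v).tape t₀ (σ 0))
    (h : ∀ T, G.Exec G.start (σ T) (t T) (σ (T + 1))) :
    {s | (clockMachine F G).TicksAt (tickSet F G) v s}.Infinite ∧ ∀ T,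
      (clockMachine F G).tickTime (tickSet F G) v T = t₀ + ∑ i ∈ Finset.range T, (t i + 1) ∧
      ((clockMachine F G).run v ((clockMachine F G).tickTime (tickSet F G) v T)).tape = σ T := by
  set M := clockMachine F G
  let τ : ℕ → ℕ := fun T => t₀ + ∑ i ∈ Finset.range T, (t i + 1)
  have hτ : ∀ T, τ (T + 1) = t T + 1 + τ T := fun T => by
    simp only [τ, Finset.sum_range_succ]; omega
  have hrun : ∀ i j, M.run v (i + j) = (next M)^[i] (M.run v j) := fun i j =>
    Function.iterate_add_apply _ _ _ _
  have h1 : ∀ T, M.run v (τ T) = ⟨.inr none, σ T⟩ := by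
    intro T
    induction T with
    | zero =>
      have := (iterate_next_inl (G := G) h₀).1
      simp only [τ, Finset.range_zero, Finset.sum_empty, add_zero]
      exact this
    | succ T ih =>
      rw [hτ, hrun, ih, Function.iterate_succ_apply, next_tick]
      exact (iterate_next_inr (h T)).1
  have h2 : ∀ s, M.TicksAt (tickSet F G) v s ↔ s ∈ Set.range τ := by
    intro s
    constructor
    · intro hs
      by_contra hne
      have h3 : ∀ T, τ T < s := by
        intro T
        induction T with
        | zero =>
          by_contra! hlt
          have hlt' : s < t₀ := lt_of_le_of_ne (by simpa [τ] using hlt)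
            fun h => hne ⟨0, by simp [τ, h]⟩
          exact (iterate_next_inl (G := G) h₀).2 s hlt' hs
        | succ T ih =>
          by_contra! hlt
          obtain ⟨i, rfl⟩ : ∃ i, s = (i + 1) + τ T := ⟨s - τ T - 1, by omega⟩
          have hlt' : i < t T := by
            have h4 : (i + 1) + τ T ≠ τ (T + 1) := fun h => hne ⟨T + 1, h.symm⟩
            rw [hτ] at hlt h4
            omega
          rw [TM.TicksAt, hrun, h1, Function.iterate_succ_apply, next_tick] at hs
          exact (iterate_next_inr (h T)).2 i hlt' hs
      have h5 : ∀ T, T ≤ τ T := by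
        intro T
        induction T with
        | zero => exact Nat.zero_le _
        | succ T ih => rw [hτ]; omega
      exact absurd (h3 s) (not_lt.2 (h5 s))
    · rintro ⟨T, rfl⟩
      rw [TM.TicksAt, h1]
      exact rfl
  have hmono : StrictMono τ := strictMono_nat_of_lt_succ fun T => by rw [hτ]; omega
  have hset : {s | M.TicksAt (tickSet F G) v s} = Set.range τ := Set.ext h2
  have hinf : {s | M.TicksAt (tickSet F G) v s}.Infinite := by
    rw [hset]; exact Set.infinite_range_of_injective hmono.injective
  have hnth : Nat.nth (M.TicksAt (tickSet F G) v) = τ := by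
    refine ((Nat.nth_strictMono hinf).range_inj hmono).1 ?_
    rw [Nat.range_nth_of_infinite hinf]
    exact hset
  refine ⟨hinf, fun T => ?_⟩
  have h3 : M.tickTime (tickSet F G) v T = τ T := congrFun hnth T
  exact ⟨h3, by rw [h3, h1]⟩

end Frag

/-! ### The machine that shows the current best predictor -/

theorem Polynomial.exists_eval_le (P : Polynomial ℕ) : ∃ c, ∀ N, 1 ≤ N → P.eval N ≤ c * N ^ c := by
  refine ⟨P.natDegree + P.eval 1, fun N hN => ?_⟩
  rw [Polynomial.eval_eq_sum_range, Polynomial.eval_eq_sum_range, add_mul]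
  refine le_trans ?_ (Nat.le_add_left _ _)
  rw [Finset.sum_mul]
  refine Finset.sum_le_sum fun i hi => ?_
  rw [one_pow, mul_one]
  refine Nat.mul_le_mul_left _ (Nat.pow_le_pow_right hN ?_)
  have := Finset.mem_range.1 hi
  omega

theorem encodeSamples_ne_blank {X Y : Type*} (encX : X → List Bool) (encY : Y → List Bool) {n : ℕ}
    (Z : Fin n → X × Y) : ∀ s ∈ encodeSamples encX encY Z, s ≠ .blank := by
  intro s hs
  obtain ⟨z, -, hz⟩ := List.mem_flatMap.1 hs
  rintro rfl
  simp [bitsToSym] at hz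

/-- The stage number `p.2` of the learner on the input `p.1`: what it outputs (in reverse order), and
the data of the next stage. -/
def learnerStage (p : List TapeSym × ℕ) : Option (List Bool) × (List TapeSym × ℕ) :=
  ((bestOutput p.1 p.2).map List.reverse, (p.1, p.2 + 1))

theorem polyTime_learnerStage : PolyTime learnerStage := by
  have h : PolyTime fun p : List TapeSym × ℕ =>
      ((bestOutput p.1 p.2).map fun w => w.reverse, (p.1, p.2 + 1)) := by fun_prop
  exact h

namespace Frag

/-- What the learner shows at the tick `T`, in the form in which it is written. -/
def stageWord (v : List TapeSym) (T : ℕ) : List TapeSym := outWord (learnerStage (v, T)).1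

/-- The stacks of the learner at the tick `T`. -/
def stageStacks (v : List TapeSym) (T : ℕ) : Stacks :=
  ⟨[], stageWord v T, (Enc.enc (v, T + 1)).word, [], []⟩

/-- Execute one stage, and write its output on the output tape. -/
theorem exists_stage : ∃ (G : Frag) (P : Polynomial ℕ), ∀ v T o, (∀ s ∈ o, s ≠ .blank) →
    esize (learnerStage (v, T)) ≤ P.eval (8 * (v.length + T + 1)) ∧
    G.Runs ⟨[], o, (Enc.enc (v, T)).word, [], []⟩ (stageStacks v T)
      (2 * o.length + 11 * P.eval (8 * (v.length + T + 1)) + 1) := by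
  obtain ⟨F, P, h⟩ := polyTime_learnerStage
  refine ⟨seq F (seq (pop .main) writeOutput), P, fun v T o ho => ?_⟩
  obtain ⟨h1, h2⟩ := h (v, T)
  beta_reduce at h1 h2
  have hS : (Enc.enc (v, T)).size ≤ 8 * (v.length + T + 1) := by
    have := esize_symList v
    change esize (v, T) ≤ _
    rw [esize_prod, esize_nat]; omega
  have hP := P.eval_mono_nat hS
  have h3 := h2 [] o [] [] []
  rw [List.append_nil, List.append_nil] at h3
  have h4 := writeOutput_runs (learnerStage (v, T)).1 [] o (Enc.enc (v, T + 1)).word [] [] ho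
  have h5 : esize (learnerStage (v, T)).1 ≤ esize (learnerStage (v, T)) := by
    change _ ≤ esize ((learnerStage (v, T)).1, (learnerStage (v, T)).2)
    rw [esize_prod]; omega
  change esize (learnerStage (v, T)) ≤ _ at h1
  exact ⟨h1.trans hP, (h3.seq ((pop_runs _ _).seq h4)).mono (by omega)⟩

/-- Read the input and prepare stage `0`. -/
theorem exists_prelude : ∃ (F : Frag) (P : Polynomial ℕ), ∀ v : List TapeSym,
    (∀ s ∈ v, s ≠ .blank) →
    F.Runs ⟨v, [], [], [], []⟩ ⟨[], [], (Enc.enc (v, 0)).word, [], []⟩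
      (30 * v.length + 4 + P.eval (8 * v.length + 1)) := by
  have h : PolyTime fun l : List TapeSym => (l.reverse, 0) := by fun_prop
  obtain ⟨F, P, h⟩ := h
  refine ⟨seq readInput F, P, fun v hv => ?_⟩
  have h1 := readInput_runs v hv [] [] [] []
  obtain ⟨-, h2⟩ := h v.reverse
  beta_reduce at h2
  have h3 := h2 [] [] [] [] []
  rw [List.reverse_reverse, List.append_nil, List.append_nil] at h3
  rw [List.append_nil] at h1
  refine (h1.seq h3).mono (Nat.add_le_add_left (P.eval_mono_nat ?_) _)
  have := esize_symList v.reverse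
  rw [List.length_reverse] at this
  change esize v.reverse ≤ _
  omega

/-- A machine that shows at every tick `T` the current best predictor, and the ticks of which come at
polynomial times. -/
theorem exists_learner : ∃ (A : TM) (tick : Set A.Q) (c : ℕ), ∀ v : List TapeSym,
    (∀ s ∈ v, s ≠ .blank) →
      (∀ t, ¬ A.Halted (A.run v t)) ∧ {t | A.TicksAt tick v t}.Infinite ∧
      ∀ T : ℕ, A.tickTime tick v T ≤ c * (v.length + T + 1) ^ c ∧
        A.shows v (A.tickTime tick v T) = bestOutput v T := by
  obtain ⟨F, PF, hF⟩ := exists_prelude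
  obtain ⟨G, PG, hG⟩ := exists_stage
  let R : Polynomial ℕ := .C 30 * .X + .C 5 + PF.comp (.C 8 * .X) +
    .X * (.C 13 * PG.comp (.C 8 * .X) + .C 2)
  obtain ⟨c, hc⟩ := R.exists_eval_le
  refine ⟨clockMachine (seq F G) G, tickSet _ _, c, fun v hv => ?_⟩
  have hstage : ∀ T, ∃ t ≤ 13 * PG.eval (8 * (v.length + (T + 1) + 1)) + 1,
      G.Exec G.start (stageStacks v T).tapes t (stageStacks v (T + 1)).tapes := by
    intro T
    have h1 := (hG v (T + 1) (stageWord v T) (outWord_ne_blank _)).2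
    refine h1.mono ?_
    have h2 := length_outWord (learnerStage (v, T)).1
    have h3 := (hG v T [] (by simp)).1
    have h4 : esize (learnerStage (v, T)).1 ≤ esize (learnerStage (v, T)) := by
      change _ ≤ esize ((learnerStage (v, T)).1, (learnerStage (v, T)).2)
      rw [esize_prod]; omega
    have h5 : PG.eval (8 * (v.length + T + 1)) ≤ PG.eval (8 * (v.length + (T + 1) + 1)) :=
      PG.eval_mono_nat (by omega)
    change 2 * (outWord (learnerStage (v, T)).1).length + _ + 1 ≤ _
    omega
  choose t ht hexec using hstage
  obtain ⟨t₀, ht₀, hexec₀⟩ := (hF v hv).seq (hG v 0 [] (by simp)).2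
  have hinit : ((clockMachine (seq F G) G).init v).tape = Stacks.tapes ⟨v, [], [], [], []⟩ := by
    classical
    funext k
    cases k
    · exact congrArg Tape.mk₁ (if_pos rfl)
    all_goals exact congrArg Tape.mk₁ (if_neg (by exact fun h => Stk.noConfusion h))
  rw [← hinit] at hexec₀
  obtain ⟨hinf, htick⟩ := clockMachine_ticks hexec₀ hexec
  refine ⟨fun t => step_clockMachine_ne_none _, hinf, fun T => ⟨?_, ?_⟩⟩
  · rw [(htick T).1]
    refine le_trans ?_ (hc _ (Nat.le_add_left 1 _))
    have hsum : ∑ i ∈ Finset.range T, (t i + 1) ≤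
        T * (13 * PG.eval (8 * (v.length + T + 1)) + 2) := by
      have := Finset.sum_le_card_nsmul (Finset.range T) (fun i => t i + 1)
        (13 * PG.eval (8 * (v.length + T + 1)) + 2) fun i hi => by
          have h1 := ht i
          have h2 : PG.eval (8 * (v.length + (i + 1) + 1)) ≤ PG.eval (8 * (v.length + T + 1)) :=
            PG.eval_mono_nat (by have := Finset.mem_range.1 hi; omega)
          omega
      simpa using this
    have h1 : PF.eval (8 * v.length + 1) ≤ PF.eval (8 * (v.length + T + 1)) :=
      PF.eval_mono_nat (by omega)
    have h2 : PG.eval (8 * (v.length + 0 + 1)) ≤ PG.eval (8 * (v.length + T + 1)) :=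
      PG.eval_mono_nat (by omega)
    have hR : R.eval (v.length + T + 1) = 30 * (v.length + T + 1) + 5 +
        PF.eval (8 * (v.length + T + 1)) +
        (v.length + T + 1) * (13 * PG.eval (8 * (v.length + T + 1)) + 2) := by
      simp [R]
    rw [hR]
    have h3 : (T + 1) * (13 * PG.eval (8 * (v.length + T + 1)) + 2) ≤
        (v.length + T + 1) * (13 * PG.eval (8 * (v.length + T + 1)) + 2) :=
      Nat.mul_le_mul_right _ (by omega)
    rw [Nat.add_mul T 1] at h3
    simp only [List.length_nil] at ht₀
    omega
  · rw [TM.shows, (htick T).2]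
    exact readWord_outWord _

end Frag

end Machines

open MeasureTheory ProbabilityTheory

/-! ### The statistics of a selection on held-out samples -/

section Selection

variable {E : Type*}

/-- The number of those samples with a number `≥ m` that are in `S`. -/
noncomputable def lateHits (m : ℕ) (S : Set E) {n : ℕ} (Z : Fin n → E) : ℕ :=
  {j : Fin n | m ≤ (j : ℕ) ∧ Z j ∈ S}.ncard

theorem lateHits_eq_sum {m N : ℕ} (S : Set E) (Z : Fin (m + N) → E) :
    (lateHits m S Z : ℝ) = ∑ i, S.indicator (1 : E → ℝ) (Z (Fin.natAdd m i)) := by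
  classical
  have h : {j : Fin (m + N) | m ≤ (j : ℕ) ∧ Z j ∈ S} =
      Fin.natAdd m '' {i : Fin N | Z (Fin.natAdd m i) ∈ S} := by
    ext j
    constructor
    · rintro ⟨h1, h2⟩
      refine ⟨⟨j - m, by omega⟩, ?_, Fin.ext ?_⟩
      · rw [Set.mem_ofPred_eq]
        convert h2 using 2
        exact Fin.ext (by simp; omega)
      · simp; omega
    · rintro ⟨i, h1, rfl⟩
      exact ⟨by simp, h1⟩
  rw [lateHits, h, Set.ncard_image_of_injective _ (Fin.natAdd_injective N m),
    Set.ncard_eq_toFinset_card', Set.toFinset_ofPred, Finset.card_filter]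
  push_cast
  exact Finset.sum_congr rfl fun i _ => by simp [Set.indicator_apply]

variable [MeasurableSpace E] (D : Measure E)

/-- The probability of `S` minus its frequency in the sample `w`. -/
noncomputable def freqGap {N : ℕ} (S : Set E) (w : Fin N → E) : ℝ :=
  ∑ i, (D.real S - S.indicator 1 (w i)) / N

theorem freqGap_eq {N : ℕ} (hN : 0 < N) (S : Set E) (w : Fin N → E) :
    freqGap D S w = D.real S - (∑ i, S.indicator (1 : E → ℝ) (w i)) / N := by
  have : (N : ℝ) ≠ 0 := by positivity
  rw [freqGap, ← Finset.sum_div, Finset.sum_sub_distrib, sub_div, Finset.sum_const,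
    Finset.card_univ, Fintype.card_fin, nsmul_eq_mul, mul_div_cancel_left₀ _ this]

variable [IsProbabilityMeasure D]

theorem abs_freqGap_le {N : ℕ} (hN : 0 < N) (S : Set E) (w : Fin N → E) : |freqGap D S w| ≤ 1 := by
  have h0 : (0 : ℝ) < N := by positivity
  have h1 : ∀ i, |(D.real S - S.indicator 1 (w i)) / N| ≤ 1 / N := fun i => by
    rw [abs_div, Nat.abs_cast]
    refine div_le_div_of_nonneg_right ?_ h0.le
    have h2 : D.real S ≤ 1 := measureReal_le_one
    have h3 : 0 ≤ D.real S := measureReal_nonneg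
    by_cases h : w i ∈ S
    · rw [Set.indicator_of_mem h, abs_le]; simp only [Pi.one_apply]; constructor <;> linarith
    · rw [Set.indicator_of_notMem h, abs_le]; constructor <;> linarith
  refine (Finset.abs_sum_le_sum_abs _ _).trans ((Finset.sum_le_sum fun i _ => h1 i).trans ?_)
  rw [Finset.sum_const, Finset.card_univ, Fintype.card_fin, nsmul_eq_mul, mul_one_div,
    div_self h0.ne']

/-- A sample of size `m + N` amounts to independent samples of the sizes `m` and `N`. -/
theorem measurePreserving_split {m N : ℕ} :
    MeasurePreserving (fun Z : Fin (m + N) → E =>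
        ((fun i => Z (Fin.castAdd N i) : Fin m → E), (fun i => Z (Fin.natAdd m i) : Fin N → E)))
      (Measure.pi fun _ => D) ((Measure.pi fun _ => D).prod (Measure.pi fun _ => D)) := by
  have h1 := (measurePreserving_piCongrLeft (fun _ : Fin (m + N) => D)
    (finSumFinEquiv (m := m) (n := N))).symm
  have h2 := measurePreserving_sumPiEquivProdPi (fun _ : Fin m ⊕ Fin N => D)
  exact h2.comp h1

variable [Countable E] [MeasurableSingletonClass E]

theorem integral_exp_sub_indicator_le (S : Set E) (t : ℝ) :
    ∫ z, Real.exp (t * (D.real S - S.indicator 1 z)) ∂D ≤ Real.exp (t ^ 2 / 8) := by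
  have h := hasSubgaussianMGF_of_mem_Icc (μ := D) (X := fun z => -S.indicator 1 z) (a := -1) (b := 0)
    Measurable.of_discrete.aemeasurable (ae_of_all _ fun z => by
      by_cases h : z ∈ S <;> simp [h])
  have h' := h.mgf_le t
  rw [integral_neg, integral_indicator_one (MeasurableSet.of_discrete)] at h'
  have hc : ((‖(0 : ℝ) - -1‖₊ / 2) ^ 2 : NNReal) * t ^ 2 / 2 = t ^ 2 / 8 := by
    simp; ring
  rw [hc] at h'
  refine le_of_eq_of_le ?_ h'
  rw [mgf]
  congr 1
  funext z
  ring_nf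

theorem integral_exp_freqGap_le {N : ℕ} (hN : 0 < N) (S : Set E) (t : ℝ) :
    ∫ w : Fin N → E, Real.exp (t * freqGap D S w) ∂(Measure.pi fun _ => D) ≤
      Real.exp (t ^ 2 / (8 * N)) := by
  have h0 : (N : ℝ) ≠ 0 := by positivity
  have h1 : ∀ w : Fin N → E, Real.exp (t * freqGap D S w) =
      ∏ i, Real.exp (t / N * (D.real S - S.indicator 1 (w i))) := fun w => by
    rw [← Real.exp_sum, freqGap, Finset.mul_sum]
    congr 1
    exact Finset.sum_congr rfl fun i _ => by ring
  simp only [h1]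
  rw [integral_fintype_prod_eq_pow (fun z => Real.exp (t / N * (D.real S - S.indicator 1 z))),
    Fintype.card_fin]
  refine (pow_le_pow_left₀ (integral_nonneg fun z => (Real.exp_pos _).le)
    (integral_exp_sub_indicator_le D S _) N).trans_eq ?_
  rw [← Real.exp_nat_mul]
  congr 1
  field_simp

theorem integral_freqGap {N : ℕ} (S : Set E) :
    ∫ w : Fin N → E, freqGap D S w ∂(Measure.pi fun _ => D) = 0 := by
  have hint : Integrable (S.indicator (1 : E → ℝ)) D :=
    (integrable_const 1).indicator MeasurableSet.of_discrete
  have hint' : Integrable (fun z => (D.real S - S.indicator 1 z) / N) D :=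
    ((integrable_const _).sub hint).div_const _
  unfold freqGap
  rw [integral_finsetSum _ fun i _ => integrable_comp_eval (μ := fun _ : Fin N => D) (i := i) hint']
  refine Finset.sum_eq_zero fun i _ => ?_
  rw [integral_comp_eval (μ := fun _ : Fin N => D) (i := i)
      (f := fun z => (D.real S - S.indicator 1 z) / N) hint'.aestronglyMeasurable,
    integral_div, integral_sub (integrable_const _) hint,
    integral_indicator_one MeasurableSet.of_discrete]
  simp

/-- If, among finitely many sets that depend only on the first `m` samples, one with the fewest hits
among the other `N` samples is selected, then the expected probability of the selected set is larger
than that of any fixed one of the sets by at most `√(L / (2 N))`, where `L` bounds the logarithm of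
the number of sets. -/
theorem integral_selected_le {ι : Type*} {m N n : ℕ} (h : m + N = n) (hN : 0 < N) (κ : Finset ι)
    {B : ι → (Fin m → E) → Set E} {b : (Fin n → E) → Set E}
    (hb : ∀ Z : Fin n → E, ∃ j ∈ κ, b Z = B j (fun i => Z (Fin.castLE (by omega) i)) ∧
      ∀ i ∈ κ, lateHits m (b Z) Z ≤ lateHits m (B i fun i => Z (Fin.castLE (by omega) i)) Z)
    {i : ι} (hi : i ∈ κ) {L : ℝ} (hL : 0 < L) (hκ : Real.log κ.card ≤ L) :
    ∫ Z, D.real (b Z) ∂(Measure.pi fun _ => D) ≤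
      (∫ z, D.real (B i z) ∂(Measure.pi fun _ => D)) + √(L / (2 * N)) := by
  subst h
  have hN' : (0 : ℝ) < N := by positivity
  have hcard : 0 < κ.card := Finset.card_pos.2 ⟨i, hi⟩
  set μ := (Measure.pi fun _ : Fin m => D).prod (Measure.pi fun _ : Fin N => D) with hμ
  set t : ℝ := √(8 * N * L) with ht
  have ht0 : 0 < t := Real.sqrt_pos.2 (by positivity)
  have ht2 : t ^ 2 = 8 * N * L := Real.sq_sqrt (by positivity)
  set c : ℝ := L + t ^ 2 / (8 * N) with hc
  -- the bound for one sample, as a function of its two parts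
  let f : (Fin m → E) × (Fin N → E) → ℝ := fun p => D.real (B i p.1) - freqGap D (B i p.1) p.2 +
    (c + (∑ j ∈ κ, Real.exp (t * freqGap D (B j p.1) p.2)) / Real.exp c - 1) / t
  have hpoint : ∀ Z : Fin (m + N) → E, D.real (b Z) ≤
      f (fun i => Z (Fin.castAdd N i), fun i => Z (Fin.natAdd m i)) := by
    intro Z
    obtain ⟨j, hj, hbj, hle⟩ := hb Z
    have h1 := hle i hi
    rw [hbj] at h1 ⊢
    change lateHits m (B j fun i => Z (Fin.castAdd N i)) Z ≤
      lateHits m (B i fun i => Z (Fin.castAdd N i)) Z at h1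
    change D.real (B j fun i => Z (Fin.castAdd N i)) ≤ _
    generalize (fun i => Z (Fin.castAdd N i)) = z at *
    have h2 : (lateHits m (B j z) Z : ℝ) / N ≤ lateHits m (B i z) Z / N :=
      div_le_div_of_nonneg_right (by exact_mod_cast h1) hN'.le
    rw [lateHits_eq_sum, lateHits_eq_sum] at h2
    have h3 := freqGap_eq D hN (B j z) fun i => Z (Fin.natAdd m i)
    have h4 := freqGap_eq D hN (B i z) fun i => Z (Fin.natAdd m i)
    generalize (fun i => Z (Fin.natAdd m i)) = w at *
    -- the tangent of the exponential function at `c`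
    have h5 : t * freqGap D (B j z) w ≤
        c + (∑ j ∈ κ, Real.exp (t * freqGap D (B j z) w)) / Real.exp c - 1 := by
      have h6 := Real.add_one_le_exp (t * freqGap D (B j z) w - c)
      rw [Real.exp_sub] at h6
      have h7 : Real.exp (t * freqGap D (B j z) w) / Real.exp c ≤
          (∑ j ∈ κ, Real.exp (t * freqGap D (B j z) w)) / Real.exp c :=
        div_le_div_of_nonneg_right (Finset.single_le_sum
          (f := fun j => Real.exp (t * freqGap D (B j z) w))
          (fun j _ => (Real.exp_pos _).le) hj) (Real.exp_pos _).le
      linarith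
    have h6 : freqGap D (B j z) w ≤
        (c + (∑ j ∈ κ, Real.exp (t * freqGap D (B j z) w)) / Real.exp c - 1) / t := by
      rw [le_div_iff₀ ht0]; linarith
    simp only [f]
    linarith
  have hint1 : ∀ {k : ℕ} (g : (Fin k → E) → Set E),
      Integrable (fun z => D.real (g z)) (Measure.pi fun _ : Fin k => D) := fun g =>
    Integrable.of_bound Measurable.of_discrete.aestronglyMeasurable 1
      (ae_of_all _ fun z => by
        rw [Real.norm_eq_abs, abs_of_nonneg measureReal_nonneg]; exact measureReal_le_one)
  have hint2 : Integrable (fun p : (Fin m → E) × (Fin N → E) => D.real (B i p.1)) μ :=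
    Integrable.of_bound Measurable.of_discrete.aestronglyMeasurable 1
      (ae_of_all _ fun z => by
        rw [Real.norm_eq_abs, abs_of_nonneg measureReal_nonneg]; exact measureReal_le_one)
  have hint3 : Integrable (fun p : (Fin m → E) × (Fin N → E) => freqGap D (B i p.1) p.2) μ :=
    Integrable.of_bound Measurable.of_discrete.aestronglyMeasurable 1
      (ae_of_all _ fun z => abs_freqGap_le D hN _ _)
  have hint4 : ∀ j, Integrable
      (fun p : (Fin m → E) × (Fin N → E) => Real.exp (t * freqGap D (B j p.1) p.2)) μ := fun j =>
    Integrable.of_bound Measurable.of_discrete.aestronglyMeasurable (Real.exp t)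
      (ae_of_all _ fun z => by
        rw [Real.norm_eq_abs, Real.abs_exp, Real.exp_le_exp]
        have := (abs_le.1 (abs_freqGap_le D hN (B j z.1) z.2)).2
        nlinarith)
  have hint5 : Integrable (fun p : (Fin m → E) × (Fin N → E) =>
      (c + (∑ j ∈ κ, Real.exp (t * freqGap D (B j p.1) p.2)) / Real.exp c - 1) / t) μ :=
    ((((integrable_const c).add
      ((integrable_finsetSum κ fun j _ => hint4 j).div_const _)).sub (integrable_const 1)).div_const t)
  have hintf : Integrable f μ := (hint2.sub hint3).add hint5
  have hsplit := measurePreserving_split D (m := m) (N := N)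
  have h1 : ∫ Z, D.real (b Z) ∂(Measure.pi fun _ => D) ≤ ∫ p, f p ∂μ := by
    rw [← hμ] at hsplit
    rw [← hsplit.map_eq, integral_map hsplit.measurable.aemeasurable
      Measurable.of_discrete.aestronglyMeasurable]
    exact integral_mono (hint1 b) (hsplit.integrable_comp_of_integrable hintf) hpoint
  have h2 : ∫ p, D.real (B i p.1) ∂μ = ∫ z, D.real (B i z) ∂(Measure.pi fun _ => D) := by
    rw [hμ, integral_fun_fst fun z => D.real (B i z)]
    simp
  have h3 : ∫ p, freqGap D (B i p.1) p.2 ∂μ = 0 := by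
    rw [integral_prod _ hint3]
    simp only [integral_freqGap, integral_zero]
  have h4 : ∀ j, ∫ p, Real.exp (t * freqGap D (B j p.1) p.2) ∂μ ≤ Real.exp (t ^ 2 / (8 * N)) := by
    intro j
    rw [integral_prod _ (hint4 j)]
    refine (integral_mono (hint4 j).integral_prod_left (integrable_const _) fun z =>
      integral_exp_freqGap_le D hN (B j z) t).trans_eq ?_
    simp
  have h5 : ∑ j ∈ κ, ∫ p, Real.exp (t * freqGap D (B j p.1) p.2) ∂μ ≤ Real.exp c := by
    refine (Finset.sum_le_sum fun j _ => h4 j).trans ?_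
    rw [Finset.sum_const, nsmul_eq_mul, hc, Real.exp_add]
    refine mul_le_mul_of_nonneg_right ?_ (Real.exp_pos _).le
    rwa [← Real.log_le_iff_le_exp (by exact_mod_cast hcard)]
  have h6 : ∫ p, f p ∂μ ≤ (∫ z, D.real (B i z) ∂(Measure.pi fun _ => D)) + c / t := by
    have e : ∫ p, f p ∂μ = (∫ p, D.real (B i p.1) ∂μ) - (∫ p, freqGap D (B i p.1) p.2 ∂μ) +
        (c + (∑ j ∈ κ, ∫ p, Real.exp (t * freqGap D (B j p.1) p.2) ∂μ) / Real.exp c - 1) / t := by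
      rw [← integral_finsetSum κ fun j _ => hint4 j, ← integral_sub hint2 hint3,
        ← integral_div]
      have e1 : c - 1 = ∫ _, (c - 1) ∂μ := by simp
      have e2 : (∫ p, (∑ j ∈ κ, Real.exp (t * freqGap D (B j p.1) p.2)) / Real.exp c ∂μ) + (c - 1) =
          ∫ p, ((∑ j ∈ κ, Real.exp (t * freqGap D (B j p.1) p.2)) / Real.exp c + (c - 1)) ∂μ := by
        rw [integral_add ((integrable_finsetSum κ fun j _ => hint4 j).div_const _)
          (integrable_const _), ← e1]
      rw [add_sub_right_comm, add_comm (c - 1), e2, ← integral_div, ← integral_add]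
      · refine integral_congr_ae (ae_of_all _ fun p => ?_)
        simp only [f]
        ring
      · exact hint2.sub hint3
      · exact (((integrable_finsetSum κ fun j _ => hint4 j).div_const _).add
          (integrable_const _)).div_const t
    rw [e, h2, h3, sub_zero]
    have := div_le_one_of_le₀ h5 (Real.exp_pos c).le
    gcongr
    linarith
  have h7 : c / t = √(L / (2 * N)) := by
    symm
    rw [Real.sqrt_eq_iff_mul_self_eq (by positivity) (by positivity)]
    rw [div_mul_div_comm, ← sq t, ht2, hc, ht2]
    field_simp
    ring
  linarith

end Selection

/-! ### Time budgets -/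

theorem TM.run_eq_of_halted {M : TM} {v : List TapeSym} {s t : ℕ} (h : M.Halted (M.run v s))
    (hst : s ≤ t) : M.run v t = M.run v s := by
  obtain ⟨d, rfl⟩ := Nat.exists_eq_add_of_le' hst
  change (fun c => (M.step c).getD c)^[d + s] (M.init v) = _
  rw [Function.iterate_add_apply]
  have hfix : (fun c => (M.step c).getD c) (M.run v s) = M.run v s := by
    change (M.step (M.run v s)).getD _ = _
    rw [show M.step (M.run v s) = none from h, Option.getD_none]
  exact Function.iterate_fixed (f := fun c => (M.step c).getD c) hfix d

theorem TM.result_mono {M : TM} {v : List TapeSym} {s t : ℕ} {w : List Bool}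
    (h : M.result v s = some w) (hst : s ≤ t) : M.result v t = some w := by
  unfold TM.result at h ⊢
  split at h
  · rename_i hs
    rw [TM.shows, TM.run_eq_of_halted hs hst, if_pos hs]
    exact h
  · cases h

section Budget

variable {X Y : Type*} {encX : X → List Bool} {encY : Y → List Bool}

theorem Predicts.mono {s t : ℕ} {f : Option (List Bool)} {z : X × Y}
    (h : Predicts encX encY s f z) (hst : s ≤ t) : Predicts encX encY t f z :=
  let ⟨w, hw, h⟩ := h
  ⟨w, hw, TM.result_mono h hst⟩

theorem Predicts.learned_mono {i s t m : ℕ} {Z : Fin m → X × Y} {z : X × Y}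
    (h : Predicts encX encY s (learned encX encY i s Z) z) (hst : s ≤ t) :
    Predicts encX encY t (learned encX encY i t Z) z :=
  let ⟨w, hw, h⟩ := h
  ⟨w, TM.result_mono hw hst, TM.result_mono h hst⟩

end Budget

theorem log_floor_log_le {n : ℕ} (h : 1 ≤ Real.log n) :
    Real.log ⌊Real.log n⌋₊ ≤ Real.log (Real.log n) + Real.log 2 := by
  have h1 : (0 : ℝ) < ⌊Real.log n⌋₊ := by exact_mod_cast Nat.floor_pos.2 h
  have h2 := Real.log_le_log h1 (Nat.floor_le (by linarith))
  have h3 := Real.log_pos one_lt_two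
  linarith

theorem floor_div_log_le {n : ℕ} (h : 1 ≤ Real.log n) (T : ℕ) :
    ⌊(T : ℝ) / Real.log n⌋₊ ≤ T / ⌊Real.log n⌋₊ := by
  have h1 : (0 : ℝ) < ⌊Real.log n⌋₊ := by exact_mod_cast Nat.floor_pos.2 h
  rw [← Nat.floor_div_eq_div (K := ℝ)]
  exact Nat.floor_mono (div_le_div_of_nonneg_left (Nat.cast_nonneg _) h1 (Nat.floor_le (by linarith)))

/-- One percent of the samples suffices for the bound on the selection error. -/
theorem sqrt_heldOut_le {n : ℕ} (hn : 0 < n) {L : ℝ} (hL : 0 ≤ L) :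
    √(L / (2 * ((n - 99 * n / 100 : ℕ) : ℝ))) ≤ 10 * √2 * √(L / n) := by
  have hn' : (0 : ℝ) < n := by exact_mod_cast hn
  have h1 : (n : ℝ) ≤ 100 * ((n - 99 * n / 100 : ℕ) : ℝ) := by
    exact_mod_cast (by omega : n ≤ 100 * (n - 99 * n / 100))
  have h2 : 10 * √2 * √(L / n) = √(200 * (L / n)) := by
    rw [Real.sqrt_mul (by norm_num), show (200 : ℝ) = 10 ^ 2 * 2 by norm_num,
      Real.sqrt_mul (by norm_num), Real.sqrt_sq (by norm_num)]
  rw [h2]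
  refine Real.sqrt_le_sqrt ?_
  rw [div_le_iff₀ (by linarith), mul_div_assoc', div_mul_eq_mul_div, le_div_iff₀ hn']
  nlinarith

/-! ### The continuous universal learner -/

theorem lemma2 {X Y : Type*} [MeasurableSpace X] [MeasurableSingletonClass X]
    [MeasurableSpace Y] [MeasurableSingletonClass Y]
    (encX : X → List Bool) (hencX : Function.Injective encX)
    (encY : Y → List Bool) (hencY : Function.Injective encY) :
    ∃ (A : TM) (tick : Set A.Q) (c : ℕ),
      -- the machine runs continuously and its clock ticks forever; the time that passes until
      -- tick `T` is polynomial in the length of the input and `T`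
      (∀ (n : ℕ) (Z : Fin n → X × Y),
        (∀ t, ¬ A.Halted (A.run (encodeSamples encX encY Z) t)) ∧
        {t | A.TicksAt tick (encodeSamples encX encY Z) t}.Infinite ∧
        ∀ T : ℕ, A.tickTime tick (encodeSamples encX encY Z) T ≤
          c * ((encodeSamples encX encY Z).length + T + 1) ^ c) ∧
      -- the clock counts the steps of the parallel simulation of the first `log n` machines, and
      -- at each tick the current best predictor is on the output tape
      (∀ (n : ℕ) (Z : Fin n → X × Y) (T : ℕ), 1 ≤ ⌊Real.log n⌋₊ →
        IsCurrentBest encX encY ⌊Real.log n⌋₊ (T / ⌊Real.log n⌋₊) Z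
          (A.shows (encodeSamples encX encY Z)
            (A.tickTime tick (encodeSamples encX encY Z) T))) ∧
      -- at whatever time `T` it is halted, its output competes with the first `log n` machines
      ∀ (D : MeasureTheory.Measure (X × Y)) [MeasureTheory.IsProbabilityMeasure D]
        (n T i : ℕ), 1 ≤ i → (i : ℝ) ≤ Real.log n →
        ∫ Z : Fin n → X × Y,
            testError encX encY D T
              (A.shows (encodeSamples encX encY Z)
                (A.tickTime tick (encodeSamples encX encY Z) T))
            ∂(MeasureTheory.Measure.pi fun _ => D) ≤
          (∫ Z : Fin (99 * n / 100) → X × Y,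
            testError encX encY D ⌊(T : ℝ) / Real.log n⌋₊
              (learned encX encY i ⌊(T : ℝ) / Real.log n⌋₊ Z)
            ∂(MeasureTheory.Measure.pi fun _ => D)) +
          10 * √2 * √((Real.log (Real.log n) + Real.log 2) / n) := by
  obtain ⟨A, tick, c, hA⟩ := Frag.exists_learner
  have hA' := fun {n : ℕ} (Z : Fin n → X × Y) => hA _ (encodeSamples_ne_blank encX encY Z)
  have hbest : ∀ (n : ℕ) (Z : Fin n → X × Y) (T : ℕ), 1 ≤ ⌊Real.log n⌋₊ →
      IsCurrentBest encX encY ⌊Real.log n⌋₊ (T / ⌊Real.log n⌋₊) Z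
        (A.shows (encodeSamples encX encY Z)
          (A.tickTime tick (encodeSamples encX encY Z) T)) := by
    intro n Z T hn
    rw [((hA' Z).2.2 T).2]
    exact isCurrentBest_bestOutput encX encY Z T hn
  refine ⟨A, tick, c, fun n Z => ⟨(hA' Z).1, (hA' Z).2.1, fun T => ((hA' Z).2.2 T).1⟩, hbest, ?_⟩
  intro D _ n T i hi hin
  have : Countable X := hencX.countable
  have : Countable Y := hencY.countable
  have hlog : 1 ≤ Real.log n := le_trans (by exact_mod_cast hi) hin
  have hk : 1 ≤ ⌊Real.log n⌋₊ := Nat.floor_pos.2 hlog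
  have hn : 0 < n := Nat.pos_of_ne_zero fun h => by simp [h] at hlog; linarith
  set k := ⌊Real.log n⌋₊
  set s := T / k
  set s' := ⌊(T : ℝ) / Real.log n⌋₊
  have hs : s' ≤ s := floor_div_log_le hlog T
  have hL : 0 < Real.log (Real.log n) + Real.log 2 := by
    have h1 := Real.log_nonneg hlog
    have h2 := Real.log_pos one_lt_two
    linarith
  let out : (Fin n → X × Y) → Option (List Bool) := fun Z =>
    A.shows (encodeSamples encX encY Z) (A.tickTime tick (encodeSamples encX encY Z) T)
  have hsel := integral_selected_le D (m := 99 * n / 100) (N := n - 99 * n / 100) (n := n)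
    (by omega) (by omega) (Finset.Icc 1 k)
    (B := fun j Z => {z | ¬ Predicts encX encY s (learned encX encY j s Z) z})
    (b := fun Z => {z | ¬ Predicts encX encY s (out Z) z}) (fun Z => by
      obtain ⟨j, hj, h1, h2⟩ := hbest n Z T hk
      refine ⟨j, Finset.mem_Icc.2 hj, ?_, fun i hi => h2 i (Finset.mem_Icc.1 hi)⟩
      simp only [out, h1]
      rfl)
    (Finset.mem_Icc.2 ⟨hi, Nat.le_floor hin⟩) hL
    (by rw [Nat.card_Icc, Nat.add_sub_cancel]; exact log_floor_log_le hlog)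
  have hint : ∀ {m : ℕ} (g : (Fin m → X × Y) → Set (X × Y)),
      Integrable (fun Z => D.real (g Z)) (Measure.pi fun _ : Fin m => D) := fun g =>
    Integrable.of_bound Measurable.of_discrete.aestronglyMeasurable 1
      (ae_of_all _ fun z => by
        rw [Real.norm_eq_abs, abs_of_nonneg measureReal_nonneg]; exact measureReal_le_one)
  -- the predictor gets `T ≥ s` steps, the learner that it competes with gets `s' ≤ s` steps
  refine (integral_mono (hint _) (hint fun Z => {z | ¬ Predicts encX encY s (out Z) z})
    fun Z => measureReal_mono fun z (hz : ¬ Predicts encX encY T (out Z) z) h =>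
      hz (h.mono (Nat.div_le_self _ _))).trans
    (hsel.trans (add_le_add (integral_mono (hint _) (hint _)
      fun Z => measureReal_mono fun z hz h => hz (h.learned_mono hs)) (sqrt_heldOut_le hn hL.le)))
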